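/- **Detecting arbitrary angles.** Let $P\subset\mathbb C$ be a polygonal billiard table: a compact planar region with connected interior, bounded by finitely many labelled straight edges, where distinct edges meet only at common endpoints and every vertex is an endpoint of exactly two edges (the boundary may have several components, and straight angles are allowed). Let $\mathcal A$ be the set of edge labels, and let $\mathsf B(P)\subset\mathcal A^{\mathbb Z}$ be the set of bounce sequences of all bi-infinite billiard trajectories on $P$ that never hit a vertex. Let $\overline{\mathsf B(P)}$ be its closure in $\mathcal A^{\mathbb Z}$, with $\mathcal A$ discrete. Let $A$ and $B$ be adjacent edges that meet at the vertex $p$, with interior angle $\theta\in(0,2\pi)$, named so that inside $P$ the edge $B$ is reached from $A$ by turning counterclockwise about $p$ through $\theta$. Sequences $S_1,\dots,S_\ell\in\overline{\mathsf B(P)}$, in each of which a finite, possibly empty, block of consecutive positions (the *insertion* of $S_i$) has been chosen, form a *collection of matching sequences* for $\{A,B\}$ if 1. there is an integer $k>0$ such that every insertion has length $k-1$ or $k$; 2. the insertions of $S_1,\dots,S_\ell$, read one after the other, form a string in which $A$ and $B$ alternate; 3. for $1\le i<\ell$ and every $n$, the $n$ symbols of $S_i$ after its insertion are, in reverse order,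 the $n$ symbols of $S_{i+1}$ before its insertion; 4. if the insertion of $S_i$ is empty, then $S_i$ grazes $p$ there. That is, the two symbols next to the empty insertion are neither $A$ nor $B$, and $S_i$ is a limit of bounce sequences of trajectories that never hit a vertex and that, between those two bounces, pass arbitrarily close to $p$, turning about $p$ towards the next letter $X\in\{A,B\}$ of the alternation (so $p$ lies to their left if $X=B$ and to their right if $X=A$). Here $X$ is the letter with which the previous nonempty insertion did not end; if all previous insertions are empty, it is the starting letter of the alternation, which is chosen once for the collection. Then there is an infinite list $S_1,S_2,\dots$ all of whose finite initial parts are collections of matching sequences for $\{A,B\}$. Moreover, $\theta$ is the limit, as the number of matching sequences goes to infinity, of $$\pi\cdot\frac{\text{number of matching sequences}}{\text{total length of inserted $A$s and $B$s}}\;=\;\frac{\pi}{\text{average length of insertion}} .$$ Precisely: for every $\varepsilon>0$ there is an $L$ such that for every $\ell\ge L$ and every collection $S_1,\dots,S_\ell$ of matching sequences for $\{A,B\}$, with insertions of total length $N$, we have $N>0$, $\left|\pi\,\ell/N-\theta\right|<\varepsilon$ and $\pi\,\ell/N=\pi/(N/\ell)$. -/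

import Mathlib

/-- A polygonal billiard table in the plane, with boundary edges labelled by `𝒜`.
The edge `e` is the segment from `start e` to `start (next e)`; distinct edges meet only where
one follows the other. The table itself is the compact set `region`; its boundary is the union of
the edges, its interior is connected, and the edges are directed so that the interior lies to their
left. The boundary may have several components, and straight angles are allowed. -/
structure BilliardTable (𝒜 : Type*) where
  start : 𝒜 → ℂ
  next : Equiv.Perm 𝒜
  region : Set ℂ
  start_injective : Function.Injective start
  next_ne : ∀ e, next e ≠ e
  edge_inter : ∀ e f, e ≠ f → ∀ x ∈ segment ℝ (start e) (start (next e)),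
    x ∈ segment ℝ (start f) (start (next f)) →
      (x = start e ∧ next f = e) ∨ (x = start f ∧ next e = f)
  isCompact_region : IsCompact region
  isConnected_interior : IsConnected (interior region)
  frontier_region : frontier region = ⋃ e, segment ℝ (start e) (start (next e))
  interior_left : ∀ e, ∀ x ∈ openSegment ℝ (start e) (start (next e)),
    ∀ᶠ t : ℝ in nhdsWithin 0 (Set.Ioi 0),
      x + (t : ℂ) * (Complex.I * (start (next e) - start e)) ∈ interior region

namespace BilliardTable

variable {𝒜 : Type*} (P : BilliardTable 𝒜)

/-- The vector along the edge `e`, from its first to its last endpoint. -/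
def edgeVec (e : 𝒜) : ℂ := P.start (P.next e) - P.start e

/-- The interior angle, in `(0, 2π)`, at the first endpoint of `A`, between `A` and the preceding
edge. As the interior lies to the left of the edges, it is the counterclockwise angle from `A` to the
preceding edge. -/
noncomputable def interiorAngle (A : 𝒜) : ℝ :=
  toIcoMod Real.two_pi_pos 0
    (Complex.arg ((P.start (P.next.symm A) - P.start A) / P.edgeVec A))

/-- The linear reflection of `v` in the line spanned by the nonzero vector `u`. -/
noncomputable def reflectAlong (u v : ℂ) : ℂ := u * (starRingEnd ℂ) (v / u)

/-- A nonsingular bi-infinite billiard trajectory, described by its bounces: the `i`-th bounce is at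
`point i`, which is not a vertex, on the edge `edge i`; the trajectory leaves it in
the direction `dir i` and runs through the interior of the table over the distance `len i` to the
next bounce, where the direction is reflected in the edge. -/
structure Trajectory where
  edge : ℤ → 𝒜
  point : ℤ → ℂ
  dir : ℤ → ℂ
  len : ℤ → ℝ
  norm_dir : ∀ i, ‖dir i‖ = 1
  len_pos : ∀ i, 0 < len i
  point_mem : ∀ i, point i ∈ openSegment ℝ (P.start (edge i)) (P.start (P.next (edge i)))
  point_succ : ∀ i, point (i + 1) = point i + (len i : ℂ) * dir i
  chord_subset : ∀ i, openSegment ℝ (point i) (point (i + 1)) ⊆ interior P.region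
  dir_succ : ∀ i, dir (i + 1) = reflectAlong (P.edgeVec (edge (i + 1))) (dir i)

/-- The bounce spectrum: the bounce sequences of all nonsingular trajectories. -/
def bounceSpectrum : Set (ℤ → 𝒜) := Set.range fun τ : P.Trajectory => τ.edge

end BilliardTable

/-- A bi-infinite sequence of labels with a chosen finite, possibly empty, string in it: the string
occupies the positions `pos, …, pos + len - 1`. -/
structure InsertedSequence (𝒜 : Type*) where
  seq : ℤ → 𝒜
  pos : ℤ
  len : ℕ

/-- The alternating infinite word `A B A B …`. -/
def alternatingLetter {𝒜 : Type*} (A B : 𝒜) (m : ℕ) : 𝒜 := if Even m then A else B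

/-- The total length of the strings of the first `ℓ` sequences. -/
def totalInsertion {𝒜 : Type*} (S : ℕ → InsertedSequence 𝒜) (ℓ : ℕ) : ℕ :=
  ∑ i ∈ Finset.range ℓ, (S i).len

namespace BilliardTable

variable {𝒜 : Type*} (P : BilliardTable 𝒜)

/-- For a sequence `s` with empty string, a vertex `p` at which the edge `B` ends and the edge `A`
starts, and `X` one of `A`, `B`: the labels next to the empty string are neither `A` nor `B`, and `s`
is the limit of bounce sequences of nonsingular trajectories
that, at the place of the empty string, pass arbitrarily close to `p`, turning about `p` towards the
edge `X`. That is, `p` is on their left (they turn counterclockwise) if `X = B`, and on their right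
if `X = A`. -/
def GrazesVertex (A B X : 𝒜) (s : InsertedSequence 𝒜) : Prop :=
  s.seq (s.pos - 1) ≠ A ∧ s.seq (s.pos - 1) ≠ B ∧ s.seq s.pos ≠ A ∧ s.seq s.pos ≠ B ∧
  ∀ n : ℕ, ∀ ε > (0 : ℝ), ∃ τ : P.Trajectory,
    (∀ j : ℤ, -(n : ℤ) ≤ j → j < n → τ.edge j = s.seq (s.pos + j)) ∧
    ∃ q ∈ openSegment ℝ (τ.point (-1)) (τ.point 0), dist q (P.start A) < ε ∧
      (X = B → 0 < ((starRingEnd ℂ) (τ.dir (-1)) * (P.start A - q)).im) ∧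
      (X = A → ((starRingEnd ℂ) (τ.dir (-1)) * (P.start A - q)).im < 0)

/-- The sequences `S 0, …, S (ℓ - 1)` in the closure of the bounce spectrum, with their chosen
strings, form a collection of matching sequences for the edges `A`, `B` (where `A` follows `B`).
The terms `S i` with `ℓ ≤ i` play no role. The strings, read one after the other, alternate between
`A` and `B`; `o` is even or odd according to whether this starts with `A` or with `B`. -/
structure IsMatching [TopologicalSpace 𝒜] (A B : 𝒜) (ℓ : ℕ) (S : ℕ → InsertedSequence 𝒜) :
    Prop where
  mem_closure : ∀ i < ℓ, (S i).seq ∈ closure P.bounceSpectrum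
  lengths : ∃ k > 0, ∀ i < ℓ, (S i).len = k - 1 ∨ (S i).len = k
  insertions : ∃ o : ℕ, ∀ i < ℓ,
    (∀ j < (S i).len, (S i).seq ((S i).pos + j) =
      alternatingLetter A B (o + totalInsertion S i + j)) ∧
    ((S i).len = 0 → P.GrazesVertex A B (alternatingLetter A B (o + totalInsertion S i)) (S i))
  matching : ∀ i, i + 1 < ℓ → ∀ n : ℕ,
    (S i).seq ((S i).pos + (S i).len + n) = (S (i + 1)).seq ((S (i + 1)).pos - 1 - n)

end BilliardTable

/-! Unfold the table about the vertex `p` where `A` starts, and write `θ` for the interior angle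
there. Near `p`, a direction is recorded by its angle from the current letter of the alternation
(`ray`). If a trajectory hits the letter at angle `β`, then reflecting it and measuring from the
next letter replaces `β` by `β + θ` (`reflectAlong_ray`, `ray_succ`). A run of bounces on `A` and
`B` is thus a straight line crossing consecutive copies of a sector, and each crossing needs `0 < β
< π`. An insertion of `n` letters entered at angle `β` is left at angle `β + nθ - π` from the letter
that would come next. A grazing sequence obeys the same rule with `n = 0`, and its `β` lies between
`π` and `θ` up to a small error.

The limit. Trajectories with the same long forward bounce sequence unfold along the same edges. The
table is bounded and the unfolded lengths grow without bound, so their directions are close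
(`Trajectory.exists_dist_dir_le`). The lengths grow because a short piece of trajectory can bounce
many times only at a corner, where the angle rule bounds the number of bounces
(`Trajectory.exists_le_sum_len`). The matching condition therefore gives `β (i + 1) ≈ β i + n i * θ
- π`, at first modulo `2π`, and then exactly as stated because both sides lie in a narrow enough
range. Summing, with all angles bounded, yields `|Nθ - ℓπ| ≤ 4π + 1` (`IsMatching.abs_sub_le`);
division by `N` gives the limit.

Existence. Start from an angle `b` and turn about `p` by `π` again and again, which produces the
rays at angles `b + Mθ - iπ`. For all but countably many `b`, none of them runs into a vertex in any
unfolding (`exists_generic_angle`). The sequence `S i` reads one ray inwards, the letters crossed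
while turning by `π`, and the next ray outwards. Lines parallel to the incoming ray that pass close
to `p` and avoid all unfolded vertices realise every finite window of it
(`IsCornerRadius.exists_trajectory_turning`). Consecutive sequences share a ray, which is the
matching condition. -/

/-! ### Signed areas, connected sets and reflections in the plane -/

/-- The signed area `Im (ū v)` of the parallelogram spanned by `u` and `v`. -/
def crossIm (u v : ℂ) : ℝ := u.re * v.im - u.im * v.re

theorem crossIm_eq (u v : ℂ) : crossIm u v = ((starRingEnd ℂ) u * v).im := by
  simp [crossIm, Complex.mul_im]; ring

theorem crossIm_add_right (u v w : ℂ) : crossIm u (v + w) = crossIm u v + crossIm u w := by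
  simp [crossIm]; ring

theorem crossIm_smul_right (u v : ℂ) (c : ℝ) : crossIm u ((c : ℂ) * v) = c * crossIm u v := by
  simp [crossIm]; ring

theorem crossIm_self (u : ℂ) : crossIm u u = 0 := by simp [crossIm]; ring

theorem crossIm_neg_right (u v : ℂ) : crossIm u (-v) = -crossIm u v := by simp [crossIm]; ring

theorem continuous_crossIm (u : ℂ) : Continuous (crossIm u) := by unfold crossIm; fun_prop

theorem exists_ofReal_mul_of_crossIm_eq_zero {u v : ℂ} (hu : u ≠ 0) (h : crossIm u v = 0) :
    ∃ c : ℝ, v = (c : ℂ) * u := by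
  have h1 : (v / u).im = 0 := by
    unfold crossIm at h
    rw [Complex.div_im, ← sub_div, show v.im * u.re - v.re * u.im = 0 by linarith, zero_div]
  refine ⟨(v / u).re, ?_⟩
  have : ((v / u).re : ℂ) = v / u := by
    apply Complex.ext <;> simp [h1]
  rw [this, div_mul_cancel₀ _ hu]

/-- Off the frontier, the space is the disjoint union of two open sets, the interior and the
complement of the closure. One point thus decides for a whole connected set, which is how the local
shape of the table is found. -/
theorem IsPreconnected.subset_interior_of_disjoint_frontier {X : Type*} [TopologicalSpace X]
    {s t : Set X} (ht : IsPreconnected t) (hd : ∀ x ∈ t, x ∉ frontier s)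
    (hi : ∃ x ∈ t, x ∈ interior s) : t ⊆ interior s := by
  refine ht.subset_left_of_subset_union isOpen_interior (isClosed_closure (s := s)).isOpen_compl
    ?_ ?_ hi
  · rw [Set.disjoint_compl_right_iff_subset]
    exact interior_subset.trans subset_closure
  · intro x hx
    by_contra hc
    simp only [Set.mem_union, Set.mem_compl_iff, not_or, not_not] at hc
    exact hd x hx ⟨hc.2, hc.1⟩

theorem IsPreconnected.notMem_of_disjoint_frontier {X : Type*} [TopologicalSpace X]
    {s t : Set X} (ht : IsPreconnected t) (hd : ∀ x ∈ t, x ∉ frontier s)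
    (hi : ∃ x ∈ t, x ∉ s) : ∀ x ∈ t, x ∉ s := by
  intro x hx hxs
  obtain ⟨y, hy, hys⟩ := hi
  refine hys (interior_subset (ht.subset_interior_of_disjoint_frontier hd ⟨x, hx, ?_⟩ hy))
  by_contra hc
  exact hd x hx ⟨subset_closure hxs, hc⟩

theorem mem_openSegment_iff_ofReal {x y z : ℂ} :
    z ∈ openSegment ℝ x y ↔ ∃ s : ℝ, 0 < s ∧ s < 1 ∧ z = x + (s : ℂ) * (y - x) := by
  rw [openSegment_eq_image']
  constructor
  · rintro ⟨s, ⟨h0, h1⟩, rfl⟩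
    exact ⟨s, h0, h1, by simp⟩
  · rintro ⟨s, h0, h1, rfl⟩
    exact ⟨s, ⟨h0, h1⟩, by simp⟩

theorem mem_segment_iff_ofReal {x y z : ℂ} :
    z ∈ segment ℝ x y ↔ ∃ s : ℝ, 0 ≤ s ∧ s ≤ 1 ∧ z = x + (s : ℂ) * (y - x) := by
  rw [segment_eq_image']
  constructor
  · rintro ⟨s, ⟨h0, h1⟩, rfl⟩
    exact ⟨s, h0, h1, by simp⟩
  · rintro ⟨s, h0, h1, rfl⟩
    exact ⟨s, ⟨h0, h1⟩, by simp⟩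

theorem mem_openSegment_add_mul {x d z : ℂ} {L : ℝ} (hL : 0 < L) :
    z ∈ openSegment ℝ x (x + (L : ℂ) * d) ↔ ∃ t : ℝ, 0 < t ∧ t < L ∧ z = x + (t : ℂ) * d := by
  rw [mem_openSegment_iff_ofReal]
  constructor
  · rintro ⟨s, h0, h1, rfl⟩
    refine ⟨s * L, by positivity, by nlinarith, ?_⟩
    push_cast; ring
  · rintro ⟨t, h0, h1, rfl⟩
    refine ⟨t / L, by positivity, by rwa [div_lt_one hL], ?_⟩
    have : (L : ℂ) ≠ 0 := by exact_mod_cast hL.ne'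
    push_cast; field_simp; ring

theorem reflectAlong_reflectAlong {u : ℂ} (hu : u ≠ 0) (v : ℂ) :
    BilliardTable.reflectAlong u (BilliardTable.reflectAlong u v) = v := by
  unfold BilliardTable.reflectAlong
  rw [mul_div_cancel_left₀ _ hu, Complex.conj_conj, mul_div_cancel₀ _ hu]

theorem reflectAlong_neg (u v : ℂ) :
    BilliardTable.reflectAlong u (-v) = -BilliardTable.reflectAlong u v := by
  unfold BilliardTable.reflectAlong
  rw [neg_div, map_neg, mul_neg]

theorem reflectAlong_add (u v w : ℂ) : BilliardTable.reflectAlong u (v + w) =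
    BilliardTable.reflectAlong u v + BilliardTable.reflectAlong u w := by
  unfold BilliardTable.reflectAlong
  rw [add_div, map_add, mul_add]

theorem reflectAlong_ofReal_mul (u v : ℂ) (c : ℝ) :
    BilliardTable.reflectAlong u ((c : ℂ) * v) = (c : ℂ) * BilliardTable.reflectAlong u v := by
  unfold BilliardTable.reflectAlong
  rw [mul_div_assoc, map_mul, Complex.conj_ofReal]; ring

theorem reflectAlong_self_mul {u : ℂ} (hu : u ≠ 0) (c : ℝ) :
    BilliardTable.reflectAlong u ((c : ℂ) * u) = (c : ℂ) * u := by
  unfold BilliardTable.reflectAlong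
  rw [mul_div_cancel_right₀ _ hu, Complex.conj_ofReal, mul_comm]

theorem norm_reflectAlong {u : ℂ} (hu : u ≠ 0) (v : ℂ) :
    ‖BilliardTable.reflectAlong u v‖ = ‖v‖ := by
  unfold BilliardTable.reflectAlong
  rw [norm_mul, RCLike.norm_conj, norm_div]
  have : ‖u‖ ≠ 0 := norm_ne_zero_iff.2 hu
  field_simp

theorem crossIm_reflectAlong {u : ℂ} (hu : u ≠ 0) (v : ℂ) :
    crossIm u (BilliardTable.reflectAlong u v) = -crossIm u v := by
  obtain ⟨w, rfl⟩ : ∃ w, v = u * w := ⟨v / u, (mul_div_cancel₀ _ hu).symm⟩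
  unfold BilliardTable.reflectAlong
  rw [mul_div_cancel_left₀ _ hu]
  simp [crossIm]; ring

/-! ### Edges, and the table near an interior point of an edge -/

namespace BilliardTable

variable {𝒜 : Type*} (P : BilliardTable 𝒜)

/-- The closed segment spanned by an edge. -/
def side (e : 𝒜) : Set ℂ := segment ℝ (P.start e) (P.start (P.next e))

/-- An edge without its endpoints. -/
def openSide (e : 𝒜) : Set ℂ := openSegment ℝ (P.start e) (P.start (P.next e))

theorem edgeVec_ne_zero (e : 𝒜) : P.edgeVec e ≠ 0 :=
  sub_ne_zero.2 fun h => P.next_ne e (P.start_injective h)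

theorem mem_openSide {e : 𝒜} {z : ℂ} :
    z ∈ P.openSide e ↔ ∃ s : ℝ, 0 < s ∧ s < 1 ∧ z = P.start e + (s : ℂ) * P.edgeVec e :=
  mem_openSegment_iff_ofReal

theorem mem_side {e : 𝒜} {z : ℂ} :
    z ∈ P.side e ↔ ∃ s : ℝ, 0 ≤ s ∧ s ≤ 1 ∧ z = P.start e + (s : ℂ) * P.edgeVec e :=
  mem_segment_iff_ofReal

theorem openSide_subset_side (e : 𝒜) : P.openSide e ⊆ P.side e :=
  openSegment_subset_segment ℝ _ _

theorem start_mem_side (e : 𝒜) : P.start e ∈ P.side e := left_mem_segment ℝ _ _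

theorem start_add_edgeVec (e : 𝒜) : P.start e + P.edgeVec e = P.start (P.next e) := by
  simp [edgeVec]

theorem start_notMem_openSide (e f : 𝒜) : P.start f ∉ P.openSide e := by
  have key : ∀ e, P.start e ∉ P.openSide e := by
    intro e h
    obtain ⟨s, h0, -, hs⟩ := P.mem_openSide.1 h
    have : (s : ℂ) * P.edgeVec e = 0 := by linear_combination -hs
    rcases mul_eq_zero.1 this with h | h
    · exact h0.ne' (by exact_mod_cast h)
    · exact P.edgeVec_ne_zero e h
  have key2 : ∀ e, P.start (P.next e) ∉ P.openSide e := by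
    intro e h
    obtain ⟨s, h0, h1, hs⟩ := P.mem_openSide.1 h
    rw [← P.start_add_edgeVec] at hs
    have : ((1 - s : ℝ) : ℂ) * P.edgeVec e = 0 := by push_cast; linear_combination hs
    rcases mul_eq_zero.1 this with h | h
    · have : 1 - s = 0 := by exact_mod_cast h
      linarith
    · exact P.edgeVec_ne_zero e h
  intro h
  by_cases hef : e = f
  · subst hef; exact key _ h
  rcases P.edge_inter e f hef _ (P.openSide_subset_side e h) (P.start_mem_side f) with h' | h'
  · rw [h'.1] at h; exact key _ h
  · rw [← h'.2] at h; exact key2 _ h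

/-- Distinct edges meet only at vertices, and no vertex lies inside an edge. Hence a bounce point
determines its label. -/
theorem eq_of_mem_openSide_of_mem_side {e f : 𝒜} {x : ℂ} (he : x ∈ P.openSide e)
    (hf : x ∈ P.side f) : e = f := by
  by_contra hef
  rcases P.edge_inter e f hef x (P.openSide_subset_side e he) hf with h | h
  · exact P.start_notMem_openSide _ _ (h.1 ▸ he)
  · exact P.start_notMem_openSide _ _ (h.1 ▸ he)

theorem mem_frontier_iff {x : ℂ} : x ∈ frontier P.region ↔ ∃ e, x ∈ P.side e := by
  rw [P.frontier_region]; simp [side]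

theorem side_subset_frontier (e : 𝒜) : P.side e ⊆ frontier P.region :=
  fun _ hx => P.mem_frontier_iff.2 ⟨e, hx⟩

theorem notMem_interior_of_mem_side {e : 𝒜} {x : ℂ} (h : x ∈ P.side e) :
    x ∉ interior P.region := (P.side_subset_frontier e h).2

theorem mem_openSide_of_mem_side {e : 𝒜} {x : ℂ} (h : x ∈ P.side e)
    (hx : ∀ f, x ≠ P.start f) : x ∈ P.openSide e := by
  obtain ⟨s, h0, h1, rfl⟩ := P.mem_side.1 h
  refine P.mem_openSide.2 ⟨s, lt_of_le_of_ne h0 ?_, lt_of_le_of_ne h1 ?_, rfl⟩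
  · rintro rfl; exact hx e (by simp)
  · rintro rfl; exact hx (P.next e) (by rw [← P.start_add_edgeVec]; simp)

theorem exists_mem_openSide {x : ℂ} (h : x ∈ frontier P.region)
    (hx : ∀ f, x ≠ P.start f) : ∃ e, x ∈ P.openSide e := by
  obtain ⟨e, he⟩ := P.mem_frontier_iff.1 h
  exact ⟨e, P.mem_openSide_of_mem_side he hx⟩

theorem isCompact_side (e : 𝒜) : IsCompact (P.side e) := by
  have : P.side e = (fun s : ℝ => P.start e + (s : ℂ) * P.edgeVec e) '' Set.Icc 0 1 := by
    ext z; rw [P.mem_side]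
    constructor
    · rintro ⟨s, h0, h1, rfl⟩; exact ⟨s, ⟨h0, h1⟩, rfl⟩
    · rintro ⟨s, ⟨h0, h1⟩, rfl⟩; exact ⟨s, h0, h1, rfl⟩
  rw [this]
  exact isCompact_Icc.image (by fun_prop)

/-- There are finitely many edges, all compact, so those that miss `y` stay at a positive distance
from it. -/
theorem exists_ball_side [Finite 𝒜] (y : ℂ) :
    ∃ r > 0, ∀ e, ∀ x ∈ P.side e, dist x y < r → y ∈ P.side e := by
  have h : ∀ᶠ r : ℝ in nhdsWithin 0 (Set.Ioi 0),
      ∀ e, ∀ x ∈ P.side e, dist x y < r → y ∈ P.side e := by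
    rw [Filter.eventually_all]
    intro e
    by_cases hy : y ∈ P.side e
    · exact Filter.Eventually.of_forall fun _ _ _ _ => hy
    · obtain ⟨r, hr, hb⟩ := Metric.isOpen_iff.1 (P.isCompact_side e).isClosed.isOpen_compl y hy
      filter_upwards [Ioo_mem_nhdsGT hr] with s hs x hx hd
      exact absurd hx (hb (lt_trans hd hs.2))
  obtain ⟨r, hr, h0⟩ := (h.and self_mem_nhdsWithin).exists
  exact ⟨r, h0, hr⟩

/-- Close to a point of an edge, the table is the half-plane to the left of the edge. -/
theorem exists_ball_left_right [Finite 𝒜] {e : 𝒜} {x : ℂ} (hx : x ∈ P.openSide e) :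
    ∃ r > 0, ∀ z, dist z x < r →
      (0 < crossIm (P.edgeVec e) (z - x) → z ∈ interior P.region) ∧
      (crossIm (P.edgeVec e) (z - x) < 0 → z ∉ P.region) := by
  obtain ⟨r, hr, hb⟩ := P.exists_ball_side x
  have hu := P.edgeVec_ne_zero e
  have hside : ∀ z f, z ∈ P.side f → dist z x < r → crossIm (P.edgeVec e) (z - x) = 0 := by
    intro z f hz hd
    have := P.eq_of_mem_openSide_of_mem_side hx (hb f z hz hd)
    subst this
    obtain ⟨s, -, -, rfl⟩ := P.mem_side.1 hz
    obtain ⟨t, -, -, rfl⟩ := P.mem_openSide.1 hx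
    have : P.start e + (s : ℂ) * P.edgeVec e - (P.start e + (t : ℂ) * P.edgeVec e)
      = ((s - t : ℝ) : ℂ) * P.edgeVec e := by push_cast; ring
    rw [this, crossIm_smul_right, crossIm_self, mul_zero]
  have hconv : ∀ c : ℝ, Convex ℝ {z : ℂ | 0 < c * crossIm (P.edgeVec e) (z - x)} := by
    intro c y hy z hz a b ha hb hab
    simp only [Set.mem_ofPred_eq, crossIm, Complex.sub_re, Complex.sub_im, Complex.add_re,
      Complex.add_im, Complex.real_smul, Complex.mul_re, Complex.mul_im, Complex.ofReal_re,
      Complex.ofReal_im] at hy hz ⊢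
    have hx' : x.re = a * x.re + b * x.re ∧ x.im = a * x.im + b * x.im :=
      ⟨by rw [← add_mul, hab, one_mul], by rw [← add_mul, hab, one_mul]⟩
    have e1 : c * ((P.edgeVec e).re * (a * y.im + 0 * y.re + (b * z.im + 0 * z.re) - x.im) -
        (P.edgeVec e).im * (a * y.re - 0 * y.im + (b * z.re - 0 * z.im) - x.re)) =
        a * (c * ((P.edgeVec e).re * (y.im - x.im) - (P.edgeVec e).im * (y.re - x.re))) +
        b * (c * ((P.edgeVec e).re * (z.im - x.im) - (P.edgeVec e).im * (z.re - x.re))) := by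
      linear_combination (-c * (P.edgeVec e).re) * hx'.2 + (c * (P.edgeVec e).im) * hx'.1
    rw [e1]
    rcases ha.eq_or_lt with rfl | ha'
    · have : b = 1 := by linarith
      subst this; simpa using hz
    · have := mul_pos ha' hy
      have := mul_nonneg hb hz.le
      linarith
  have hpre : ∀ c : ℝ, IsPreconnected
      ({z : ℂ | 0 < c * crossIm (P.edgeVec e) (z - x)} ∩ Metric.ball x r) := fun c =>
    ((hconv c).inter (convex_ball x r)).isPreconnected
  have hfr : ∀ c : ℝ, ∀ z ∈ {z : ℂ | 0 < c * crossIm (P.edgeVec e) (z - x)} ∩ Metric.ball x r,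
      z ∉ frontier P.region := by
    rintro c z ⟨hz, hzb⟩ hf
    obtain ⟨f, hzf⟩ := P.mem_frontier_iff.1 hf
    have := hside z f hzf hzb
    simp only [Set.mem_ofPred_eq, this, mul_zero, lt_irrefl] at hz
  have hleft : ∀ z, dist z x < r → 0 < crossIm (P.edgeVec e) (z - x) → z ∈ interior P.region := by
    intro z hz hzc
    refine (hpre 1).subset_interior_of_disjoint_frontier (hfr 1) ?_ ⟨by simpa using hzc, hz⟩
    have h1 := P.interior_left e x hx
    have h2 : Filter.Tendsto (fun t : ℝ => x + (t : ℂ) *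
        (Complex.I * (P.start (P.next e) - P.start e))) (nhdsWithin 0 (Set.Ioi 0)) (nhds x) := by
      refine Filter.Tendsto.mono_left ?_ nhdsWithin_le_nhds
      have : Continuous (fun t : ℝ => x + (t : ℂ) *
        (Complex.I * (P.start (P.next e) - P.start e))) := by fun_prop
      simpa using this.tendsto 0
    obtain ⟨t, ⟨ht1, ht2⟩, ht0⟩ := ((h1.and (h2.eventually (Metric.ball_mem_nhds x hr))).and
      self_mem_nhdsWithin).exists
    refine ⟨_, ⟨?_, ht2⟩, ht1⟩
    have ht0' : 0 < t := ht0
    have : (0:ℝ) < ‖P.edgeVec e‖ ^ 2 := by positivity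
    rw [← Complex.normSq_eq_norm_sq, Complex.normSq_apply] at this
    have hc : crossIm (P.edgeVec e) (Complex.I * P.edgeVec e) =
        (P.edgeVec e).re * (P.edgeVec e).re + (P.edgeVec e).im * (P.edgeVec e).im := by
      simp [crossIm]
    have : 0 < t * crossIm (P.edgeVec e) (Complex.I * P.edgeVec e) := by
      rw [hc]; positivity
    simpa [crossIm_smul_right, edgeVec] using this
  refine ⟨r, hr, fun z hz => ⟨hleft z hz, fun hzc => ?_⟩⟩
  -- It remains to find one point on the right outside the table. Otherwise the right half-disc lies
  -- in the table, as do the left one and the piece of edge between them, so `x` would be an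
  -- interior point.
  refine (hpre (-1)).notMem_of_disjoint_frontier (hfr _) ?_ z
    ⟨by simpa using hzc, hz⟩
  by_contra hcon
  push Not at hcon
  have hxf : x ∈ frontier P.region := P.side_subset_frontier e (P.openSide_subset_side e hx)
  refine hxf.2 ?_
  obtain ⟨t, ht0, ht1, hxt⟩ := P.mem_openSide.1 hx
  have hul : 0 < ‖P.edgeVec e‖ := norm_pos_iff.2 hu
  -- The last two bounds keep the diameter along the line of `e` inside the edge itself.
  obtain ⟨r', hr', hr'r, hr1, hr2⟩ : ∃ r' > 0, r' ≤ r ∧ r' ≤ t * ‖P.edgeVec e‖ ∧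
      r' ≤ (1 - t) * ‖P.edgeVec e‖ := by
    refine ⟨min r (min (t * ‖P.edgeVec e‖) ((1 - t) * ‖P.edgeVec e‖)), ?_, min_le_left _ _,
      (min_le_right _ _).trans (min_le_left _ _), (min_le_right _ _).trans (min_le_right _ _)⟩
    have : 0 < 1 - t := by linarith
    positivity
  rw [mem_interior]
  refine ⟨Metric.ball x r', ?_, Metric.isOpen_ball, Metric.mem_ball_self hr'⟩
  intro y hy
  have hyr : dist y x < r := lt_of_lt_of_le hy hr'r
  rcases lt_trichotomy (crossIm (P.edgeVec e) (y - x)) 0 with h | h | h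
  · exact hcon y ⟨by simpa using h, hyr⟩
  · obtain ⟨c, hc⟩ := exists_ofReal_mul_of_crossIm_eq_zero hu h
    have hcn : |c| * ‖P.edgeVec e‖ < r' := by
      have : dist y x < r' := hy
      rwa [dist_eq_norm, hc, norm_mul, Complex.norm_real, Real.norm_eq_abs] at this
    have h1 : |c| < t := lt_of_mul_lt_mul_right (hcn.trans_le hr1) hul.le
    have h2 : |c| < 1 - t := lt_of_mul_lt_mul_right (hcn.trans_le hr2) hul.le
    rw [abs_lt] at h1 h2
    have : y ∈ P.side e := P.mem_side.2 ⟨t + c, by linarith, by linarith, by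
      push_cast; linear_combination hc + hxt⟩
    exact P.isCompact_region.isClosed.frontier_subset (P.side_subset_frontier e this)
  · exact interior_subset (hleft y hyr h)

end BilliardTable

/-! ### Polar coordinates at a vertex, and the table as a sector -/

namespace BilliardTable

variable {𝒜 : Type*} (P : BilliardTable 𝒜)

/-- The unit vector that makes the angle `s` with the `m`-th letter of `A B A B …`, measured into the
table, at the vertex where the edge `A` starts. -/
noncomputable def ray (A : 𝒜) (m : ℕ) (s : ℝ) : ℂ :=
  P.edgeVec A / (‖P.edgeVec A‖ : ℂ) *
    Complex.exp (((if Even m then s else P.interiorAngle A - s : ℝ) : ℂ) * Complex.I)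

theorem norm_ray (A : 𝒜) (m : ℕ) (s : ℝ) : ‖P.ray A m s‖ = 1 := by
  unfold ray
  rw [norm_mul, Complex.norm_exp_ofReal_mul_I, mul_one, norm_div, Complex.norm_real, norm_norm]
  exact div_self (norm_ne_zero_iff.2 (P.edgeVec_ne_zero A))

theorem ray_ne_zero (A : 𝒜) (m : ℕ) (s : ℝ) : P.ray A m s ≠ 0 := by
  rw [← norm_ne_zero_iff, norm_ray]; exact one_ne_zero

/-- Consecutive letters bound the sector of angle `θ` and are measured from opposite sides. Combined
with `reflectAlong_ray`, this change of letter makes the angle grow by `θ` at each bounce. -/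
theorem ray_succ (A : 𝒜) (m : ℕ) (s : ℝ) :
    P.ray A (m + 1) s = P.ray A m (P.interiorAngle A - s) := by
  unfold ray
  by_cases h : Even m
  · have h' : ¬ Even (m + 1) := by rw [Nat.even_add_one]; exact not_not.2 h
    rw [if_pos h, if_neg h']
  · have h' : Even (m + 1) := by rw [Nat.even_add_one]; exact h
    rw [if_neg h, if_pos h']; congr 3; push_cast; ring_nf

theorem ray_odd_or_even (A : 𝒜) (m : ℕ) : P.ray A m = P.ray A 0 ∨ P.ray A m = P.ray A 1 := by
  by_cases h : Even m
  · left; ext s; simp [ray, h]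
  · right; ext s; simp [ray, h]

theorem ray_add (A : 𝒜) (m : ℕ) (s t : ℝ) : P.ray A m (s + t) =
    P.ray A m s * Complex.exp (((if Even m then t else -t : ℝ) : ℂ) * Complex.I) := by
  unfold ray
  split_ifs <;> rw [mul_assoc, ← Complex.exp_add] <;> congr 2 <;> push_cast <;> ring

theorem ray_add_pi (A : 𝒜) (m : ℕ) (s : ℝ) : P.ray A m (s + Real.pi) = -P.ray A m s := by
  rw [ray_add]
  split_ifs <;> simp [Complex.exp_neg]

theorem ray_sub_pi (A : 𝒜) (m : ℕ) (s : ℝ) : P.ray A m (s - Real.pi) = -P.ray A m s := by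
  rw [← neg_eq_iff_eq_neg, ← ray_add_pi, sub_add_cancel]

theorem ray_add_two_pi (A : 𝒜) (m : ℕ) (s : ℝ) :
    P.ray A m (s + 2 * Real.pi) = P.ray A m s := by
  rw [two_mul, ← add_assoc, ray_add_pi, ray_add_pi, neg_neg]

/-- The law of sines, in vector form. -/
theorem sin_mul_ray (A : 𝒜) (m : ℕ) (a b c : ℝ) :
    (Real.sin (b - a) : ℂ) * P.ray A m c =
      (Real.sin (b - c) : ℂ) * P.ray A m a + (Real.sin (c - a) : ℂ) * P.ray A m b := by
  have e : ∀ s, P.ray A m s = P.ray A m 0 * (Complex.cos s +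
      (if Even m then Complex.sin s else -Complex.sin s) * Complex.I) := by
    intro s
    conv_lhs => rw [← zero_add s, ray_add]
    rw [Complex.exp_mul_I]
    split_ifs <;> simp
  have key : ∀ κ : ℂ, (Real.sin (b - a) : ℂ) * (Complex.cos c + κ * Complex.sin c) =
      (Real.sin (b - c) : ℂ) * (Complex.cos a + κ * Complex.sin a) +
      (Real.sin (c - a) : ℂ) * (Complex.cos b + κ * Complex.sin b) := by
    intro κ
    push_cast
    rw [Complex.sin_sub, Complex.sin_sub, Complex.sin_sub]
    ring
  rw [e a, e b, e c]
  split_ifs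
  · linear_combination (P.ray A m 0) * key Complex.I
  · linear_combination (P.ray A m 0) * key (-Complex.I)

/-- Angles from even letters run counterclockwise and those from odd letters clockwise, hence the
sign. -/
theorem crossIm_ray (A : 𝒜) (m : ℕ) (s t : ℝ) :
    crossIm (P.ray A m s) (P.ray A m t) =
      if Even m then Real.sin (t - s) else -Real.sin (t - s) := by
  have h : ∀ u v : ℂ, crossIm u (u * v) = ‖u‖ ^ 2 * v.im := by
    intro u v
    rw [← Complex.normSq_eq_norm_sq, Complex.normSq_apply]
    simp [crossIm]; ring
  have : P.ray A m t = P.ray A m s *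
      Complex.exp (((if Even m then t - s else -(t - s) : ℝ) : ℂ) * Complex.I) := by
    rw [← ray_add]; congr 1; ring
  rw [this, h, norm_ray, Complex.exp_ofReal_mul_I_im]
  split_ifs
  · simp
  · rw [Real.sin_neg]; simp

theorem dist_ray (A : 𝒜) (m : ℕ) (s t : ℝ) :
    ‖P.ray A m s - P.ray A m t‖ = 2 * |Real.sin ((s - t) / 2)| := by
  have h0 : ∀ x : ℝ, ‖Complex.exp ((x : ℂ) * Complex.I) - 1‖ = 2 * |Real.sin (x / 2)| := by
    intro x
    have := Complex.norm_exp_I_mul_ofReal_sub_one x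
    rw [mul_comm] at this
    rw [this, norm_mul]; simp
  have : P.ray A m s - P.ray A m t = P.ray A m t * (Complex.exp
      (((if Even m then s - t else -(s - t) : ℝ) : ℂ) * Complex.I) - 1) := by
    rw [mul_sub, ← ray_add]; ring_nf
  rw [this, norm_mul, norm_ray, one_mul, h0]
  split_ifs
  · rfl
  · rw [neg_div, Real.sin_neg, abs_neg]

theorem ray_surjective (A : 𝒜) (m : ℕ) (c : ℝ) {z : ℂ} (hz : ‖z‖ = 1) :
    ∃ s, c ≤ s ∧ s < c + 2 * Real.pi ∧ z = P.ray A m s := by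
  have : ∃ s, z = P.ray A m s := by
    have h1 : ‖z / P.ray A m 0‖ = 1 := by rw [norm_div, norm_ray, hz, div_one]
    obtain ⟨φ, h2⟩ : ∃ φ : ℝ, z / P.ray A m 0 = Complex.exp ((φ : ℂ) * Complex.I) := by
      refine ⟨Complex.arg (z / P.ray A m 0), ?_⟩
      conv_lhs => rw [← Complex.norm_mul_exp_arg_mul_I (z / P.ray A m 0), h1]
      simp
    refine ⟨if Even m then φ else -φ, ?_⟩
    rw [← zero_add (ite _ _ _), ray_add]
    rw [eq_comm, mul_comm, ← eq_div_iff (P.ray_ne_zero A m 0), h2]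
    split_ifs <;> simp
  obtain ⟨s, rfl⟩ := this
  refine ⟨toIcoMod Real.two_pi_pos c s, left_le_toIcoMod _ _ _, toIcoMod_lt_right _ _ _, ?_⟩
  have hp : Function.Periodic (P.ray A m) (2 * Real.pi) := P.ray_add_two_pi A m
  rw [toIcoMod, hp.sub_zsmul_eq]

/-- Uniqueness of polar coordinates; the bound `2π` excludes a full turn. -/
theorem eq_of_mul_ray_eq {A : 𝒜} {m : ℕ} {s t x y : ℝ} (hx : 0 < x) (hy : 0 < y)
    (hst : |s - t| < 2 * Real.pi) (h : (x : ℂ) * P.ray A m s = (y : ℂ) * P.ray A m t) : s = t := by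
  have hxy : x = y := by
    have := congrArg norm h
    rwa [norm_mul, norm_mul, norm_ray, norm_ray, mul_one, mul_one, Complex.norm_real,
      Complex.norm_real, Real.norm_of_nonneg hx.le, Real.norm_of_nonneg hy.le] at this
  subst hxy
  have h1 := mul_left_cancel₀ (by exact_mod_cast hx.ne' : (x : ℂ) ≠ 0) h
  have h2 : Real.sin ((s - t) / 2) = 0 := by
    have := P.dist_ray A m s t
    rw [h1, sub_self, norm_zero] at this
    rw [← abs_eq_zero]; linarith
  rw [abs_lt] at hst
  have := (Real.sin_eq_zero_iff_of_lt_of_lt (by linarith) (by linarith)).1 h2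
  linarith

section Corner

variable {P} {A B : 𝒜}

/-- `interiorAngle` agrees with the argument of the quotient of the two edge directions modulo `2π`,
which is enough for the exponential. So the ray at angle `0` from letter `1` points along `B`, away
from the vertex. -/
theorem exists_start_sub_eq_ray (hAB : P.next B = A) :
    P.start B - P.start A = (‖P.edgeVec B‖ : ℂ) * P.ray A 1 0 := by
  have hB : P.next.symm A = B := by rw [← hAB, Equiv.symm_apply_apply]
  have hn : ‖P.start B - P.start A‖ = ‖P.edgeVec B‖ := by
    rw [edgeVec, hAB, norm_sub_rev]
  have hu := P.edgeVec_ne_zero A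
  set z := (P.start B - P.start A) / P.edgeVec A with hz
  have hθ : Complex.exp ((P.interiorAngle A : ℂ) * Complex.I) =
      Complex.exp ((Complex.arg z : ℂ) * Complex.I) := by
    have : P.interiorAngle A = Complex.arg z -
        ((toIcoDiv Real.two_pi_pos 0 (Complex.arg z) : ℤ) : ℝ) * (2 * Real.pi) := by
      rw [interiorAngle, hB, toIcoMod, zsmul_eq_mul]
    rw [this]
    have h2 := Complex.exp_periodic.sub_int_mul_eq
      (x := (Complex.arg z : ℂ) * Complex.I) (toIcoDiv Real.two_pi_pos 0 (Complex.arg z))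
    rw [← h2]; congr 1; push_cast; ring
  have h1 := Complex.norm_mul_exp_arg_mul_I z
  have h3 : P.start B - P.start A = P.edgeVec A * z := (mul_div_cancel₀ _ hu).symm
  have h4 : ‖P.edgeVec B‖ = ‖P.edgeVec A‖ * ‖z‖ := by rw [← hn, h3, norm_mul]
  have h5 : (‖P.edgeVec A‖ : ℂ) ≠ 0 := by exact_mod_cast norm_ne_zero_iff.2 hu
  rw [h4, ray, if_neg (by decide), sub_zero, hθ, h3]
  conv_lhs => rw [← h1]
  push_cast
  field_simp

theorem edgeVec_eq_ray_zero (A : 𝒜) : P.edgeVec A = (‖P.edgeVec A‖ : ℂ) * P.ray A 0 0 := by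
  have h5 : (‖P.edgeVec A‖ : ℂ) ≠ 0 := by exact_mod_cast norm_ne_zero_iff.2 (P.edgeVec_ne_zero A)
  rw [ray, if_pos (by decide)]; simp; field_simp

theorem ne_of_next_eq (hAB : P.next B = A) : A ≠ B := fun h => P.next_ne B (hAB.trans h)

theorem edgeVec_eq_neg_ray (hAB : P.next B = A) :
    P.edgeVec B = -((‖P.edgeVec B‖ : ℂ) * P.ray A 1 0) := by
  rw [← exists_start_sub_eq_ray hAB, edgeVec, hAB]; ring

theorem add_ray_mem_openSide (hAB : P.next B = A) (m : ℕ) {ρ : ℝ} (h0 : 0 < ρ)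
    (h1 : ρ < ‖P.edgeVec (alternatingLetter A B m)‖) :
    P.start A + (ρ : ℂ) * P.ray A m 0 ∈ P.openSide (alternatingLetter A B m) := by
  rw [mem_openSide]
  by_cases hm : Even m
  · have hr : P.ray A m = P.ray A 0 := by ext s; simp [ray, hm]
    simp only [alternatingLetter, hm, if_true] at h1 ⊢
    have hl : 0 < ‖P.edgeVec A‖ := h0.trans h1
    have hl' : (‖P.edgeVec A‖ : ℂ) ≠ 0 := by exact_mod_cast hl.ne'
    refine ⟨ρ / ‖P.edgeVec A‖, by positivity, by rwa [div_lt_one hl], ?_⟩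
    conv_rhs => rw [edgeVec_eq_ray_zero A]
    rw [hr, norm_mul, norm_ray, Complex.norm_real, norm_norm, mul_one]
    push_cast; field_simp
  · have hr : P.ray A m = P.ray A 1 := by ext s; simp [ray, hm]
    simp only [alternatingLetter, hm, if_false] at h1 ⊢
    have hl : 0 < ‖P.edgeVec B‖ := h0.trans h1
    have hl' : (‖P.edgeVec B‖ : ℂ) ≠ 0 := by exact_mod_cast hl.ne'
    refine ⟨1 - ρ / ‖P.edgeVec B‖, by rw [sub_pos, div_lt_one hl]; exact h1,
      by linarith [div_pos h0 hl], ?_⟩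
    have h2 : P.start A = P.start B + P.edgeVec B := by rw [P.start_add_edgeVec, hAB]
    have h3 := edgeVec_eq_neg_ray hAB
    have h4 : (ρ : ℂ) * P.ray A 1 0 = -((ρ / ‖P.edgeVec B‖ : ℝ) : ℂ) * P.edgeVec B := by
      conv_rhs => rw [h3]
      rw [norm_neg, norm_mul, norm_ray, Complex.norm_real, norm_norm, mul_one]
      push_cast; field_simp
    rw [hr, h4, h2]; push_cast; ring

theorem exists_eq_add_ray_of_mem_side (hAB : P.next B = A) (m : ℕ) {z : ℂ}
    (hz : z ∈ P.side (alternatingLetter A B m)) :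
    ∃ ρ : ℝ, 0 ≤ ρ ∧ z = P.start A + (ρ : ℂ) * P.ray A m 0 := by
  obtain ⟨s, h0, h1, rfl⟩ := P.mem_side.1 hz
  by_cases hm : Even m
  · have hr : P.ray A m = P.ray A 0 := by ext s; simp [ray, hm]
    simp only [alternatingLetter, hm, if_true]
    refine ⟨s * ‖P.edgeVec A‖, by positivity, ?_⟩
    rw [hr]; push_cast; rw [mul_assoc, ← edgeVec_eq_ray_zero]
  · have hr : P.ray A m = P.ray A 1 := by ext s; simp [ray, hm]
    simp only [alternatingLetter, hm, if_false]
    refine ⟨(1 - s) * ‖P.edgeVec B‖, mul_nonneg (by linarith) (norm_nonneg _), ?_⟩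
    have h3 := edgeVec_eq_neg_ray hAB
    have h2 : P.start A = P.start B + P.edgeVec B := by rw [P.start_add_edgeVec, hAB]
    rw [hr, h2]; push_cast; linear_combination (s - 1 : ℂ) * h3

/-- For `θ = 0` the two edges would leave the vertex in the same direction and overlap. -/
theorem interiorAngle_pos (hAB : P.next B = A) : 0 < P.interiorAngle A := by
  have h0 : 0 ≤ P.interiorAngle A := left_le_toIcoMod Real.two_pi_pos 0 _
  refine lt_of_le_of_ne h0 fun h => ?_
  have hr : P.ray A 1 0 = P.ray A 0 0 := by rw [← zero_add 1, ray_succ, ← h, sub_zero]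
  have hA := norm_pos_iff.2 (P.edgeVec_ne_zero A)
  have hB := norm_pos_iff.2 (P.edgeVec_ne_zero B)
  obtain ⟨ρ, hρ0, hρ⟩ := exists_between (lt_min hA hB)
  have h1 := add_ray_mem_openSide hAB 0 (ρ := ρ)
    hρ0
    (by simpa [alternatingLetter] using hρ.trans_le (min_le_left _ _))
  have h2 := add_ray_mem_openSide hAB 1 (ρ := ρ)
    hρ0
    (by simpa [alternatingLetter] using hρ.trans_le (min_le_right _ _))
  rw [hr] at h2
  have := P.eq_of_mem_openSide_of_mem_side h1 (P.openSide_subset_side _ h2)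
  exact ne_of_next_eq hAB (by simpa [alternatingLetter] using this)

theorem interiorAngle_lt (A : 𝒜) : P.interiorAngle A < 2 * Real.pi :=
  (toIcoMod_lt_right Real.two_pi_pos 0 _).trans_eq (zero_add _)

theorem reflectAlong_ray (hAB : P.next B = A) (m : ℕ) (s : ℝ) :
    reflectAlong (P.edgeVec (alternatingLetter A B m)) (P.ray A m s) = P.ray A m (-s) := by
  have key : ∀ c : ℝ, c ≠ 0 → reflectAlong ((c : ℂ) * P.ray A m 0) (P.ray A m s) =
      P.ray A m (-s) := by
    intro c hc
    have hc' : (c : ℂ) ≠ 0 := by exact_mod_cast hc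
    have hr := P.ray_ne_zero A m 0
    unfold reflectAlong
    have e1 := P.ray_add A m 0 s
    have e2 := P.ray_add A m 0 (-s)
    rw [zero_add] at e1 e2
    rw [e1, e2]
    have : P.ray A m 0 * Complex.exp (((if Even m then s else -s : ℝ) : ℂ) * Complex.I) /
        ((c : ℂ) * P.ray A m 0) =
        Complex.exp (((if Even m then s else -s : ℝ) : ℂ) * Complex.I) / (c : ℂ) := by
      field_simp
    rw [this, map_div₀, Complex.conj_ofReal, ← Complex.exp_conj]
    have h2 : (starRingEnd ℂ) (((if Even m then s else -s : ℝ) : ℂ) * Complex.I) =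
        ((if Even m then -s else - -s : ℝ) : ℂ) * Complex.I := by
      rw [map_mul, Complex.conj_ofReal, Complex.conj_I]
      split_ifs <;> push_cast <;> ring
    rw [h2]; field_simp
  by_cases hm : Even m
  · have hr : P.ray A m = P.ray A 0 := by ext s; simp [ray, hm]
    simp only [alternatingLetter, hm, if_true]
    rw [edgeVec_eq_ray_zero A, ← hr]
    exact key _ (norm_ne_zero_iff.2 (P.edgeVec_ne_zero A))
  · have hr : P.ray A m = P.ray A 1 := by ext s; simp [ray, hm]
    simp only [alternatingLetter, hm, if_false]
    rw [edgeVec_eq_neg_ray hAB, ← hr]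
    have := key (-‖P.edgeVec B‖) (neg_ne_zero.2 (norm_ne_zero_iff.2 (P.edgeVec_ne_zero B)))
    rw [← this]; push_cast; rw [neg_mul]

theorem crossIm_edgeVec_ray (hAB : P.next B = A) (m : ℕ) (s : ℝ) :
    crossIm (P.edgeVec (alternatingLetter A B m)) (P.ray A m s) =
      ‖P.edgeVec (alternatingLetter A B m)‖ * Real.sin s := by
  have hl : ∀ (c : ℝ) (u v : ℂ), crossIm ((c : ℂ) * u) v = c * crossIm u v := by
    intro c u v; simp [crossIm]; ring
  by_cases hm : Even m
  · have hr : P.ray A m = P.ray A 0 := by ext s; simp [ray, hm]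
    simp only [alternatingLetter, hm, if_true]
    conv_lhs => rw [edgeVec_eq_ray_zero A, hr]
    rw [hl, crossIm_ray, sub_zero, if_pos (by decide)]
  · have hr : P.ray A m = P.ray A 1 := by ext s; simp [ray, hm]
    simp only [alternatingLetter, hm, if_false]
    conv_lhs => rw [edgeVec_eq_neg_ray hAB, hr]
    rw [← neg_mul, ← Complex.ofReal_neg, hl, crossIm_ray, sub_zero, if_neg (by decide)]
    ring

theorem eq_alternatingLetter_of_start_mem_side (hAB : P.next B = A) {e : 𝒜}
    (h : P.start A ∈ P.side e) : e = A ∨ e = B := by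
  by_cases he : e = A
  · exact Or.inl he
  · right
    rcases P.edge_inter e A he _ h (P.start_mem_side A) with h' | h'
    · exact absurd (P.start_injective h'.1).symm he
    · rw [← hAB] at h'; exact P.next.injective h'.2

/-- Close to a vertex, the table is the sector between its two edges. -/
theorem exists_sector [Finite 𝒜] (hAB : P.next B = A) :
    ∃ r > 0, (∀ m, r ≤ ‖P.edgeVec (alternatingLetter A B m)‖) ∧
      (∀ e, ∀ x ∈ P.side e, dist x (P.start A) < r → e = A ∨ e = B) ∧
      (∀ m, ∀ ρ s : ℝ, 0 < ρ → ρ < r → 0 < s → s < P.interiorAngle A →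
        P.start A + (ρ : ℂ) * P.ray A m s ∈ interior P.region) ∧
      (∀ m, ∀ ρ s : ℝ, 0 < ρ → ρ < r → P.interiorAngle A < s → s < 2 * Real.pi →
        P.start A + (ρ : ℂ) * P.ray A m s ∉ P.region) := by
  obtain ⟨r₀, hr₀, hb⟩ := P.exists_ball_side (P.start A)
  have hA := norm_pos_iff.2 (P.edgeVec_ne_zero A)
  have hB := norm_pos_iff.2 (P.edgeVec_ne_zero B)
  set θ := P.interiorAngle A with hθ
  have hθ0 : 0 < θ := interiorAngle_pos hAB
  have hθ2 : θ < 2 * Real.pi := P.interiorAngle_lt A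
  obtain ⟨r, hr, hrr₀, hrA, hrB⟩ : ∃ r > 0, r ≤ r₀ ∧ r ≤ ‖P.edgeVec A‖ ∧ r ≤ ‖P.edgeVec B‖ :=
    ⟨min r₀ (min ‖P.edgeVec A‖ ‖P.edgeVec B‖), by positivity, min_le_left _ _,
      (min_le_right _ _).trans (min_le_left _ _), (min_le_right _ _).trans (min_le_right _ _)⟩
  have hside : ∀ e, ∀ x ∈ P.side e, dist x (P.start A) < r → e = A ∨ e = B :=
    fun e x hx hd => eq_alternatingLetter_of_start_mem_side hAB (hb e x hx (hd.trans_le hrr₀))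
  have hdist : ∀ m s (ρ : ℝ), 0 < ρ → dist (P.start A + (ρ : ℂ) * P.ray A m s) (P.start A) = ρ := by
    intro m s ρ hρ
    rw [dist_eq_norm, add_sub_cancel_left, norm_mul, norm_ray, mul_one, Complex.norm_real,
      Real.norm_of_nonneg hρ.le]
  -- Near the vertex only its two edges occur, and they lie at the angles `0` and `θ`. Between
  -- these, and between `θ` and `2π`, the open sectors miss the frontier.
  have hfr : ∀ ρ s : ℝ, 0 < ρ → ρ < r → 0 < s → s < 2 * Real.pi → s ≠ θ →
      P.start A + (ρ : ℂ) * P.ray A 0 s ∉ frontier P.region := by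
    intro ρ s h0 h1 h2 h3 h4 hf
    obtain ⟨e, he⟩ := P.mem_frontier_iff.1 hf
    have : ∃ m < 2, e = alternatingLetter A B m := by
      rcases hside e _ he (by rwa [hdist _ _ _ h0]) with rfl | rfl
      · exact ⟨0, by norm_num, by simp [alternatingLetter]⟩
      · exact ⟨1, by norm_num, by simp [alternatingLetter]⟩
    obtain ⟨m, hm, rfl⟩ := this
    obtain ⟨ρ', hρ', heq⟩ := exists_eq_add_ray_of_mem_side hAB m he
    have heq' := add_left_cancel heq
    have hρ'0 : 0 < ρ' := by
      refine lt_of_le_of_ne hρ' ?_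
      rintro rfl
      have : (ρ : ℂ) ≠ 0 := by exact_mod_cast h0.ne'
      simp [this, P.ray_ne_zero] at heq'
    interval_cases m
    · have := P.eq_of_mul_ray_eq h0 hρ'0 (by rw [sub_zero, abs_of_pos h2]; exact h3) heq'
      exact h2.ne' this
    · rw [← zero_add 1, ray_succ, ← hθ, sub_zero] at heq'
      exact h4 (P.eq_of_mul_ray_eq h0 hρ'0 (by rw [abs_lt]; constructor <;> linarith) heq')
  have hcont : Continuous (fun x : ℝ × ℝ => P.start A + (x.1 : ℂ) * P.ray A 0 x.2) := by
    unfold ray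
    simp only [Even.zero, if_true]
    fun_prop
  have hpre : ∀ a b : ℝ, IsPreconnected
      ((fun x : ℝ × ℝ => P.start A + (x.1 : ℂ) * P.ray A 0 x.2) ''
        (Set.Ioo 0 r ×ˢ Set.Ioo a b)) := fun a b =>
    (isPreconnected_Ioo.prod isPreconnected_Ioo).image _ hcont.continuousOn
  have hr2 : 0 < r / 2 := by positivity
  have hx : P.start A + ((r / 2 : ℝ) : ℂ) * P.ray A 0 0 ∈ P.openSide A :=
    add_ray_mem_openSide hAB 0 hr2 (by simp only [alternatingLetter, Even.zero, if_true]; linarith)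
  -- Both sectors are tested next to this point of `A`: just to its left for the inner one, just to
  -- its right for the outer one.
  obtain ⟨r₁, hr₁, hlr⟩ := P.exists_ball_left_right hx
  have hnear : ∀ᶠ s : ℝ in nhds 0, dist (P.start A + ((r / 2 : ℝ) : ℂ) * P.ray A 0 s)
      (P.start A + ((r / 2 : ℝ) : ℂ) * P.ray A 0 0) < r₁ := by
    have : Continuous (fun s : ℝ => P.start A + ((r / 2 : ℝ) : ℂ) * P.ray A 0 s) :=
      hcont.comp (by fun_prop : Continuous fun s : ℝ => (r / 2, s))
    exact (this.tendsto 0).eventually (Metric.ball_mem_nhds _ hr₁)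
  obtain ⟨δ, hδ, hδb⟩ := Metric.eventually_nhds_iff.1 hnear
  have hcross : ∀ s : ℝ, crossIm (P.edgeVec A) (P.start A + ((r / 2 : ℝ) : ℂ) * P.ray A 0 s -
      (P.start A + ((r / 2 : ℝ) : ℂ) * P.ray A 0 0)) = r / 2 * (‖P.edgeVec A‖ * Real.sin s) := by
    intro s
    have h1 := crossIm_edgeVec_ray hAB 0 s
    have h2 := crossIm_edgeVec_ray hAB 0 0
    simp only [alternatingLetter, show Even 0 by decide, if_true] at h1 h2
    have : P.start A + ((r / 2 : ℝ) : ℂ) * P.ray A 0 s -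
      (P.start A + ((r / 2 : ℝ) : ℂ) * P.ray A 0 0) = ((r / 2 : ℝ) : ℂ) * P.ray A 0 s +
        ((-(r / 2) : ℝ) : ℂ) * P.ray A 0 0 := by push_cast; ring
    rw [this, crossIm_add_right, crossIm_smul_right, crossIm_smul_right, h1, h2, Real.sin_zero]
    ring
  have hin : ∀ ρ s : ℝ, 0 < ρ → ρ < r → 0 < s → s < θ →
      P.start A + (ρ : ℂ) * P.ray A 0 s ∈ interior P.region := by
    intro ρ s h0 h1 h2 h3
    refine (hpre 0 θ).subset_interior_of_disjoint_frontier ?_ ?_ ⟨(ρ, s), ⟨⟨h0, h1⟩, h2, h3⟩, rfl⟩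
    · rintro _ ⟨⟨x, y⟩, ⟨⟨hx0, hx1⟩, hy0, hy1⟩, rfl⟩
      exact hfr x y hx0 hx1 hy0 (hy1.trans hθ2) hy1.ne
    · obtain ⟨t, ht0, ht⟩ := exists_between (lt_min hδ (lt_min hθ0 Real.pi_pos))
      have htδ : t < δ := ht.trans_le (min_le_left _ _)
      have htθ : t < θ := ht.trans_le ((min_le_right _ _).trans (min_le_left _ _))
      have htπ : t < Real.pi := ht.trans_le ((min_le_right _ _).trans (min_le_right _ _))
      refine ⟨_, ⟨(r / 2, t), ⟨⟨hr2, by linarith⟩, ht0, htθ⟩, rfl⟩, ?_⟩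
      refine (hlr _ (hδb (by rw [Real.dist_eq, sub_zero, abs_of_pos ht0]; exact htδ))).1 ?_
      rw [hcross]
      have := Real.sin_pos_of_pos_of_lt_pi ht0 htπ
      positivity
  have hout : ∀ ρ s : ℝ, 0 < ρ → ρ < r → θ < s → s < 2 * Real.pi →
      P.start A + (ρ : ℂ) * P.ray A 0 s ∉ P.region := by
    intro ρ s h0 h1 h2 h3
    refine (hpre θ (2 * Real.pi)).notMem_of_disjoint_frontier ?_ ?_ _
      ⟨(ρ, s), ⟨⟨h0, h1⟩, h2, h3⟩, rfl⟩
    · rintro _ ⟨⟨x, y⟩, ⟨⟨hx0, hx1⟩, hy0, hy1⟩, rfl⟩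
      exact hfr x y hx0 hx1 (hθ0.trans hy0) hy1 hy0.ne'
    · obtain ⟨t, ht0, ht⟩ := exists_between (lt_min hδ (lt_min (sub_pos.2 hθ2) Real.pi_pos))
      have htδ : t < δ := ht.trans_le (min_le_left _ _)
      have htθ : t < 2 * Real.pi - θ := ht.trans_le ((min_le_right _ _).trans (min_le_left _ _))
      have htπ : t < Real.pi := ht.trans_le ((min_le_right _ _).trans (min_le_right _ _))
      refine ⟨_, ⟨(r / 2, -t + 2 * Real.pi), ⟨⟨hr2, by linarith⟩, by linarith, by linarith⟩, rfl⟩, ?_⟩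
      show P.start A + ((r / 2 : ℝ) : ℂ) * P.ray A 0 (-t + 2 * Real.pi) ∉ P.region
      rw [ray_add_two_pi]
      refine (hlr _ (hδb (by rw [Real.dist_eq, sub_zero, abs_neg, abs_of_pos ht0]; exact htδ))).2 ?_
      rw [hcross, Real.sin_neg]
      have := Real.sin_pos_of_pos_of_lt_pi ht0 htπ
      have : 0 < r / 2 * (‖P.edgeVec A‖ * Real.sin t) := by positivity
      linarith
  refine ⟨r, hr, ?_, hside, ?_, ?_⟩
  · intro m; unfold alternatingLetter; split_ifs <;> assumption
  · intro m ρ s h0 h1 h2 h3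
    rcases P.ray_odd_or_even A m with h | h
    · rw [h]; exact hin ρ s h0 h1 h2 h3
    · rw [h, ← zero_add 1, ray_succ]
      exact hin ρ _ h0 h1 (by linarith) (by linarith)
  · intro m ρ s h0 h1 h2 h3
    rcases P.ray_odd_or_even A m with h | h
    · rw [h]; exact hout ρ s h0 h1 h2 h3
    · rw [h, ← zero_add 1, ray_succ, ← ray_add_two_pi]
      exact hout ρ _ h0 h1 (by linarith) (by linarith)

end Corner

end BilliardTable

/-! ### Trajectories: angles at a corner and distance travelled -/

namespace BilliardTable

variable {𝒜 : Type*} {P : BilliardTable 𝒜}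

/-- A segment in the interior that ends on an edge reaches it from the left. -/
theorem crossIm_neg_of_reaches [Finite 𝒜] {e : 𝒜} {y d : ℂ} (hy : y ∈ P.openSide e) {t₀ : ℝ}
    (ht₀ : 0 < t₀) (h : ∀ t : ℝ, 0 < t → t < t₀ → y - (t : ℂ) * d ∈ interior P.region) :
    crossIm (P.edgeVec e) d < 0 := by
  obtain ⟨r, hr, hlr⟩ := P.exists_ball_left_right hy
  have hcont : Continuous (fun t : ℝ => y - (t : ℂ) * d) := by fun_prop
  have hnear : ∀ᶠ t : ℝ in nhdsWithin 0 (Set.Ioi 0), dist (y - (t : ℂ) * d) y < r := by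
    refine Filter.Eventually.filter_mono nhdsWithin_le_nhds ?_
    have := hcont.tendsto 0
    simp only [Complex.ofReal_zero, zero_mul, sub_zero] at this
    exact this.eventually (Metric.ball_mem_nhds y hr)
  rcases lt_trichotomy (crossIm (P.edgeVec e) d) 0 with hc | hc | hc
  · exact hc
  · exfalso
    obtain ⟨c, rfl⟩ := exists_ofReal_mul_of_crossIm_eq_zero (P.edgeVec_ne_zero e) hc
    obtain ⟨s, hs0, hs1, rfl⟩ := P.mem_openSide.1 hy
    have h2 : ∀ᶠ t : ℝ in nhdsWithin 0 (Set.Ioi 0), s - t * c ∈ Set.Ioo (0 : ℝ) 1 := by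
      refine Filter.Eventually.filter_mono nhdsWithin_le_nhds ?_
      have : Continuous fun t : ℝ => s - t * c := by fun_prop
      have := this.tendsto 0
      simp only [zero_mul, sub_zero] at this
      exact this.eventually (Ioo_mem_nhds hs0 hs1)
    obtain ⟨t, ht, ht1, ht2⟩ := (h2.and (Ioo_mem_nhdsGT ht₀)).exists
    refine P.notMem_interior_of_mem_side (e := e) ?_ (h t ht1 ht2)
    refine P.openSide_subset_side e (P.mem_openSide.2 ⟨s - t * c, ht.1, ht.2, ?_⟩)
    push_cast; ring
  · exfalso
    obtain ⟨t, ht, ht1, ht2⟩ := (hnear.and (Ioo_mem_nhdsGT ht₀)).exists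
    refine (hlr _ ht).2 ?_ (interior_subset (h t ht1 ht2))
    have : y - (t : ℂ) * d - y = ((-t : ℝ) : ℂ) * d := by push_cast; ring
    rw [this, crossIm_smul_right]
    nlinarith

namespace Trajectory

variable (τ : P.Trajectory)

theorem mem_openSide (i : ℤ) : τ.point i ∈ P.openSide (τ.edge i) := τ.point_mem i

theorem mem_region (i : ℤ) : τ.point i ∈ P.region :=
  P.isCompact_region.isClosed.frontier_subset
    (P.side_subset_frontier _ (P.openSide_subset_side _ (τ.mem_openSide i)))

theorem mem_interior {i : ℤ} {t : ℝ} (h0 : 0 < t) (h1 : t < τ.len i) :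
    τ.point i + (t : ℂ) * τ.dir i ∈ interior P.region := by
  refine τ.chord_subset i ?_
  rw [τ.point_succ, mem_openSegment_add_mul (τ.len_pos i)]
  exact ⟨t, h0, h1, rfl⟩

/-- A chord between two points of one edge would lie in that edge, hence in the frontier. -/
theorem edge_succ_ne (i : ℤ) : τ.edge (i + 1) ≠ τ.edge i := by
  intro h
  obtain ⟨t, h0, h1⟩ := exists_between (τ.len_pos i)
  have h2 : τ.point i + (t : ℂ) * τ.dir i ∈ openSegment ℝ (τ.point i) (τ.point (i + 1)) := by
    rw [τ.point_succ, mem_openSegment_add_mul (τ.len_pos i)]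
    exact ⟨t, h0, h1, rfl⟩
  refine P.notMem_interior_of_mem_side (e := τ.edge i) ?_ (τ.chord_subset i h2)
  have h3 := τ.mem_openSide (i + 1)
  rw [h] at h3
  exact (convex_segment _ _).openSegment_subset (P.openSide_subset_side _ (τ.mem_openSide i))
    (P.openSide_subset_side _ h3) h2

theorem crossIm_dir_neg [Finite 𝒜] (i : ℤ) :
    crossIm (P.edgeVec (τ.edge (i + 1))) (τ.dir i) < 0 := by
  refine crossIm_neg_of_reaches (τ.mem_openSide (i + 1)) (τ.len_pos i) fun t h0 h1 => ?_
  have := τ.mem_interior (i := i) (t := τ.len i - t) (by linarith) (by linarith)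
  rw [τ.point_succ]; push_cast at this
  convert! this using 1; ring

/-- The trajectory with its bounces renumbered. -/
def shift (k : ℤ) : P.Trajectory where
  edge i := τ.edge (i + k)
  point i := τ.point (i + k)
  dir i := τ.dir (i + k)
  len i := τ.len (i + k)
  norm_dir i := τ.norm_dir _
  len_pos i := τ.len_pos _
  point_mem i := τ.point_mem _
  point_succ i := by rw [add_right_comm]; exact τ.point_succ _
  chord_subset i := by rw [add_right_comm]; exact τ.chord_subset _
  dir_succ i := by rw [add_right_comm]; exact τ.dir_succ _

/-- The trajectory run backwards. -/
noncomputable def reverse : P.Trajectory where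
  edge i := τ.edge (-i)
  point i := τ.point (-i)
  -- The chord leaving the `i`-th bounce of the reversed trajectory is the one that arrives at
  -- bounce `-i`, and that chord has the index `-i - 1`.
  dir i := -τ.dir (-i - 1)
  len i := τ.len (-i - 1)
  norm_dir i := by rw [norm_neg]; exact τ.norm_dir _
  len_pos i := τ.len_pos _
  point_mem i := τ.point_mem _
  point_succ i := by
    have := τ.point_succ (-i - 1)
    rw [sub_add_cancel] at this
    rw [this, show -(i + 1) = -i - 1 by ring]; ring
  chord_subset i := by
    have := τ.chord_subset (-i - 1)
    rw [sub_add_cancel] at this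
    rw [openSegment_symm, show -(i + 1) = -i - 1 by ring]; exact this
  dir_succ i := by
    have := τ.dir_succ (-(i + 1) - 1)
    rw [sub_add_cancel] at this
    rw [show -i - 1 = -(i + 1) by ring, this, reflectAlong_neg,
      reflectAlong_reflectAlong (P.edgeVec_ne_zero _)]

section Corner

variable {τ} {A B : 𝒜}

/-- The angle from which a trajectory hits an edge of a corner. -/
theorem exists_dir_eq_neg_ray [Finite 𝒜] (hAB : P.next B = A) {m : ℕ} {i : ℤ}
    (h : τ.edge (i + 1) = alternatingLetter A B m) :
    ∃ β, 0 < β ∧ β < Real.pi ∧ τ.dir i = -P.ray A m β := by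
  obtain ⟨β, h1, h2, h3⟩ := P.ray_surjective A m (-Real.pi) (z := -τ.dir i)
    (by rw [norm_neg, τ.norm_dir])
  have hd : τ.dir i = -P.ray A m β := by rw [← h3, neg_neg]
  have hc := τ.crossIm_dir_neg i
  rw [hd, h, crossIm_neg_right, crossIm_edgeVec_ray hAB] at hc
  have hl := norm_pos_iff.2 (P.edgeVec_ne_zero (alternatingLetter A B m))
  have hs : 0 < Real.sin β := by
    by_contra hs
    push Not at hs
    nlinarith
  refine ⟨β, ?_, by linarith, hd⟩
  by_contra hβ
  push Not at hβ
  exact absurd (Real.sin_nonpos_of_nonpos_of_neg_pi_le hβ h1) (not_le.2 hs)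

/-- From one bounce at a corner to the next one, the angle grows by the interior angle. -/
theorem dir_eq_of_edge_eq (hAB : P.next B = A) {m : ℕ} {i : ℤ} {β : ℝ}
    (h0 : τ.edge (i + 1) = alternatingLetter A B m)
    (h1 : τ.edge (i + 1 + 1) = alternatingLetter A B (m + 1)) (hβ0 : 0 < β) (hβ1 : β < Real.pi)
    (hd : τ.dir i = -P.ray A m β) :
    β + P.interiorAngle A < Real.pi ∧
      τ.dir (i + 1) = -P.ray A (m + 1) (β + P.interiorAngle A) := by
  set θ := P.interiorAngle A with hθ
  have hθ0 : 0 < θ := interiorAngle_pos hAB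
  have hθ2 : θ < 2 * Real.pi := P.interiorAngle_lt A
  have hdir : τ.dir (i + 1) = P.ray A m (Real.pi - β) := by
    rw [τ.dir_succ, h0, hd, reflectAlong_neg, reflectAlong_ray hAB, ← ray_add_pi, neg_add_eq_sub]
  have hdir' : τ.dir (i + 1) = -P.ray A (m + 1) (β + θ) := by
    rw [hdir, ray_succ, ← ray_add_pi]; congr 1; ring
  refine ⟨?_, hdir'⟩
  have hp0 := P.openSide_subset_side _ (τ.mem_openSide (i + 1))
  have hp1 := P.openSide_subset_side _ (τ.mem_openSide (i + 1 + 1))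
  rw [h0] at hp0; rw [h1] at hp1
  obtain ⟨s, hs, hps⟩ := exists_eq_add_ray_of_mem_side hAB m hp0
  obtain ⟨t, ht, hpt⟩ := exists_eq_add_ray_of_mem_side hAB (m + 1) hp1
  have hs0 : 0 < s := by
    refine lt_of_le_of_ne hs ?_
    rintro rfl
    have := τ.mem_openSide (i + 1)
    rw [hps, Complex.ofReal_zero, zero_mul, add_zero] at this
    exact P.start_notMem_openSide _ _ this
  have hL := τ.len_pos (i + 1)
  set L := τ.len (i + 1)
  -- The triangle formed by the vertex and the two bounces, with sides `s`, `L`, `t`. Its cross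
  -- products with the two edge directions give `L sin β = t sin θ` and `L sin (π - β - θ) = s sin
  -- θ`: the first forces `θ < π`, the second `β + θ < π`.
  have heq : (s : ℂ) * P.ray A m 0 + (L : ℂ) * P.ray A m (Real.pi - β) =
      (t : ℂ) * P.ray A m θ := by
    have := τ.point_succ (i + 1)
    rw [hps, hpt, hdir, ray_succ, sub_zero] at this
    linear_combination -this
  have hz : ∀ u, s * Real.sin (0 - u) + L * Real.sin (Real.pi - β - u) =
      t * Real.sin (θ - u) := by
    intro u
    have h2 := congrArg (crossIm (P.ray A m u)) heq
    rw [crossIm_add_right, crossIm_smul_right, crossIm_smul_right, crossIm_smul_right,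
      crossIm_ray, crossIm_ray, crossIm_ray] at h2
    split_ifs at h2 <;> linarith
  have hz0 := hz 0
  have hzθ := hz θ
  rw [sub_zero, Real.sin_zero, sub_zero, sub_zero, Real.sin_pi_sub] at hz0
  have hsβ := Real.sin_pos_of_pos_of_lt_pi hβ0 hβ1
  have hsθ : 0 < Real.sin θ := by
    by_contra hcon
    push Not at hcon
    nlinarith [mul_pos hL hsβ]
  have hθπ : θ < Real.pi := by
    by_contra hcon
    push Not at hcon
    have := Real.sin_nonneg_of_nonneg_of_le_pi (x := θ - Real.pi) (by linarith) (by linarith)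
    rw [Real.sin_sub_pi] at this
    linarith
  by_contra hcon
  push Not at hcon
  rw [zero_sub, Real.sin_neg, sub_self, Real.sin_zero] at hzθ
  have h3 := Real.sin_nonneg_of_nonneg_of_le_pi (x := β + θ - Real.pi) (by linarith) (by linarith)
  have h4 : Real.sin (Real.pi - β - θ) = -Real.sin (β + θ - Real.pi) := by
    rw [← Real.sin_neg]; congr 1; ring
  rw [h4] at hzθ
  nlinarith [mul_pos hs0 hsθ, mul_nonneg hL.le h3]

theorem dir_eq_of_alternates (hAB : P.next B = A) {m : ℕ} {i : ℤ} {β : ℝ} {n : ℕ}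
    (h : ∀ j < n + 1, τ.edge (i + 1 + j) = alternatingLetter A B (m + j))
    (hβ0 : 0 < β) (hβ1 : β < Real.pi) (hd : τ.dir i = -P.ray A m β) :
    β + n * P.interiorAngle A < Real.pi ∧
      τ.dir (i + n) = -P.ray A (m + n) (β + n * P.interiorAngle A) := by
  induction n with
  | zero => simpa using ⟨hβ1, hd⟩
  | succ n ih =>
    obtain ⟨h1, h2⟩ := ih fun j hj => h j (by omega)
    have e1 := h n (by omega)
    have e2 := h (n + 1) (by omega)
    have hθ0 : 0 < P.interiorAngle A := interiorAngle_pos hAB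
    have hn : (0 : ℝ) ≤ n * P.interiorAngle A := by positivity
    have := dir_eq_of_edge_eq (τ := τ) hAB (m := m + n) (i := i + n)
      (β := β + n * P.interiorAngle A)
      (by rw [← e1]; congr 1; ring) (by rw [add_assoc m, ← e2]; congr 1; push_cast; ring)
      (by linarith) h1 h2
    push_cast
    rw [add_one_mul, ← add_assoc, ← add_assoc, ← add_assoc]
    exact this

end Corner

theorem sum_len_nonneg (i : ℤ) (n : ℕ) : 0 ≤ ∑ j ∈ Finset.range n, τ.len (i + j) :=
  Finset.sum_nonneg fun _ _ => (τ.len_pos _).le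

theorem dist_point_le (i : ℤ) (n : ℕ) :
    dist (τ.point (i + n)) (τ.point i) ≤ ∑ j ∈ Finset.range n, τ.len (i + j) := by
  induction n with
  | zero => simp
  | succ n ih =>
    rw [Finset.sum_range_succ]
    refine (dist_triangle _ (τ.point (i + n)) _).trans ?_
    rw [add_comm]
    refine add_le_add ih ?_
    push_cast
    rw [← add_assoc, τ.point_succ, dist_eq_norm, add_sub_cancel_left, norm_mul, τ.norm_dir,
      mul_one, Complex.norm_real, Real.norm_of_nonneg (τ.len_pos _).le]

theorem edge_eq_alternatingLetter {A B : 𝒜} {i : ℤ} {N : ℕ}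
    (h : ∀ j ≤ N, τ.edge (i + j) = A ∨ τ.edge (i + j) = B) :
    ∃ m, ∀ j ≤ N, τ.edge (i + j) = alternatingLetter A B (m + j) := by
  have key : ∀ m, τ.edge i = alternatingLetter A B m → ∀ j ≤ N,
      τ.edge (i + j) = alternatingLetter A B (m + j) := by
    intro m hm j
    induction j with
    | zero => intro _; simpa using hm
    | succ j ih =>
      intro hj
      have h1 := ih (by omega)
      have h2 := τ.edge_succ_ne (i + j)
      have h3 := h (j + 1) hj
      push_cast at h3 ⊢
      rw [add_assoc] at h2
      rw [h1] at h2
      unfold alternatingLetter at h2 ⊢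
      rw [← add_assoc m]
      by_cases hm' : Even (m + j)
      · rw [if_pos hm'] at h2
        rw [if_neg (by rw [Nat.even_add_one]; exact not_not.2 hm')]
        exact h3.resolve_left h2
      · rw [if_neg hm'] at h2
        rw [if_pos (by rw [Nat.even_add_one]; exact hm')]
        exact h3.resolve_right h2
  rcases h 0 (by omega) with h0 | h0
  · exact ⟨0, key 0 (by simpa [alternatingLetter] using h0)⟩
  · exact ⟨1, key 1 (by simpa [alternatingLetter] using h0)⟩

/-- A trajectory travels at least a fixed distance in a fixed number of bounces. -/
theorem exists_le_sum_len [Finite 𝒜] (P : BilliardTable 𝒜) : ∃ δ > 0, ∃ N : ℕ,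
    ∀ (τ : P.Trajectory) (i : ℤ), δ ≤ ∑ j ∈ Finset.range N, τ.len (i + j) := by
  choose r hr hb using fun y => P.exists_ball_side y
  obtain ⟨δ, hδ, hL⟩ := lebesgue_number_lemma_of_metric (c := fun y : ℂ => Metric.ball y (r y))
    P.isCompact_region (fun _ => Metric.isOpen_ball)
    (fun x _ => Set.mem_iUnion.2 ⟨x, Metric.mem_ball_self (hr x)⟩)
  -- At a corner the angle grows by `θ` per bounce and stays below `π`, so `K` bounces with `Kθ > π`
  -- are too many.
  have hK : ∀ A, ∃ K : ℕ, Real.pi < K * P.interiorAngle A := by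
    intro A
    obtain ⟨K, hK⟩ := exists_nat_gt (Real.pi / P.interiorAngle A)
    exact ⟨K, by rwa [div_lt_iff₀ (interiorAngle_pos (P.next.apply_symm_apply A))] at hK⟩
  choose K hK using hK
  obtain ⟨N₀, hN₀⟩ := Finite.exists_le K
  refine ⟨δ, hδ, N₀ + 1, fun τ i => ?_⟩
  by_contra hcon
  push Not at hcon
  -- A piece shorter than the Lebesgue number stays in a ball where every edge passes through the
  -- centre `y`. Consecutive edges differ, so `y` is a vertex and all the bounces alternate between
  -- its two edges.
  obtain ⟨y, hy⟩ := hL _ (τ.mem_region i)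
  have hyside : ∀ j ≤ N₀ + 1, y ∈ P.side (τ.edge (i + j)) := by
    intro j hj
    refine hb y _ _ (P.openSide_subset_side _ (τ.mem_openSide (i + j))) (hy ?_)
    refine lt_of_le_of_lt ((τ.dist_point_le i j).trans ?_) hcon
    exact Finset.sum_le_sum_of_subset_of_nonneg (Finset.range_mono hj)
      fun _ _ _ => (τ.len_pos _).le
  obtain ⟨A, rfl⟩ : ∃ A, y = P.start A := by
    have h0 := hyside 0 (by omega)
    have h1 := hyside 1 (by omega)
    have hne := τ.edge_succ_ne i
    simp only [Nat.cast_zero, add_zero, Nat.cast_one] at h0 h1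
    rcases P.edge_inter _ _ hne _ h1 h0 with h | h
    · exact ⟨_, h.1⟩
    · exact ⟨_, h.1⟩
  have hAB := P.next.apply_symm_apply A
  set B := P.next.symm A
  obtain ⟨m, hm⟩ := τ.edge_eq_alternatingLetter (A := A) (B := B) (i := i) (N := N₀ + 1)
    fun j hj => eq_alternatingLetter_of_start_mem_side hAB (hyside j hj)
  obtain ⟨β, hβ0, hβ1, hβ⟩ := exists_dir_eq_neg_ray (τ := τ) hAB (m := m) (i := i - 1)
    (by simpa using hm 0 (by omega))
  have := (dir_eq_of_alternates (τ := τ) hAB (m := m) (i := i - 1) (n := N₀)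
    (fun j hj => by rw [sub_add_cancel]; exact hm j (by omega)) hβ0 hβ1 hβ).1
  have h1 : (K A : ℝ) ≤ N₀ := by exact_mod_cast hN₀ A
  have h2 := hK A
  have h3 : 0 < P.interiorAngle A := interiorAngle_pos hAB
  nlinarith

theorem exists_sum_len_ge [Finite 𝒜] (P : BilliardTable 𝒜) (L : ℝ) : ∃ n : ℕ,
    ∀ (τ : P.Trajectory) (i : ℤ), L ≤ ∑ j ∈ Finset.range n, τ.len (i + j) := by
  obtain ⟨δ, hδ, N, hN⟩ := exists_le_sum_len P
  have key : ∀ (k : ℕ) (τ : P.Trajectory) (i : ℤ),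
      k * δ ≤ ∑ j ∈ Finset.range (k * N), τ.len (i + j) := by
    intro k
    induction k with
    | zero => intro τ i; simp
    | succ k ih =>
      intro τ i
      rw [add_one_mul, Finset.sum_range_add]
      have h1 := ih τ i
      have h2 := hN τ (i + (k * N : ℕ))
      have h3 : ∑ x ∈ Finset.range N, τ.len (i + ((k * N + x : ℕ) : ℤ)) =
          ∑ j ∈ Finset.range N, τ.len (i + (k * N : ℕ) + j) :=
        Finset.sum_congr rfl fun x _ => by rw [Nat.cast_add, add_assoc]
      rw [h3]; push_cast at *; linarith
  obtain ⟨k, hk⟩ := exists_nat_gt (L / δ)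
  rw [div_lt_iff₀ hδ] at hk
  exact ⟨k * N, fun τ i => hk.le.trans (key k τ i)⟩

end Trajectory

/-! ### Unfolding a trajectory -/

/-- The reflection of the plane in the line through an edge. -/
noncomputable def fold (P : BilliardTable 𝒜) (e : 𝒜) (z : ℂ) : ℂ :=
  P.start e + reflectAlong (P.edgeVec e) (z - P.start e)

/-- The composition of the reflections in the edges of a word; the last letter acts first. -/
noncomputable def foldWord (P : BilliardTable 𝒜) : List 𝒜 → ℂ → ℂ
  | [], z => z
  | e :: w, z => P.fold e (P.foldWord w z)

theorem dist_fold (e : 𝒜) (z w : ℂ) : dist (P.fold e z) (P.fold e w) = dist z w := by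
  rw [dist_eq_norm, dist_eq_norm, ← norm_reflectAlong (P.edgeVec_ne_zero e) (z - w)]
  have : z - w = (z - P.start e) + -(w - P.start e) := by ring
  rw [this, reflectAlong_add, reflectAlong_neg, fold, fold]
  congr 1; ring

theorem dist_foldWord (w : List 𝒜) (y z : ℂ) :
    dist (P.foldWord w y) (P.foldWord w z) = dist y z := by
  induction w with
  | nil => rfl
  | cons e w ih => rw [foldWord, foldWord, dist_fold, ih]

theorem fold_add {e : 𝒜} {y : ℂ} (hy : y ∈ P.side e) (v : ℂ) :
    P.fold e (y + v) = y + reflectAlong (P.edgeVec e) v := by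
  obtain ⟨s, -, -, rfl⟩ := P.mem_side.1 hy
  have : P.start e + (s : ℂ) * P.edgeVec e + v - P.start e = (s : ℂ) * P.edgeVec e + v := by ring
  rw [fold, this, reflectAlong_add, reflectAlong_self_mul (P.edgeVec_ne_zero e), add_assoc]

namespace Trajectory

/-- The word of the `n` bounces after the `i`-th one, the last one first. -/
def bounceWord (f : ℤ → 𝒜) (i : ℤ) : ℕ → List 𝒜
  | 0 => []
  | n + 1 => f (i + n + 1) :: bounceWord f i n

theorem bounceWord_congr {f g : ℤ → 𝒜} {i k : ℤ} {n : ℕ}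
    (h : ∀ j < n, f (i + j + 1) = g (k + j + 1)) : bounceWord f i n = bounceWord g k n := by
  induction n with
  | zero => rfl
  | succ n ih => rw [bounceWord, bounceWord, h n (by omega), ih fun j hj => h j (by omega)]

/-- Instead of reflecting the direction at a bounce, one goes straight on and reflects the plane;
the two agree because the bounce point lies on the mirror (`fold_add`). -/
theorem point_add_dir (τ : P.Trajectory) (i : ℤ) (n : ℕ) (s : ℝ) :
    τ.point (i + n) + (s : ℂ) * τ.dir (i + n) = P.foldWord (bounceWord τ.edge i n)
      (τ.point i + ((∑ j ∈ Finset.range n, τ.len (i + j) + s : ℝ) : ℂ) * τ.dir i) := by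
  induction n generalizing s with
  | zero => simp [bounceWord, foldWord]
  | succ n ih =>
    rw [Finset.sum_range_succ, bounceWord, foldWord, add_assoc (Finset.sum _ _), ← ih]
    push_cast
    rw [← add_assoc, τ.dir_succ, ← reflectAlong_ofReal_mul,
      ← fold_add (P.openSide_subset_side _ (τ.mem_openSide _)), τ.point_succ]
    congr 1; ring

/-- Trajectories with the same long forward bounce sequence have almost the same direction. -/
theorem exists_dist_dir_le [Finite 𝒜] (P : BilliardTable 𝒜) {η : ℝ} (hη : 0 < η) :
    ∃ n : ℕ, ∀ (τ τ' : P.Trajectory) (i k : ℤ),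
      (∀ j < n, τ.edge (i + j + 1) = τ'.edge (k + j + 1)) → ‖τ.dir i - τ'.dir k‖ ≤ η := by
  obtain ⟨D, hD⟩ := Metric.isBounded_iff.1 P.isCompact_region.isBounded
  obtain ⟨n, hn⟩ := exists_sum_len_ge P ((4 * |D| + 1) / η)
  refine ⟨n, fun τ τ' i k h => ?_⟩
  have h1 := τ.point_add_dir i n 0
  have h2 := τ'.point_add_dir k n 0
  rw [bounceWord_congr h] at h1
  simp only [Complex.ofReal_zero, zero_mul, add_zero] at h1 h2
  have h3 := hD (τ.mem_region (i + n)) (τ'.mem_region (k + n))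
  -- Equal bounce words fold by the same isometry, so the unfolded endpoints are as close together
  -- as the actual ones, which lie in the bounded table.
  rw [h1, h2, dist_foldWord] at h3
  have h4 := hD (τ.mem_region i) (τ'.mem_region k)
  have hT := hn τ i
  set T := ∑ j ∈ Finset.range n, τ.len (i + j)
  set T' := ∑ j ∈ Finset.range n, τ'.len (k + j)
  have hT0 : 0 ≤ T := τ.sum_len_nonneg i n
  have hT0' : 0 ≤ T' := τ'.sum_len_nonneg k n
  have hDD : D ≤ |D| := le_abs_self D
  have h5 : ‖(T : ℂ) * τ.dir i - (T' : ℂ) * τ'.dir k‖ ≤ 2 * |D| := by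
    have : (T : ℂ) * τ.dir i - (T' : ℂ) * τ'.dir k =
        (τ.point i + (T : ℂ) * τ.dir i - (τ'.point k + (T' : ℂ) * τ'.dir k)) -
        (τ.point i - τ'.point k) := by ring
    rw [this]
    refine (norm_sub_le _ _).trans ?_
    rw [← dist_eq_norm, ← dist_eq_norm]; linarith
  -- The two lengths may differ, so replacing `T'` by `T` costs another `2|D|`.
  have h6 : |T - T'| ≤ 2 * |D| := by
    have := (abs_norm_sub_norm_le ((T : ℂ) * τ.dir i) ((T' : ℂ) * τ'.dir k)).trans h5
    rwa [norm_mul, norm_mul, τ.norm_dir, τ'.norm_dir, mul_one, mul_one, Complex.norm_real,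
      Complex.norm_real, Real.norm_of_nonneg hT0, Real.norm_of_nonneg hT0'] at this
  have h7 : T * ‖τ.dir i - τ'.dir k‖ ≤ 4 * |D| := by
    have e : (T : ℂ) * (τ.dir i - τ'.dir k) =
        ((T : ℂ) * τ.dir i - (T' : ℂ) * τ'.dir k) - ((T - T' : ℝ) : ℂ) * τ'.dir k := by
      push_cast; ring
    have : T * ‖τ.dir i - τ'.dir k‖ = ‖(T : ℂ) * (τ.dir i - τ'.dir k)‖ := by
      rw [norm_mul, Complex.norm_real, Real.norm_of_nonneg hT0]
    rw [this, e]
    refine (norm_sub_le _ _).trans ?_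
    rw [norm_mul, τ'.norm_dir, mul_one, Complex.norm_real, Real.norm_eq_abs]
    linarith
  rw [div_le_iff₀ hη] at hT
  by_contra hcon
  push Not at hcon
  have := mul_le_mul_of_nonneg_left hcon.le hT0
  linarith

end Trajectory

end BilliardTable

/-! ### Insertions, grazing and the total turning angle -/

namespace BilliardTable

variable {𝒜 : Type*} {P : BilliardTable 𝒜} {A B : 𝒜}

/-- The law of sines locates the point where the line from `ρ * ray σ` in the direction `-ray β`
crosses the line of the `m`-th letter: the time is `ρ sin σ / sin β`, the distance from the vertex
`ρ sin (β - σ) / sin β`. -/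
theorem ray_mul_sub_eq (A : 𝒜) (m : ℕ) {σ β ρ : ℝ} (hs : Real.sin β ≠ 0) :
    (ρ : ℂ) * P.ray A m σ + ((ρ * Real.sin σ / Real.sin β : ℝ) : ℂ) * -P.ray A m β =
      ((ρ * Real.sin (β - σ) / Real.sin β : ℝ) : ℂ) * P.ray A m 0 := by
  have h := P.sin_mul_ray A m 0 β σ
  rw [sub_zero, sub_zero] at h
  have hs' : (Real.sin β : ℂ) ≠ 0 := by exact_mod_cast hs
  have e1 : P.ray A m σ = ((Real.sin (β - σ) : ℂ) * P.ray A m 0 +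
      (Real.sin σ : ℂ) * P.ray A m β) / (Real.sin β : ℂ) := by
    rw [← h, mul_div_cancel_left₀ _ hs']
  rw [e1, Complex.ofReal_div, Complex.ofReal_div, Complex.ofReal_mul, Complex.ofReal_mul]
  field_simp
  ring

/-- Bounds the crossing distance of `ray_mul_sub_eq` by `ρ / sin η`. Up to `π / 2` the sine is
monotone; beyond, `sin η ≤ sin (π - β)`. -/
theorem sin_sub_mul_sin_le {σ β η : ℝ} (hσ : 0 < σ) (hσβ : σ < β) (hη : 0 < η)
    (hβ : β < Real.pi - η) :
    Real.sin (β - σ) * Real.sin η ≤ Real.sin β := by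
  have hπ := Real.pi_pos
  have h0 : 0 ≤ Real.sin (β - σ) :=
    Real.sin_nonneg_of_nonneg_of_le_pi (by linarith) (by linarith)
  have h1 : 0 ≤ Real.sin η := Real.sin_nonneg_of_nonneg_of_le_pi (by linarith) (by linarith)
  rcases le_or_gt β (Real.pi / 2) with h | h
  · have : Real.sin (β - σ) ≤ Real.sin β :=
      Real.sin_le_sin_of_le_of_le_pi_div_two (by linarith) h (by linarith)
    nlinarith [Real.sin_le_one η]
  · have : Real.sin η ≤ Real.sin (Real.pi - β) :=
      Real.sin_le_sin_of_le_of_le_pi_div_two (by linarith) (by linarith) (by linarith)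
    rw [Real.sin_pi_sub] at this
    nlinarith [Real.sin_le_one (β - σ)]

/-- A segment that starts close to a vertex and ends on an edge away from the vertex almost does not
meet the sides of the corner, so its direction lies almost in the corner. -/
theorem pi_sub_le_of_passes (hAB : P.next B = A) {r : ℝ}
    (hlen : ∀ m, r ≤ ‖P.edgeVec (alternatingLetter A B m)‖)
    (hside : ∀ e, ∀ x ∈ P.side e, dist x (P.start A) < r → e = A ∨ e = B)
    {m : ℕ} {σ β ρ T η : ℝ} (hσ0 : 0 < σ) (hσβ : σ < β)
    (hη : 0 < η) (hρ0 : 0 < ρ) (hρ : ρ < r * Real.sin η)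
    (hint : ∀ t : ℝ, 0 < t → t < T →
      P.start A + (ρ : ℂ) * P.ray A m σ + (t : ℂ) * -P.ray A m β ∈ interior P.region)
    (hT : 0 < T) {e : 𝒜} (heA : e ≠ A) (heB : e ≠ B)
    (he : P.start A + (ρ : ℂ) * P.ray A m σ + (T : ℂ) * -P.ray A m β ∈ P.side e) :
    Real.pi - η ≤ β := by
  by_contra hcon
  push Not at hcon
  have hsβ : 0 < Real.sin β := Real.sin_pos_of_pos_of_lt_pi (by linarith) (by linarith)
  have hsσ : 0 < Real.sin σ := Real.sin_pos_of_pos_of_lt_pi (by linarith) (by linarith)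
  have hsβσ : 0 < Real.sin (β - σ) := Real.sin_pos_of_pos_of_lt_pi (by linarith) (by linarith)
  have hsη : 0 < Real.sin η := Real.sin_pos_of_pos_of_lt_pi hη (by linarith)
  have hr : 0 < r := by
    by_contra h
    push Not at h
    nlinarith
  have heq := ray_mul_sub_eq (P := P) A m (σ := σ) (ρ := ρ) hsβ.ne'
  set t₀ := ρ * Real.sin σ / Real.sin β with ht₀
  set ρ' := ρ * Real.sin (β - σ) / Real.sin β with hρ'
  have ht₀0 : 0 < t₀ := by positivity
  have hρ'0 : 0 < ρ' := by positivity
  have hρ'r : ρ' < r := by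
    rw [hρ', div_lt_iff₀ hsβ]
    calc ρ * Real.sin (β - σ) < r * Real.sin η * Real.sin (β - σ) := by gcongr
      _ = r * (Real.sin (β - σ) * Real.sin η) := by ring
      _ ≤ r * Real.sin β := by gcongr; exact sin_sub_mul_sin_le hσ0 hσβ hη hcon
  have hz : P.start A + (ρ : ℂ) * P.ray A m σ + (t₀ : ℂ) * -P.ray A m β =
      P.start A + (ρ' : ℂ) * P.ray A m 0 := by rw [add_assoc, heq]
  have hzs := P.openSide_subset_side _ (add_ray_mem_openSide hAB m hρ'0 (hρ'r.trans_le (hlen m)))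
  -- If the letter is crossed before time `T`, the path leaves the interior too early. Otherwise the
  -- endpoint still lies in the ball about the vertex, where only `A` and `B` occur.
  rcases lt_or_ge t₀ T with h | h
  · have := hint t₀ ht₀0 h
    rw [hz] at this
    exact P.notMem_interior_of_mem_side hzs this
  · have hb : P.start A + (ρ : ℂ) * P.ray A m σ + (T : ℂ) * -P.ray A m β ∈
        Metric.ball (P.start A) r := by
      refine (convex_ball (P.start A) r).segment_subset
        (x := P.start A + (ρ : ℂ) * P.ray A m σ)
        (y := P.start A + (ρ : ℂ) * P.ray A m σ + (t₀ : ℂ) * -P.ray A m β) ?_ ?_ ?_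
      · rw [Metric.mem_ball, dist_eq_norm, add_sub_cancel_left, norm_mul, norm_ray, mul_one,
          Complex.norm_real, Real.norm_of_nonneg hρ0.le]
        nlinarith [Real.sin_le_one η]
      · rw [hz, Metric.mem_ball, dist_eq_norm, add_sub_cancel_left, norm_mul, norm_ray, mul_one,
          Complex.norm_real, Real.norm_of_nonneg hρ'0.le]
        exact hρ'r
      · rw [mem_segment_iff_ofReal]
        refine ⟨T / t₀, by positivity, by rwa [div_le_one ht₀0], ?_⟩
        have : (t₀ : ℂ) ≠ 0 := by exact_mod_cast ht₀0.ne'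
        push_cast; field_simp; ring
    rcases hside e _ he hb with h | h
    · exact heA h
    · exact heB h

theorem exists_eq_add_ray_of_mem_interior (hAB : P.next B = A) {r : ℝ}
    (hlen : ∀ m, r ≤ ‖P.edgeVec (alternatingLetter A B m)‖)
    (hout : ∀ m, ∀ ρ s : ℝ, 0 < ρ → ρ < r → P.interiorAngle A < s → s < 2 * Real.pi →
        P.start A + (ρ : ℂ) * P.ray A m s ∉ P.region) (m : ℕ) {q : ℂ}
    (hq : q ∈ interior P.region) (hqr : dist q (P.start A) < r) :
    ∃ ρ σ : ℝ, 0 < ρ ∧ ρ = dist q (P.start A) ∧ 0 < σ ∧ σ < P.interiorAngle A ∧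
      q = P.start A + (ρ : ℂ) * P.ray A m σ := by
  have hqp : q ≠ P.start A := by
    rintro rfl
    exact P.notMem_interior_of_mem_side (P.start_mem_side A) hq
  have hρ0 : 0 < dist q (P.start A) := dist_pos.2 hqp
  set ρ := dist q (P.start A) with hρ
  have hρ' : (ρ : ℂ) ≠ 0 := by exact_mod_cast hρ0.ne'
  obtain ⟨σ, h1, h2, h3⟩ := P.ray_surjective A m 0 (z := (q - P.start A) / ρ)
    (by rw [norm_div, Complex.norm_real, ← dist_eq_norm, Real.norm_of_nonneg hρ0.le, ← hρ,
          div_self hρ0.ne'])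
  have hq' : q = P.start A + (ρ : ℂ) * P.ray A m σ := by
    rw [← h3]; field_simp; ring
  refine ⟨ρ, σ, hρ0, rfl, ?_, ?_, hq'⟩
  · refine lt_of_le_of_ne h1 ?_
    rintro rfl
    rw [hq'] at hq
    exact P.notMem_interior_of_mem_side (P.openSide_subset_side _
      (add_ray_mem_openSide hAB m hρ0 (hqr.trans_le (hlen m)))) hq
  · rcases lt_trichotomy σ (P.interiorAngle A) with h | h | h
    · exact h
    · exfalso
      have : P.ray A m σ = P.ray A (m + 1) 0 := by rw [ray_succ, sub_zero, h]
      rw [hq', this] at hq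
      exact P.notMem_interior_of_mem_side (P.openSide_subset_side _
        (add_ray_mem_openSide hAB (m + 1) hρ0 (hqr.trans_le (hlen _)))) hq
    · exact absurd (interior_subset hq) (by
        conv => rw [hq']
        exact hout m ρ σ hρ0 hqr h (by linarith))

/-- The angle of a trajectory that grazes a vertex. -/
theorem exists_dir_eq_of_grazes [Finite 𝒜] (hAB : P.next B = A) {m : ℕ} {S : InsertedSequence 𝒜}
    (h : P.GrazesVertex A B (alternatingLetter A B m) S) {η : ℝ} (hη : 0 < η)
    (hη2 : η ≤ Real.pi / 2) (N : ℕ) : ∃ (τ : P.Trajectory) (β : ℝ),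
      (∀ j : ℤ, -(N : ℤ) ≤ j → j < N → τ.edge j = S.seq (S.pos + j)) ∧
      τ.dir (-1) = -P.ray A m β ∧ Real.pi - η ≤ β ∧ β ≤ P.interiorAngle A + η := by
  obtain ⟨r, hr, hlen, hside, -, hout⟩ := exists_sector hAB
  obtain ⟨ha0, hb0, ha1, hb1, hgr⟩ := h
  have hsη : 0 < Real.sin η := Real.sin_pos_of_pos_of_lt_pi hη (by linarith [Real.pi_pos])
  have hrη : 0 < r * Real.sin η := by positivity
  -- The window `N + 1` covers the positions `-1` and `0` even when `N = 0`.
  obtain ⟨τ, hτ, q, hq, hqd, hB, hA⟩ := hgr (N + 1) (r * Real.sin η) hrη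
  have e0 : τ.edge (-1) = S.seq (S.pos - 1) := by
    rw [hτ (-1) (by push_cast; omega) (by push_cast; omega)]; rfl
  have e1 : τ.edge 0 = S.seq S.pos := by
    rw [hτ 0 (by push_cast; omega) (by push_cast; omega), add_zero]
  have hps := τ.point_succ (-1)
  have hL := τ.len_pos (-1)
  have hnd := τ.norm_dir (-1)
  have hmi := fun t => τ.mem_interior (i := -1) (t := t)
  have hp0 := P.openSide_subset_side _ (τ.mem_openSide 0)
  have hp1 := P.openSide_subset_side _ (τ.mem_openSide (-1))
  rw [show (-1 : ℤ) + 1 = 0 by norm_num] at hps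
  rw [hps, mem_openSegment_add_mul hL] at hq
  rw [hps] at hp0
  rw [e1] at hp0
  rw [e0] at hp1
  set L := τ.len (-1)
  set d := τ.dir (-1) with hd
  set p₁ := τ.point (-1)
  obtain ⟨t₁, ht0, ht1, hq⟩ := hq
  have hqi : q ∈ interior P.region := hq ▸ hmi t₁ ht0 ht1
  have hqr : dist q (P.start A) < r := by nlinarith [Real.sin_le_one η]
  obtain ⟨ρ, σ, hρ0, hρ, hσ0, hσ1, hqρ⟩ :=
    exists_eq_add_ray_of_mem_interior hAB hlen hout m hqi hqr
  obtain ⟨β, hβ0, hβ1, hβ⟩ := P.ray_surjective A m σ (z := -d) (by rw [norm_neg, hnd])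
  have hdβ : d = -P.ray A m β := by rw [← hβ, neg_neg]
  -- The side on which `p` is passed enters here: the sign agrees with the orientation in which
  -- angles from the `m`-th letter are measured.
  have hsin : 0 < Real.sin (β - σ) := by
    have hc : ((starRingEnd ℂ) d * (P.start A - q)).im =
        ρ * crossIm (P.ray A m β) (P.ray A m σ) := by
      rw [← crossIm_eq, hdβ, hqρ]; simp [crossIm]; ring
    have e : Real.sin (β - σ) = -Real.sin (σ - β) := by rw [← Real.sin_neg]; congr 1; ring
    rw [hc, crossIm_ray] at hA hB
    rw [e]
    by_cases hm : Even m
    · have := hA (by simp [alternatingLetter, hm])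
      rw [if_pos hm] at this
      by_contra hcon
      push Not at hcon
      nlinarith
    · have := hB (by simp [alternatingLetter, hm])
      rw [if_neg hm] at this
      by_contra hcon
      push Not at hcon
      nlinarith
  have hσβ : σ < β := by
    refine lt_of_le_of_ne hβ0 ?_
    rintro rfl
    simp at hsin
  have hβσ : β - σ < Real.pi := by
    by_contra hcon
    push Not at hcon
    have := Real.sin_nonneg_of_nonneg_of_le_pi (x := β - σ - Real.pi) (by linarith) (by linarith)
    rw [Real.sin_sub_pi] at this
    linarith
  refine ⟨τ, β, fun j h0 h1 => hτ j (by push_cast; omega) (by push_cast; omega), hdβ, ?_, ?_⟩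
  · refine pi_sub_le_of_passes hAB hlen hside (m := m) (T := L - t₁) hσ0 hσβ hη hρ0
      (by rwa [hρ]) ?_ (by linarith) ha1 hb1 ?_
    · intro t h0 h1
      have := hmi (t₁ + t) (by linarith) (by linarith)
      rw [← hqρ, ← hdβ, hq]; push_cast at this
      convert! this using 1; ring
    · rw [← hqρ, ← hdβ, hq]
      convert! hp0 using 1; push_cast; ring
  -- The backward half is the same situation seen from the other edge: there `σ` becomes `θ - σ` and
  -- `β` becomes `θ - β + π`, so the lower bound turns into `β ≤ θ + η`.
  · have key : P.ray A (m + 1) (P.interiorAngle A - σ) = P.ray A m σ := by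
      rw [ray_succ, sub_sub_cancel]
    have key2 : -P.ray A (m + 1) (P.interiorAngle A - β + Real.pi) = -d := by
      rw [ray_succ, show P.interiorAngle A - (P.interiorAngle A - β + Real.pi) = β - Real.pi by ring,
        ray_sub_pi, hdβ]
    have := pi_sub_le_of_passes hAB hlen hside (m := m + 1) (σ := P.interiorAngle A - σ)
      (β := P.interiorAngle A - β + Real.pi) (ρ := ρ) (T := t₁) (by linarith) (by linarith) hη
      hρ0 (by rwa [hρ]) ?_ ht0 ha0 hb0 ?_
    · linarith
    · intro t h0 h1
      have := hmi (t₁ - t) (by linarith) (by linarith)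
      rw [key, key2, ← hqρ, hq]; push_cast at this
      convert! this using 1; ring
    · rw [key, key2, ← hqρ, hq]
      convert! hp1 using 1; ring

theorem exists_trajectory_of_mem_closure [TopologicalSpace 𝒜] [DiscreteTopology 𝒜] {s : ℤ → 𝒜}
    (h : s ∈ closure P.bounceSpectrum) (a b : ℤ) :
    ∃ τ : P.Trajectory, ∀ j ∈ Set.Icc a b, τ.edge j = s j := by
  rw [mem_closure_iff] at h
  obtain ⟨-, hf, τ, rfl⟩ := h ((Set.Icc a b).pi fun j => {s j})
    (isOpen_set_pi (Set.finite_Icc a b) fun _ _ => isOpen_discrete _) (fun j _ => rfl)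
  exact ⟨τ, fun j hj => hf j hj⟩

/-- A matching sequence is approximated by trajectories; the angle by which they turn about the vertex
is `π`, which has to be compared with the length of the insertion. -/
theorem exists_trajectory_of_insertion [Finite 𝒜] [TopologicalSpace 𝒜] [DiscreteTopology 𝒜]
    (hAB : P.next B = A) {m : ℕ} {S : InsertedSequence 𝒜}
    (hcl : S.seq ∈ closure P.bounceSpectrum)
    (hins : ∀ j < S.len, S.seq (S.pos + j) = alternatingLetter A B (m + j))
    (hgr : S.len = 0 → P.GrazesVertex A B (alternatingLetter A B m) S) {η : ℝ} (hη : 0 < η)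
    (hη2 : η ≤ Real.pi / 2) (N : ℕ) : ∃ (τ : P.Trajectory) (β : ℝ),
      (∀ j : ℤ, -(N : ℤ) ≤ j → j < S.len + N → τ.edge j = S.seq (S.pos + j)) ∧
      τ.dir (-1) = -P.ray A m β ∧
      τ.dir (S.len - 1) = P.ray A (m + S.len) (β + S.len * P.interiorAngle A - Real.pi) ∧
      ((0 < S.len ∧ 0 < β ∧ β + (S.len - 1) * P.interiorAngle A < Real.pi) ∨
        (S.len = 0 ∧ Real.pi - η ≤ β ∧ β ≤ P.interiorAngle A + η)) := by
  rcases Nat.eq_zero_or_pos S.len with h0 | h0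
  · obtain ⟨τ, β, h1, h2, h3, h4⟩ := exists_dir_eq_of_grazes hAB (hgr h0) hη hη2 N
    refine ⟨τ, β, fun j hj0 hj1 => h1 j hj0 (by rw [h0] at hj1; simpa using hj1), h2, ?_,
      Or.inr ⟨h0, h3, h4⟩⟩
    rw [h0]
    simp only [Nat.cast_zero, zero_sub, zero_mul, add_zero]
    rw [h2, ray_sub_pi]
  · obtain ⟨τ₀, hτ₀⟩ := exists_trajectory_of_mem_closure hcl (S.pos - N) (S.pos + S.len + N)
    have hτ : ∀ j : ℤ, -(N : ℤ) ≤ j → j < S.len + N →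
        (τ₀.shift S.pos).edge j = S.seq (S.pos + j) := by
      intro j hj0 hj1
      rw [add_comm S.pos]
      exact hτ₀ _ ⟨by linarith, by linarith⟩
    set τ := τ₀.shift S.pos
    -- From the first inserted bounce to the last one the angle grows `len - 1` times; the
    -- reflection at the last letter supplies the remaining `θ`.
    obtain ⟨n, hn⟩ := Nat.exists_eq_add_of_lt h0
    rw [zero_add] at hn
    have hal : ∀ j < n + 1, τ.edge (-1 + 1 + j) = alternatingLetter A B (m + j) := by
      intro j hj
      rw [← hins j (by omega), ← hτ j (by omega) (by omega)]; congr 1; ring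
    obtain ⟨β, hβ0, hβ1, hβ⟩ := Trajectory.exists_dir_eq_neg_ray (τ := τ) hAB (m := m) (i := -1)
      (by simpa using hal 0 (by omega))
    obtain ⟨h1, h2⟩ := Trajectory.dir_eq_of_alternates hAB hal hβ0 hβ1 hβ
    refine ⟨τ, β, hτ, hβ, ?_, Or.inl ⟨h0, hβ0, by rw [hn]; push_cast; linarith⟩⟩
    have hlast := hal n (by omega)
    have h3 := τ.dir_succ (-1 + n)
    rw [h2, show (-1 : ℤ) + n + 1 = -1 + 1 + n by ring, hlast, reflectAlong_neg,
      reflectAlong_ray hAB] at h3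
    rw [hn]
    convert! h3 using 2
    · push_cast; ring
    · rw [← add_assoc, ray_succ, ← ray_add_pi]
      congr 1; push_cast; ring

/-- Closeness of unit vectors determines angles only modulo `2π`. The a priori bound on `x` excludes
neighbourhoods of `±2π`. -/
theorem abs_lt_of_abs_sin_half_lt {x η : ℝ} (hη : 0 < η) (hx : |x| ≤ 2 * Real.pi - η)
    (hs : |Real.sin (x / 2)| < Real.sin (η / 2)) : |x| < η := by
  by_contra hcon
  push Not at hcon
  have key : |Real.sin (x / 2)| = Real.sin (|x| / 2) := by
    have h0 : 0 ≤ Real.sin (|x| / 2) :=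
      Real.sin_nonneg_of_nonneg_of_le_pi (by positivity) (by linarith)
    rcases abs_cases x with ⟨h, -⟩ | ⟨h, -⟩
    · rw [h] at h0 ⊢; exact abs_of_nonneg h0
    · rw [h] at h0 ⊢; rw [← abs_of_nonneg h0, neg_div, Real.sin_neg, abs_neg]
  rw [key] at hs
  rcases le_or_gt (|x| / 2) (Real.pi / 2) with h | h
  · have := Real.sin_le_sin_of_le_of_le_pi_div_two (x := η / 2) (y := |x| / 2)
      (by linarith [Real.pi_pos]) h (by linarith)
    linarith
  · have := Real.sin_le_sin_of_le_of_le_pi_div_two (x := η / 2) (y := Real.pi - |x| / 2)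
      (by linarith [Real.pi_pos]) (by linarith) (by linarith)
    rw [Real.sin_pi_sub] at this
    linarith

theorem totalInsertion_succ (S : ℕ → InsertedSequence 𝒜) (i : ℕ) :
    totalInsertion S (i + 1) = totalInsertion S i + (S i).len := Finset.sum_range_succ _ _

/-- The total turning `π ℓ` of `ℓ` matching sequences is the total length of the insertions times the
interior angle, up to a bounded error. -/
theorem IsMatching.abs_sub_le [Finite 𝒜] [TopologicalSpace 𝒜] [DiscreteTopology 𝒜]
    (hAB : P.next B = A) {ℓ : ℕ} {S : ℕ → InsertedSequence 𝒜} (h : P.IsMatching A B (ℓ + 1) S) :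
    |totalInsertion S (ℓ + 1) * P.interiorAngle A - (ℓ + 1 : ℕ) * Real.pi| ≤
      4 * Real.pi + 1 := by
  set θ := P.interiorAngle A with hθ
  have hθ0 : 0 < θ := interiorAngle_pos hAB
  have hθ2 : θ < 2 * Real.pi := P.interiorAngle_lt A
  have hπ := Real.pi_pos
  -- The first two bounds give the a priori range `2π - η` needed to drop the ambiguity modulo `2π`;
  -- the third keeps the sum of the `ℓ` errors at most `1`.
  obtain ⟨η, hη, hη1, hη2, hη3⟩ : ∃ η > 0, 4 * η ≤ θ ∧ 4 * η ≤ 2 * Real.pi - θ ∧ ℓ * η ≤ 1 := by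
    have h2 : 0 < (2 * Real.pi - θ) / 4 := by linarith
    refine ⟨min (θ / 4) (min ((2 * Real.pi - θ) / 4) (1 / (ℓ + 1))), by positivity, ?_, ?_, ?_⟩
    · linarith [min_le_left (θ / 4) (min ((2 * Real.pi - θ) / 4) (1 / ((ℓ : ℝ) + 1)))]
    · linarith [(min_le_right (θ / 4) (min ((2 * Real.pi - θ) / 4) (1 / ((ℓ : ℝ) + 1)))).trans
        (min_le_left _ _)]
    · have h3 := (min_le_right (θ / 4) (min ((2 * Real.pi - θ) / 4) (1 / ((ℓ : ℝ) + 1)))).trans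
        (min_le_right _ _)
      have h4 : (0 : ℝ) ≤ ℓ := Nat.cast_nonneg ℓ
      refine (mul_le_mul_of_nonneg_left h3 h4).trans ?_
      rw [mul_one_div, div_le_one (by linarith)]; linarith
  have hηπ : η ≤ Real.pi / 2 := by linarith
  have hsη : 0 < Real.sin (η / 2) := Real.sin_pos_of_pos_of_lt_pi (by linarith) (by linarith)
  obtain ⟨N, hN⟩ := Trajectory.exists_dist_dir_le P hsη
  obtain ⟨o, ho⟩ := h.insertions
  choose τ β hedge hin hout hβ using fun i hi =>
    exists_trajectory_of_insertion hAB (h.mem_closure i hi) (ho i hi).1 (ho i hi).2 hη hηπ N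
  have hstep : ∀ i (hi : i < ℓ + 1) (hi' : i + 1 < ℓ + 1),
      |β (i + 1) hi' - (β i hi + (S i).len * θ - Real.pi)| < η := by
    intro i hi hi'
    refine abs_lt_of_abs_sin_half_lt hη ?_ ?_
    · rw [abs_le]
      rcases hβ i hi with ⟨h1, h2, h3⟩ | ⟨h1, h2, h3⟩ <;>
      rcases hβ (i + 1) hi' with ⟨h4, h5, h6⟩ | ⟨h4, h5, h6⟩
      · have h7 : (1 : ℝ) ≤ (S (i + 1)).len := by exact_mod_cast h4
        have h8 : (1 : ℝ) ≤ (S i).len := by exact_mod_cast h1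
        constructor <;> nlinarith
      · have h8 : (1 : ℝ) ≤ (S i).len := by exact_mod_cast h1
        constructor <;> nlinarith
      · have h7 : (1 : ℝ) ≤ (S (i + 1)).len := by exact_mod_cast h4
        rw [h1, Nat.cast_zero, zero_mul]
        constructor <;> nlinarith
      · rw [h1, Nat.cast_zero, zero_mul]
        constructor <;> linarith
    -- Leaving the insertion of `S i` forwards is compared with leaving that of `S (i + 1)`
    -- backwards, whence the reversed trajectory.
    · have h1 := hN (τ i hi) (τ (i + 1) hi').reverse ((S i).len - 1) 0 (by
        intro j hj
        have e1 := hedge i hi ((S i).len - 1 + j + 1) (by omega) (by omega)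
        have e2 := hedge (i + 1) hi' (-(0 + j + 1)) (by omega) (by omega)
        have e3 := h.matching i hi' j
        show (τ i hi).edge _ = (τ (i + 1) hi').edge (-(0 + j + 1))
        rw [e1, e2]
        convert! e3 using 2 <;> ring)
      have h2 : (τ (i + 1) hi').reverse.dir 0 =
          P.ray A (o + totalInsertion S i + (S i).len) (β (i + 1) hi') := by
        show -(τ (i + 1) hi').dir (-0 - 1) = _
        rw [show (-0 - 1 : ℤ) = -1 by norm_num, hin, neg_neg, totalInsertion_succ, add_assoc]
      rw [h2, hout, norm_sub_rev, dist_ray] at h1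
      linarith [abs_nonneg (Real.sin
        ((β (i + 1) hi' - (β i hi + (S i).len * θ - Real.pi)) / 2))]
  have h0 : 0 < ℓ + 1 := Nat.succ_pos ℓ
  have hsum : ∀ i (hi : i < ℓ + 1),
      |β i hi - (β 0 h0 + totalInsertion S i * θ - i * Real.pi)| ≤ i * η := by
    intro i
    induction i with
    | zero => intro hi; simp [totalInsertion]
    | succ i ih =>
      intro hi
      have h1 := abs_le.1 (ih (by omega))
      have h2 := abs_lt.1 (hstep i (by omega) hi)
      rw [totalInsertion_succ, abs_le]
      push_cast
      constructor <;> nlinarith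
  have h1 := abs_le.1 (hsum ℓ (by omega))
  -- The total turning is the outgoing angle of the last sequence minus the incoming angle of the
  -- first, up to `1`; each is at most `2π` in absolute value.
  have hb : ∀ i (hi : i < ℓ + 1), 0 ≤ β i hi ∧ β i hi ≤ 2 * Real.pi ∧
      -(2 * Real.pi) ≤ β i hi + (S i).len * θ - Real.pi ∧
      β i hi + (S i).len * θ - Real.pi ≤ 2 * Real.pi := by
    intro i hi
    rcases hβ i hi with ⟨h1, h2, h3⟩ | ⟨h1, h2, h3⟩
    · have h8 : (1 : ℝ) ≤ (S i).len := by exact_mod_cast h1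
      refine ⟨h2.le, ?_, ?_, ?_⟩ <;> nlinarith
    · rw [h1, Nat.cast_zero, zero_mul]
      refine ⟨?_, ?_, ?_, ?_⟩ <;> linarith
  have h2 := hb 0 h0
  have h3 := hb ℓ (by omega)
  rw [totalInsertion_succ, abs_le]
  push_cast
  constructor <;> nlinarith

theorem exists_abs_sub_interiorAngle_lt [Finite 𝒜] [TopologicalSpace 𝒜] [DiscreteTopology 𝒜]
    (hAB : P.next B = A) {ε : ℝ} (hε : 0 < ε) : ∃ L : ℕ, ∀ ℓ ≥ L,
      ∀ S : ℕ → InsertedSequence 𝒜, P.IsMatching A B ℓ S → 0 < totalInsertion S ℓ ∧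
        |Real.pi * ((ℓ : ℝ) / (totalInsertion S ℓ : ℝ)) - P.interiorAngle A| < ε := by
  have hθ0 : 0 < P.interiorAngle A := interiorAngle_pos hAB
  have hπ := Real.pi_pos
  set θ := P.interiorAngle A with hθ
  set C := 4 * Real.pi + 1 with hC
  have hC0 : 0 < C := by positivity
  -- Chosen so that `ℓπ - C` exceeds `Cθ / ε`. Then `Nθ` does too, and the error `C / N` is less
  -- than `ε`.
  obtain ⟨L, hL⟩ := exists_nat_gt ((C + C * θ / ε) / Real.pi)
  rw [div_lt_iff₀ hπ] at hL
  have hCε : 0 < C * θ / ε := by positivity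
  refine ⟨L + 1, fun ℓ hℓ S hS => ?_⟩
  obtain ⟨n, rfl⟩ : ∃ n, ℓ = n + 1 := ⟨ℓ - 1, by omega⟩
  have h1 := hS.abs_sub_le hAB
  set N := totalInsertion S (n + 1)
  have hn : (L : ℝ) ≤ ((n + 1 : ℕ) : ℝ) := by exact_mod_cast (by omega : L ≤ n + 1)
  have h2 := abs_le.1 h1
  have h3 : C * θ / ε < N * θ := by nlinarith [h2.1]
  have hN : (0 : ℝ) < N := by
    by_contra hcon
    push Not at hcon
    nlinarith
  refine ⟨by exact_mod_cast hN, ?_⟩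
  have h4 : Real.pi * (((n + 1 : ℕ) : ℝ) / (N : ℝ)) - θ =
      -(N * θ - ((n + 1 : ℕ) : ℝ) * Real.pi) / N := by field_simp; ring
  rw [h4, abs_div, abs_neg, abs_of_pos hN, div_lt_iff₀ hN]
  refine h1.trans_lt ?_
  rw [div_lt_iff₀ hε] at h3
  have h5 : C * θ < (ε * N) * θ := by linarith
  exact lt_of_mul_lt_mul_right h5 hθ0.le

end BilliardTable

/-! ### The billiard flow from generic states and its continuity -/

namespace BilliardTable

variable {𝒜 : Type*} {P : BilliardTable 𝒜}

/-- A point with a direction, and the label of the last edge that was hit. -/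
structure FlowState (𝒜 : Type*) where
  pos : ℂ
  dir : ℂ
  edge : 𝒜

/-- From `x` in the direction `d`, the edge `e` is reached through the interior at the distance `L`. -/
structure Reaches (P : BilliardTable 𝒜) (x d : ℂ) (L : ℝ) (e : 𝒜) : Prop where
  pos : 0 < L
  mem_interior : ∀ t : ℝ, 0 < t → t < L → x + (t : ℂ) * d ∈ interior P.region
  mem_openSide : x + (L : ℂ) * d ∈ P.openSide e

theorem Reaches.eq {x d : ℂ} {L L' : ℝ} {e e' : 𝒜} (h : P.Reaches x d L e)
    (h' : P.Reaches x d L' e') : L = L' ∧ e = e' := by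
  have key : ∀ {L L' : ℝ} {e e' : 𝒜}, P.Reaches x d L e → P.Reaches x d L' e' → L' ≤ L := by
    intro L L' e e' h h'
    by_contra hlt
    push Not at hlt
    exact P.notMem_interior_of_mem_side (P.openSide_subset_side _ h.mem_openSide)
      (h'.mem_interior L h.pos hlt)
  have hL : L = L' := le_antisymm (key h' h) (key h h')
  subst hL
  exact ⟨rfl, P.eq_of_mem_openSide_of_mem_side h.mem_openSide
    (P.openSide_subset_side _ h'.mem_openSide)⟩

theorem Reaches.crossIm_neg [Finite 𝒜] {x d : ℂ} {L : ℝ} {e : 𝒜} (h : P.Reaches x d L e) :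
    crossIm (P.edgeVec e) d < 0 := by
  refine crossIm_neg_of_reaches h.mem_openSide h.pos fun t h0 h1 => ?_
  convert! h.mem_interior (L - t) (by linarith) (by linarith) using 1
  push_cast; ring

open Classical in
/-- The billiard map. -/
noncomputable def step (P : BilliardTable 𝒜) (s : FlowState 𝒜) : FlowState 𝒜 :=
  if h : ∃ x : ℝ × 𝒜, P.Reaches s.pos s.dir x.1 x.2 then
    ⟨s.pos + (h.choose.1 : ℂ) * s.dir, reflectAlong (P.edgeVec h.choose.2) s.dir, h.choose.2⟩
  else s

theorem Reaches.step_eq {x d : ℂ} {L : ℝ} {e : 𝒜} (h : P.Reaches x d L e) (e₀ : 𝒜) :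
    P.step ⟨x, d, e₀⟩ = ⟨x + (L : ℂ) * d, reflectAlong (P.edgeVec e) d, e⟩ := by
  have h' : ∃ x' : ℝ × 𝒜, P.Reaches x d x'.1 x'.2 := ⟨(L, e), h⟩
  have := h'.choose_spec.eq h
  rw [step, dif_pos h', this.1, this.2]

/-- The points that some word of reflections in the edges maps to a vertex. -/
def unfoldedVertices (P : BilliardTable 𝒜) : Set ℂ :=
  {z | ∃ (w : List 𝒜) (e : 𝒜), P.foldWord w z = P.start e}

/-- There are countably many words, and each folds isometrically, so it maps at most one point to a
given vertex. -/
theorem countable_unfoldedVertices [Finite 𝒜] (P : BilliardTable 𝒜) :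
    P.unfoldedVertices.Countable := by
  have : P.unfoldedVertices = ⋃ (w : List 𝒜) (e : 𝒜), {z | P.foldWord w z = P.start e} := by
    ext z; simp [unfoldedVertices]
  rw [this]
  refine Set.countable_iUnion fun w => Set.countable_iUnion fun e => Set.Subsingleton.countable ?_
  intro y hy z hz
  have := P.dist_foldWord w y z
  rw [Set.mem_ofPred_eq] at hy hz
  rw [hy, hz, dist_self] at this
  exact dist_eq_zero.1 this.symm

theorem foldWord_append_singleton (w : List 𝒜) (e : 𝒜) (z : ℂ) :
    P.foldWord (w ++ [e]) z = P.foldWord w (P.fold e z) := by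
  induction w with
  | nil => rfl
  | cons f w ih => rw [List.cons_append, foldWord, ih, foldWord]

theorem mem_unfoldedVertices_of_fold {e : 𝒜} {z : ℂ} (h : P.fold e z ∈ P.unfoldedVertices) :
    z ∈ P.unfoldedVertices := by
  obtain ⟨w, f, h⟩ := h
  exact ⟨w ++ [e], f, by rw [foldWord_append_singleton, h]⟩

theorem start_mem_unfoldedVertices (e : 𝒜) : P.start e ∈ P.unfoldedVertices := ⟨[], e, rfl⟩

/-- A state from which the flow runs forever: it points into the table, and no unfolded vertex lies
ahead. -/
structure IsGood (P : BilliardTable 𝒜) (s : FlowState 𝒜) : Prop where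
  norm_dir : ‖s.dir‖ = 1
  inward : ∀ᶠ t : ℝ in nhdsWithin 0 (Set.Ioi 0), s.pos + (t : ℂ) * s.dir ∈ interior P.region
  notMem : ∀ t : ℝ, 0 < t → s.pos + (t : ℂ) * s.dir ∉ P.unfoldedVertices

/-- The first exit time exists because the table is bounded. The exit point lies on the frontier and
is no vertex, vertices being unfolded by the empty word. -/
theorem IsGood.exists_reaches {s : FlowState 𝒜} (h : P.IsGood s) :
    ∃ L e, P.Reaches s.pos s.dir L e := by
  obtain ⟨ε, hε, hεi⟩ := mem_nhdsGT_iff_exists_Ioo_subset.1 h.inward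
  have hε0 : (0 : ℝ) < ε := hε
  have hcont : Continuous (fun t : ℝ => s.pos + (t : ℂ) * s.dir) := by fun_prop
  -- Times below `ε` are left out, since the starting point may itself lie on the frontier.
  set T : Set ℝ := {t | ε ≤ t ∧ s.pos + (t : ℂ) * s.dir ∉ interior P.region} with hT
  have hTc : IsClosed T :=
    isClosed_Ici.inter (isOpen_interior.isClosed_compl.preimage hcont)
  have hTb : BddBelow T := ⟨ε, fun t ht => ht.1⟩
  have hTn : T.Nonempty := by
    obtain ⟨R, hR⟩ := P.isCompact_region.isBounded.exists_norm_le
    refine ⟨ε + (|R| + ‖s.pos‖ + 1), by have := abs_nonneg R; have := norm_nonneg s.pos; linarith, ?_⟩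
    intro hmem
    have h1 := hR _ (interior_subset hmem)
    have h0 : (0 : ℝ) ≤ ε + (|R| + ‖s.pos‖ + 1) := by positivity
    have h2 : ‖((ε + (|R| + ‖s.pos‖ + 1) : ℝ) : ℂ) * s.dir‖ = ε + (|R| + ‖s.pos‖ + 1) := by
      rw [norm_mul, h.norm_dir, mul_one, Complex.norm_real, Real.norm_of_nonneg h0]
    have h3 := norm_sub_le (s.pos + ((ε + (|R| + ‖s.pos‖ + 1) : ℝ) : ℂ) * s.dir) s.pos
    rw [add_sub_cancel_left, h2] at h3
    linarith [le_abs_self R]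
  have hL := hTc.csInf_mem hTn hTb
  set L := sInf T
  have hL0 : 0 < L := hε0.trans_le hL.1
  have hint : ∀ t : ℝ, 0 < t → t < L → s.pos + (t : ℂ) * s.dir ∈ interior P.region := by
    intro t h0 h1
    rcases lt_or_ge t ε with h2 | h2
    · exact hεi ⟨h0, h2⟩
    · by_contra hcon
      exact notMem_of_lt_csInf h1 hTb ⟨h2, hcon⟩
  have hcl : s.pos + (L : ℂ) * s.dir ∈ closure P.region := by
    refine mem_closure_of_tendsto (b := nhdsWithin L (Set.Iio L))
      ((hcont.tendsto L).mono_left nhdsWithin_le_nhds) ?_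
    filter_upwards [Ioo_mem_nhdsLT hL0] with t ht
    exact interior_subset (hint t ht.1 ht.2)
  obtain ⟨e, he⟩ := P.exists_mem_openSide ⟨hcl, hL.2⟩ fun f hf =>
    h.notMem L hL0 (hf ▸ start_mem_unfoldedVertices f)
  exact ⟨L, e, hL0, hint, he⟩

/-- A reflection at an edge hit from the left points back into the table. A point ahead of the new
state is the fold of a point ahead of the old one, so unfolded vertices are still avoided. -/
theorem IsGood.step [Finite 𝒜] {s : FlowState 𝒜} (h : P.IsGood s) : P.IsGood (P.step s) := by
  obtain ⟨L, e, hr⟩ := h.exists_reaches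
  obtain ⟨x, d, e₀⟩ := s
  rw [hr.step_eq]
  refine ⟨?_, ?_, ?_⟩
  · rw [norm_reflectAlong (P.edgeVec_ne_zero e)]; exact h.norm_dir
  · obtain ⟨r, hr0, hlr⟩ := P.exists_ball_left_right hr.mem_openSide
    set y := x + (L : ℂ) * d
    set d' := reflectAlong (P.edgeVec e) d with hd'
    have hcont : Continuous (fun t : ℝ => y + (t : ℂ) * d') := by fun_prop
    have hnear : ∀ᶠ t : ℝ in nhdsWithin 0 (Set.Ioi 0), dist (y + (t : ℂ) * d') y < r := by
      refine Filter.Eventually.filter_mono nhdsWithin_le_nhds ?_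
      have := hcont.tendsto 0
      simp only [Complex.ofReal_zero, zero_mul, add_zero] at this
      exact this.eventually (Metric.ball_mem_nhds y hr0)
    filter_upwards [hnear, self_mem_nhdsWithin] with t ht ht0
    refine (hlr _ ht).1 ?_
    rw [add_sub_cancel_left, crossIm_smul_right, hd', crossIm_reflectAlong (P.edgeVec_ne_zero e)]
    have := hr.crossIm_neg
    exact mul_pos ht0 (by linarith)
  · intro t ht hmem
    refine h.notMem (L + t) (by linarith [hr.pos]) (mem_unfoldedVertices_of_fold (e := e) ?_)
    show P.fold e (x + ((L + t : ℝ) : ℂ) * d) ∈ P.unfoldedVertices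
    rw [Complex.ofReal_add, add_mul, ← add_assoc,
      fold_add (P.openSide_subset_side _ hr.mem_openSide), reflectAlong_ofReal_mul]
    exact hmem

theorem IsGood.iterate [Finite 𝒜] {s : FlowState 𝒜} (h : P.IsGood s) (n : ℕ) :
    P.IsGood (P.step^[n] s) := by
  induction n with
  | zero => exact h
  | succ n ih => rw [Function.iterate_succ_apply']; exact ih.step

theorem IsGood.exists_reaches_iterate [Finite 𝒜] {s : FlowState 𝒜} (h : P.IsGood s) (n : ℕ) :
    ∃ L, P.Reaches (P.step^[n] s).pos (P.step^[n] s).dir L (P.step^[n + 1] s).edge ∧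
      (P.step^[n + 1] s).pos = (P.step^[n] s).pos + (L : ℂ) * (P.step^[n] s).dir ∧
      (P.step^[n + 1] s).dir =
        reflectAlong (P.edgeVec (P.step^[n + 1] s).edge) (P.step^[n] s).dir := by
  obtain ⟨L, e, hr⟩ := (h.iterate n).exists_reaches
  have := hr.step_eq (P.step^[n] s).edge
  refine ⟨L, ?_⟩
  rw [Function.iterate_succ_apply', this]
  exact ⟨hr, rfl, rfl⟩

/-- Sliding a state along its direction, through the interior, does not change its future. -/
theorem IsGood.slide {x d : ℂ} {e e' : 𝒜} {u : ℝ} (h : P.IsGood ⟨x, d, e⟩) (hu : 0 < u)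
    (hint : ∀ t : ℝ, 0 < t → t ≤ u → x + (t : ℂ) * d ∈ interior P.region) :
    P.IsGood ⟨x + (u : ℂ) * d, d, e'⟩ ∧ P.step ⟨x + (u : ℂ) * d, d, e'⟩ = P.step ⟨x, d, e⟩ := by
  constructor
  · refine ⟨h.norm_dir, ?_, ?_⟩
    · refine Filter.Eventually.filter_mono nhdsWithin_le_nhds ?_
      have hcont : Continuous (fun t : ℝ => x + (u : ℂ) * d + (t : ℂ) * d) := by fun_prop
      have := hcont.tendsto 0
      simp only [Complex.ofReal_zero, zero_mul, add_zero] at this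
      exact this.eventually (isOpen_interior.mem_nhds (hint u hu le_rfl))
    · intro t ht
      convert! h.notMem (u + t) (by linarith) using 2
      push_cast; ring
  · obtain ⟨L, f, hr⟩ := h.exists_reaches
    have huL : u < L := by
      by_contra hcon
      push Not at hcon
      exact P.notMem_interior_of_mem_side (P.openSide_subset_side _ hr.mem_openSide)
        (hint L hr.pos hcon)
    have hr' : P.Reaches (x + (u : ℂ) * d) d (L - u) f := by
      refine ⟨by linarith, fun t h0 h1 => ?_, ?_⟩
      · convert! hr.mem_interior (u + t) (by linarith) (by linarith) using 1
        push_cast; ring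
      · convert! hr.mem_openSide using 1
        push_cast; ring
    rw [hr'.step_eq, hr.step_eq]
    congr 1; push_cast; ring

/-- The trajectory through an interior point whose two half-lines never hit a vertex. -/
theorem exists_trajectory [Finite 𝒜] {q d : ℂ} {e₀ : 𝒜} (hq : q ∈ interior P.region)
    (h : P.IsGood ⟨q, d, e₀⟩) (h' : P.IsGood ⟨q, -d, e₀⟩) : ∃ τ : P.Trajectory,
      (∀ j : ℕ, τ.edge j = (P.step^[j + 1] ⟨q, d, e₀⟩).edge) ∧
      (∀ j : ℕ, τ.edge (-1 - j) = (P.step^[j + 1] ⟨q, -d, e₀⟩).edge) ∧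
      τ.dir (-1) = d ∧ q ∈ openSegment ℝ (τ.point (-1)) (τ.point 0) := by
  choose L hL hLp hLd using fun n => h.exists_reaches_iterate n
  choose L' hL' hLp' hLd' using fun n => h'.exists_reaches_iterate n
  set F := fun n => P.step^[n] ⟨q, d, e₀⟩ with hF
  set G := fun n => P.step^[n] ⟨q, -d, e₀⟩ with hG
  -- Forward bounces `F (j + 1)` get the index `j`, backward ones `G (j + 1)` the index `-1 - j`.
  -- The chord through `q` has the index `-1`, and its length is the sum of the two pieces.
  let edge : ℤ → 𝒜 := fun i => Int.casesOn i (fun j => (F (j + 1)).edge) fun j => (G (j + 1)).edge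
  let point : ℤ → ℂ := fun i => Int.casesOn i (fun j => (F (j + 1)).pos) fun j => (G (j + 1)).pos
  let dir : ℤ → ℂ := fun i => Int.casesOn i (fun j => (F (j + 1)).dir) fun j => -(G j).dir
  let len : ℤ → ℝ := fun i => Int.casesOn i (fun j => L (j + 1)) fun j =>
    Nat.casesOn j (L 0 + L' 0) fun j => L' (j + 1)
  have hneg : ∀ j : ℕ, Int.negSucc (j + 1) + 1 = Int.negSucc j := fun j => rfl
  have hzero : Int.negSucc 0 + 1 = 0 := rfl
  have hlen : ∀ i, 0 < len i := by
    rintro (j | _ | j)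
    · exact (hL (j + 1)).pos
    · exact add_pos (hL 0).pos (hL' 0).pos
    · exact (hL' (j + 1)).pos
  have hp0 : (F 1).pos = q + (L 0 : ℂ) * d := hLp 0
  have hp0' : (G 1).pos = q + (L' 0 : ℂ) * -d := hLp' 0
  have hpoint : ∀ i : ℤ, point (i + 1) = point i + Complex.ofReal (len i) * dir i := by
    rintro (j | _ | j)
    · exact hLp (j + 1)
    · show (F 1).pos = (G 1).pos + ((L 0 + L' 0 : ℝ) : ℂ) * -(-d)
      rw [hp0, hp0']; push_cast; ring
    · rw [hneg]
      show (G (j + 1)).pos = (G (j + 2)).pos + (L' (j + 1) : ℂ) * -(G (j + 1)).dir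
      have := hLp' (j + 1)
      rw [show (G (j + 2)).pos = _ from this]; ring
  refine ⟨⟨edge, point, dir, len, ?_, hlen, ?_, hpoint, ?_, ?_⟩, fun j => rfl, fun j => ?_, ?_, ?_⟩
  · rintro (j | j)
    · exact (h.iterate (j + 1)).norm_dir
    · exact (norm_neg _).trans (h'.iterate j).norm_dir
  · rintro (j | j)
    · show (F (j + 1)).pos ∈ P.openSide (F (j + 1)).edge
      rw [show (F (j + 1)).pos = _ from hLp j]
      exact (hL j).mem_openSide
    · show (G (j + 1)).pos ∈ P.openSide (G (j + 1)).edge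
      rw [show (G (j + 1)).pos = _ from hLp' j]
      exact (hL' j).mem_openSide
  · intro i z hz
    rw [hpoint, mem_openSegment_add_mul (hlen i)] at hz
    obtain ⟨t, h0, h1, rfl⟩ := hz
    rcases i with j | _ | j
    · exact (hL (j + 1)).mem_interior t h0 h1
    · have h1' : t < L 0 + L' 0 := h1
      show (G 1).pos + (t : ℂ) * -(-d) ∈ interior P.region
      rw [hp0']
      rcases lt_trichotomy t (L' 0) with h2 | h2 | h2
      · convert! (hL' 0).mem_interior (L' 0 - t) (by linarith) (by linarith) using 1
        show q + (L' 0 : ℂ) * -d + (t : ℂ) * -(-d) = q + ((L' 0 - t : ℝ) : ℂ) * -d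
        push_cast; ring
      · convert! hq using 1
        rw [h2]; ring
      · convert! (hL 0).mem_interior (t - L' 0) (by linarith) (by linarith) using 1
        show q + (L' 0 : ℂ) * -d + (t : ℂ) * -(-d) = q + ((t - L' 0 : ℝ) : ℂ) * d
        push_cast; ring
    · have h1' : t < L' (j + 1) := h1
      convert! (hL' (j + 1)).mem_interior (L' (j + 1) - t) (by linarith) (by linarith) using 1
      show (G (j + 2)).pos + (t : ℂ) * -(G (j + 1)).dir =
        (G (j + 1)).pos + ((L' (j + 1) - t : ℝ) : ℂ) * (G (j + 1)).dir
      rw [show (G (j + 2)).pos = _ from hLp' (j + 1)]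
      push_cast; ring
  · rintro (j | _ | j)
    · exact hLd (j + 1)
    · show (F 1).dir = reflectAlong (P.edgeVec (F 1).edge) (-(-d))
      rw [neg_neg]; exact hLd 0
    · rw [hneg]
      show -(G j).dir = reflectAlong (P.edgeVec (G (j + 1)).edge) (-(G (j + 1)).dir)
      rw [show (G (j + 1)).dir = _ from hLd' j, reflectAlong_neg]
      exact congrArg Neg.neg (reflectAlong_reflectAlong (P.edgeVec_ne_zero _) _).symm
  · show edge (-1 - j) = _
    rw [show (-1 - j : ℤ) = Int.negSucc j by rw [Int.negSucc_eq]; ring]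
  · exact neg_neg d
  · show q ∈ openSegment ℝ (G 1).pos (F 1).pos
    have : (F 1).pos = (G 1).pos + ((L 0 + L' 0 : ℝ) : ℂ) * d := by
      rw [hp0, hp0']; push_cast; ring
    rw [this, mem_openSegment_add_mul (add_pos (hL 0).pos (hL' 0).pos)]
    exact ⟨L' 0, (hL' 0).pos, by linarith [(hL 0).pos], by rw [hp0']; ring⟩

theorem exists_ball_mem_openSide {e : 𝒜} {y : ℂ} (hy : y ∈ P.openSide e) :
    ∃ r > 0, ∀ z, dist z y < r → crossIm (P.edgeVec e) (z - y) = 0 → z ∈ P.openSide e := by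
  obtain ⟨s, h0, h1, rfl⟩ := P.mem_openSide.1 hy
  have hu := P.edgeVec_ne_zero e
  have hul : 0 < ‖P.edgeVec e‖ := norm_pos_iff.2 hu
  have h1' : 0 < 1 - s := by linarith
  refine ⟨min s (1 - s) * ‖P.edgeVec e‖, by positivity, fun z hz hc => ?_⟩
  obtain ⟨c, hc⟩ := exists_ofReal_mul_of_crossIm_eq_zero hu hc
  rw [dist_eq_norm, hc, norm_mul, Complex.norm_real, Real.norm_eq_abs] at hz
  have h2 := abs_lt.1 ((lt_of_mul_lt_mul_right hz hul.le).trans_le (min_le_left _ _))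
  have h3 := abs_lt.1 ((lt_of_mul_lt_mul_right hz hul.le).trans_le (min_le_right _ _))
  exact P.mem_openSide.2 ⟨s + c, by linarith, by linarith, by push_cast; linear_combination hc⟩

theorem crossIm_sub_eq_zero {e : 𝒜} {y z : ℂ} (hy : y ∈ P.side e) (hz : z ∈ P.side e) :
    crossIm (P.edgeVec e) (z - y) = 0 := by
  obtain ⟨s, -, -, rfl⟩ := P.mem_side.1 hy
  obtain ⟨t, -, -, rfl⟩ := P.mem_side.1 hz
  have : P.start e + (t : ℂ) * P.edgeVec e - (P.start e + (s : ℂ) * P.edgeVec e)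
    = ((t - s : ℝ) : ℂ) * P.edgeVec e := by push_cast; ring
  rw [this, crossIm_smul_right, crossIm_self, mul_zero]

/-- If an edge is visible from an interior point, then so are close points of the edge from close
points of the interior. -/
theorem Reaches.exists_openSegment_subset [Finite 𝒜] {x d : ℂ} {L : ℝ} {e : 𝒜}
    (h : P.Reaches x d L e) (hx : x ∈ interior P.region) :
    ∃ δ > 0, ∀ x', dist x' x < δ → x' ∈ interior P.region ∧
      ∀ y' ∈ P.side e, dist y' (x + (L : ℂ) * d) < δ →
        openSegment ℝ x' y' ⊆ interior P.region := by
  set y := x + (L : ℂ) * d with hy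
  have hyo := h.mem_openSide
  rw [← hy] at hyo
  have hK : IsCompact ((fun s : ℝ => x + (s : ℂ) * (y - x)) '' Set.Icc 0 1) :=
    isCompact_Icc.image (by fun_prop)
  have hU : IsOpen {z | ∀ f, f ≠ e → z ∉ P.side f} := by
    have : {z | ∀ f, f ≠ e → z ∉ P.side f} = ⋂ f, {z | f ≠ e → z ∉ P.side f} := by ext; simp
    rw [this]
    refine isOpen_iInter_of_finite fun f => ?_
    by_cases hf : f = e
    · simp [hf]
    · have : {z | f ≠ e → z ∉ P.side f} = (P.side f)ᶜ := by ext; simp [hf]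
      rw [this]
      exact (P.isCompact_side f).isClosed.isOpen_compl
  have hKU : (fun s : ℝ => x + (s : ℂ) * (y - x)) '' Set.Icc 0 1 ⊆
      {z | ∀ f, f ≠ e → z ∉ P.side f} := by
    rintro _ ⟨s, ⟨h0, h1⟩, rfl⟩ f hf hmem
    dsimp only at hmem
    rw [hy, add_sub_cancel_left, ← mul_assoc, ← Complex.ofReal_mul] at hmem
    rcases h0.eq_or_lt with rfl | h0
    · rw [zero_mul, Complex.ofReal_zero, zero_mul, add_zero] at hmem
      exact P.notMem_interior_of_mem_side hmem hx
    rcases h1.eq_or_lt with rfl | h1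
    · rw [one_mul] at hmem
      exact hf (P.eq_of_mem_openSide_of_mem_side hyo hmem).symm
    · exact P.notMem_interior_of_mem_side hmem
        (h.mem_interior (s * L) (mul_pos h0 h.pos) (by nlinarith [h.pos]))
  obtain ⟨δ₁, hδ₁, hδ₁U⟩ := hK.exists_thickening_subset_open hU hKU
  obtain ⟨δ₂, hδ₂, hδ₂i⟩ := Metric.isOpen_iff.1 isOpen_interior x hx
  -- Points near `x` stay strictly to the left of `e`, so a segment from them to a point of `e`
  -- meets its line only at the end. The other edges are avoided by compactness.
  have hcx : 0 < crossIm (P.edgeVec e) (x - y) := by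
    have : x - y = ((-L : ℝ) : ℂ) * d := by rw [hy]; push_cast; ring
    rw [this, crossIm_smul_right]
    nlinarith [h.crossIm_neg, h.pos]
  have hopen : IsOpen {z | 0 < crossIm (P.edgeVec e) (z - y)} :=
    isOpen_lt continuous_const ((continuous_crossIm _).comp (by fun_prop))
  obtain ⟨δ₃, hδ₃, hδ₃c⟩ := Metric.isOpen_iff.1 hopen x hcx
  refine ⟨min δ₁ (min δ₂ δ₃), by positivity, fun x' hx' => ?_⟩
  have hx1 := hx'.trans_le (min_le_left _ _)
  have hx2 := hx'.trans_le ((min_le_right _ _).trans (min_le_left _ _))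
  have hx3 := hx'.trans_le ((min_le_right _ _).trans (min_le_right _ _))
  refine ⟨hδ₂i hx2, fun y' hy' hyd => ?_⟩
  have hy1 := hyd.trans_le (min_le_left _ _)
  have hpre : IsPreconnected ((fun s : ℝ => x' + (s : ℂ) * (y' - x')) '' Set.Ico 0 1) :=
    isPreconnected_Ico.image _ (by fun_prop)
  have hsub := hpre.subset_interior_of_disjoint_frontier (s := P.region) (by
    rintro _ ⟨s, ⟨h0, h1⟩, rfl⟩ hf
    obtain ⟨f, hf⟩ := P.mem_frontier_iff.1 hf
    dsimp only at hf
    by_cases hfe : f = e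
    · subst hfe
      have e1 := crossIm_sub_eq_zero (P.openSide_subset_side _ hyo) hf
      have e2 := crossIm_sub_eq_zero (P.openSide_subset_side _ hyo) hy'
      have e3 : x' + (s : ℂ) * (y' - x') - y =
          ((1 - s : ℝ) : ℂ) * (x' - y) + (s : ℂ) * (y' - y) := by push_cast; ring
      rw [e3, crossIm_add_right, crossIm_smul_right, crossIm_smul_right, e2, mul_zero,
        add_zero] at e1
      have e4 : 0 < crossIm (P.edgeVec f) (x' - y) := hδ₃c hx3
      have : 0 < 1 - s := by linarith
      exact (mul_pos this e4).ne' e1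
    · refine hδ₁U ?_ f hfe hf
      refine Metric.mem_thickening_iff.2 ⟨_, ⟨s, ⟨h0, h1.le⟩, rfl⟩, ?_⟩
      have e1 : x' + (s : ℂ) * (y' - x') - (x + (s : ℂ) * (y - x)) =
          ((1 - s : ℝ) : ℂ) * (x' - x) + (s : ℂ) * (y' - y) := by push_cast; ring
      dsimp only
      rw [dist_eq_norm, e1]
      refine (norm_add_le _ _).trans_lt ?_
      rw [norm_mul, norm_mul, Complex.norm_real, Complex.norm_real, Real.norm_of_nonneg h0,
        Real.norm_of_nonneg (by linarith : 0 ≤ 1 - s), ← dist_eq_norm, ← dist_eq_norm]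
      nlinarith)
    ⟨x', ⟨0, ⟨le_rfl, one_pos⟩, by simp⟩, hδ₂i hx2⟩
  intro z hz
  obtain ⟨s, h0, h1, rfl⟩ := mem_openSegment_iff_ofReal.1 hz
  exact hsub ⟨s, ⟨h0.le, h1⟩, rfl⟩

/-- The first bounces do not change when the starting point moves a little. -/
theorem IsGood.eventually_edge_eq [Finite 𝒜] (N : ℕ) {x d : ℂ} {e : 𝒜}
    (h : P.IsGood ⟨x, d, e⟩) (hx : x ∈ interior P.region) :
    ∀ᶠ x' in nhds x, P.IsGood ⟨x', d, e⟩ → ∀ j < N,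
      (P.step^[j + 1] ⟨x', d, e⟩).edge = (P.step^[j + 1] ⟨x, d, e⟩).edge := by
  induction N generalizing x d e with
  | zero => exact Filter.Eventually.of_forall fun _ _ j hj => absurd hj (Nat.not_lt_zero j)
  | succ N ih =>
    obtain ⟨L, e₁, hr⟩ := h.exists_reaches
    have hs := hr.step_eq e
    have hg := h.step
    rw [hs] at hg
    have hcr := hr.crossIm_neg
    simp only [] at hr hcr
    set y := x + (L : ℂ) * d with hy
    set d' := reflectAlong (P.edgeVec e₁) d with hd'
    obtain ⟨L', e₂, hr'⟩ := hg.exists_reaches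
    simp only [] at hr'
    have hL' := hr'.pos
    -- The induction hypothesis wants an interior starting point, so after the bounce the state is
    -- slid half-way along its next chord.
    set u := L' / 2 with hu
    have hu0 : 0 < u := by positivity
    have hx₁ : y + (u : ℂ) * d' ∈ interior P.region := hr'.mem_interior u hu0 (by linarith)
    obtain ⟨hg₁, hs₁⟩ := hg.slide (e' := e₁) hu0
      fun t h0 h1 => hr'.mem_interior t h0 (by linarith)
    have hback : P.Reaches (y + (u : ℂ) * d') (-d') u e₁ := by
      refine ⟨hu0, fun t h0 h1 => ?_, ?_⟩
      · convert! hr'.mem_interior (u - t) (by linarith) (by linarith) using 1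
        push_cast; ring
      · convert! hr.mem_openSide using 1
        ring
    obtain ⟨δ₁, hδ₁, hv₁⟩ := hr.exists_openSegment_subset hx
    obtain ⟨δ₂, hδ₂, hv₂⟩ := hback.exists_openSegment_subset hx₁
    obtain ⟨r, hr0, hbr⟩ := exists_ball_mem_openSide hr.mem_openSide
    have hyend : y + (u : ℂ) * d' + (u : ℂ) * -d' = y := by ring
    rw [hyend] at hv₂
    -- The time at which the line from `x'` in the direction `d` meets the line of `e₁`; it is
    -- continuous because the crossing is transversal.
    let t : ℂ → ℝ := fun x' => -crossIm (P.edgeVec e₁) (x' - y) / crossIm (P.edgeVec e₁) d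
    have ht : Continuous t := by
      have := continuous_crossIm (P.edgeVec e₁)
      exact ((this.comp (by fun_prop : Continuous fun x' : ℂ => x' - y)).neg).div_const _
    have htx : t x = L := by
      have : x - y = ((-L : ℝ) : ℂ) * d := by rw [hy]; push_cast; ring
      show -crossIm _ (x - y) / _ = L
      rw [this, crossIm_smul_right]; field_simp [hcr.ne]
    let y' : ℂ → ℂ := fun x' => x' + (t x' : ℂ) * d
    have hy' : Continuous y' := by fun_prop
    have hy'x : y' x = y := by show x + (t x : ℂ) * d = y; rw [htx]
    have hx1c : Continuous fun x' => y' x' + (u : ℂ) * d' := by fun_prop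
    have E1 : ∀ᶠ x' in nhds x, dist x' x < δ₁ := Metric.ball_mem_nhds x hδ₁
    have E2 : ∀ᶠ x' in nhds x, dist (y' x') y < δ₁ :=
      (hy'x ▸ hy'.tendsto x).eventually (Metric.ball_mem_nhds y hδ₁)
    have E3 : ∀ᶠ x' in nhds x, dist (y' x') y < δ₂ :=
      (hy'x ▸ hy'.tendsto x).eventually (Metric.ball_mem_nhds y hδ₂)
    have E4 : ∀ᶠ x' in nhds x, dist (y' x') y < r :=
      (hy'x ▸ hy'.tendsto x).eventually (Metric.ball_mem_nhds y hr0)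
    have T5 := hx1c.tendsto x
    rw [hy'x] at T5
    have E5 := T5.eventually (Metric.ball_mem_nhds (y + (u : ℂ) * d') hδ₂)
    have E6 := T5.eventually (ih hg₁ hx₁)
    have E7 : ∀ᶠ x' in nhds x, 0 < t x' :=
      (htx ▸ ht.tendsto x).eventually (lt_mem_nhds hr.pos)
    filter_upwards [E1, E2, E3, E4, E5, E6, E7] with x' F1 F2 F3 F4 F5 F6 F7 hgx'
    have hside : y' x' ∈ P.openSide e₁ := by
      refine hbr _ F4 ?_
      have : y' x' - y = (x' - y) + (t x' : ℂ) * d := by show x' + _ - y = _; ring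
      rw [this, crossIm_add_right, crossIm_smul_right]
      show _ + -crossIm _ (x' - y) / _ * _ = _
      field_simp [hcr.ne]; ring
    have hreach : P.Reaches x' d (t x') e₁ := by
      refine ⟨F7, fun s h0 h1 => ?_, hside⟩
      refine (hv₁ x' F1).2 (y' x') (P.openSide_subset_side _ hside) F2 ?_
      exact (mem_openSegment_add_mul F7).2 ⟨s, h0, h1, rfl⟩
    have hstep' := hreach.step_eq e
    have hgy := hgx'.step
    rw [hstep'] at hgy
    have hx1i := (hv₂ _ F5).1
    have hseg := (hv₂ _ F5).2 (y' x') (P.openSide_subset_side _ hside) F3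
    rw [openSegment_symm] at hseg
    obtain ⟨hg2, hs2⟩ := hgy.slide (e' := e₁) hu0 fun s h0 h1 => by
      rcases h1.eq_or_lt with rfl | h1
      · exact hx1i
      · exact hseg ((mem_openSegment_add_mul hu0).2 ⟨s, h0, h1, rfl⟩)
    have F6' := F6 hg2
    intro j hj
    rw [Function.iterate_succ_apply, Function.iterate_succ_apply, hstep', hs]
    rcases j with _ | j
    · rfl
    · have := F6' j (by omega)
      rw [Function.iterate_succ_apply, Function.iterate_succ_apply, hs₁] at this
      rw [Function.iterate_succ_apply, Function.iterate_succ_apply, ← this]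
      exact congrArg (fun s => (P.step^[j] s).edge) hs2.symm

end BilliardTable

/-! ### Trajectories that turn about a vertex -/

namespace BilliardTable

variable {𝒜 : Type*} {P : BilliardTable 𝒜} {A B : 𝒜}

/-- The cross products of the sum with its two summands fix the signs of `sin (c - a)` and `sin (c -
b)`. This replaces convexity at corners with `θ > π`, where the sector is not convex. -/
theorem exists_mul_ray_eq_add (P : BilliardTable 𝒜) (A : 𝒜) (m : ℕ) {a b x y : ℝ} (hab : a < b)
    (hba : b < a + Real.pi) (hx : 0 < x) (hy : 0 < y) : ∃ ρ c : ℝ, 0 < ρ ∧ ρ ≤ x + y ∧ a < c ∧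
      c < b ∧ (x : ℂ) * P.ray A m a + (y : ℂ) * P.ray A m b = (ρ : ℂ) * P.ray A m c := by
  set w := (x : ℂ) * P.ray A m a + (y : ℂ) * P.ray A m b with hw
  have hs : 0 < Real.sin (b - a) := Real.sin_pos_of_pos_of_lt_pi (by linarith) (by linarith)
  have hcr : ∀ u, crossIm (P.ray A m u) w =
      if Even m then x * Real.sin (a - u) + y * Real.sin (b - u)
      else -(x * Real.sin (a - u) + y * Real.sin (b - u)) := by
    intro u
    rw [hw, crossIm_add_right, crossIm_smul_right, crossIm_smul_right, crossIm_ray, crossIm_ray]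
    split_ifs <;> ring
  have hwn : w ≠ 0 := by
    intro h0
    have := hcr a
    rw [h0, sub_self, Real.sin_zero, mul_zero, zero_add] at this
    have h1 : 0 < y * Real.sin (b - a) := by positivity
    simp only [crossIm, Complex.zero_im, Complex.zero_re, mul_zero, sub_self] at this
    split_ifs at this <;> linarith
  have hρ : 0 < ‖w‖ := norm_pos_iff.2 hwn
  have hρ' : (‖w‖ : ℂ) ≠ 0 := by exact_mod_cast hρ.ne'
  obtain ⟨c, hc0, hc1, hc⟩ := P.ray_surjective A m a (z := w / ‖w‖)
    (by rw [norm_div, Complex.norm_real, norm_norm, div_self hρ.ne'])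
  have hwc : w = (‖w‖ : ℂ) * P.ray A m c := by rw [← hc]; field_simp
  have hz : ∀ u, ‖w‖ * Real.sin (c - u) = x * Real.sin (a - u) + y * Real.sin (b - u) := by
    intro u
    have := hcr u
    rw [hwc, crossIm_smul_right, crossIm_ray] at this
    split_ifs at this <;> linarith
  have hza := hz a
  have hzb := hz b
  rw [sub_self, Real.sin_zero, mul_zero, zero_add] at hza
  rw [sub_self, Real.sin_zero, mul_zero, add_zero, ← neg_sub b a, Real.sin_neg] at hzb
  have h1 : 0 < Real.sin (c - a) := by
    have : 0 < ‖w‖ * Real.sin (c - a) := by rw [hza]; positivity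
    exact (mul_pos_iff_of_pos_left hρ).1 this
  have h2 : Real.sin (c - b) < 0 := by
    have h3 : 0 < x * Real.sin (b - a) := by positivity
    by_contra hcon
    push Not at hcon
    nlinarith
  have hca : a < c := by
    refine lt_of_le_of_ne hc0 ?_
    rintro rfl
    simp at h1
  have hcπ : c < a + Real.pi := by
    by_contra hcon
    push Not at hcon
    have := Real.sin_nonneg_of_nonneg_of_le_pi (x := c - a - Real.pi) (by linarith) (by linarith)
    rw [Real.sin_sub_pi] at this
    linarith
  refine ⟨‖w‖, c, hρ, ?_, hca, ?_, hwc⟩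
  · refine (norm_add_le _ _).trans ?_
    rw [norm_mul, norm_mul, norm_ray, norm_ray, Complex.norm_real, Complex.norm_real,
      Real.norm_of_nonneg hx.le, Real.norm_of_nonneg hy.le, mul_one, mul_one]
  · by_contra hcon
    push Not at hcon
    have := Real.sin_nonneg_of_nonneg_of_le_pi (x := c - b) (by linarith) (by linarith)
    linarith

/-- Within the radius `r`, the table is the sector at the vertex where `B` ends and `A` starts. -/
structure IsCornerRadius (P : BilliardTable 𝒜) (A B : 𝒜) (r : ℝ) : Prop where
  pos : 0 < r
  le_norm : ∀ m, r ≤ ‖P.edgeVec (alternatingLetter A B m)‖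
  mem_interior : ∀ m, ∀ ρ s : ℝ, 0 < ρ → ρ < r → 0 < s → s < P.interiorAngle A →
    P.start A + (ρ : ℂ) * P.ray A m s ∈ interior P.region

theorem exists_isCornerRadius [Finite 𝒜] (hAB : P.next B = A) : ∃ r, P.IsCornerRadius A B r := by
  obtain ⟨r, hr, hlen, -, hin, -⟩ := exists_sector hAB
  exact ⟨r, hr, hlen, hin⟩

theorem IsCornerRadius.add_mem_interior {r : ℝ} (hr : P.IsCornerRadius A B r) {m : ℕ}
    {σ γ ρ t : ℝ} (hσ0 : 0 ≤ σ) (hσ1 : σ ≤ P.interiorAngle A) (hγ0 : 0 < γ)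
    (hγ1 : γ < P.interiorAngle A) (hσγ : |σ - γ| < Real.pi) (hρ : 0 < ρ) (ht : 0 < t)
    (hρt : ρ + t < r) :
    P.start A + (ρ : ℂ) * P.ray A m σ + (t : ℂ) * P.ray A m γ ∈ interior P.region := by
  rw [abs_lt] at hσγ
  rw [add_assoc]
  rcases lt_trichotomy σ γ with h | h | h
  · obtain ⟨ρ', c, h0, h1, h2, h3, h4⟩ :=
      P.exists_mul_ray_eq_add A m h (by linarith) hρ ht
    rw [h4]
    exact hr.mem_interior m ρ' c h0 (by linarith) (by linarith) (by linarith)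
  · subst h
    rw [← add_mul, ← Complex.ofReal_add]
    exact hr.mem_interior m _ _ (by linarith) hρt hγ0 hγ1
  · obtain ⟨ρ', c, h0, h1, h2, h3, h4⟩ :=
      P.exists_mul_ray_eq_add A m h (by linarith) ht hρ
    rw [add_comm (_ * _), h4]
    exact hr.mem_interior m ρ' c h0 (by linarith) (by linarith) (by linarith)

theorem IsCornerRadius.reaches {r : ℝ} (hAB : P.next B = A) (hr : P.IsCornerRadius A B r) {m : ℕ}
    {σ β ρ : ℝ} (hσ0 : 0 < σ) (hσ1 : σ ≤ P.interiorAngle A) (hσβ : σ < β) (hβ : β < Real.pi)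
    (hρ0 : 0 < ρ) (hρ : ρ < r) (hρ' : ρ * Real.sin (β - σ) / Real.sin β < r) :
    P.Reaches (P.start A + (ρ : ℂ) * P.ray A m σ) (-P.ray A m β)
      (ρ * Real.sin σ / Real.sin β) (alternatingLetter A B m) := by
  have hsβ : 0 < Real.sin β := Real.sin_pos_of_pos_of_lt_pi (by linarith) (by linarith)
  have hsσ : 0 < Real.sin σ := Real.sin_pos_of_pos_of_lt_pi (by linarith) (by linarith)
  have hsβσ : 0 < Real.sin (β - σ) := Real.sin_pos_of_pos_of_lt_pi (by linarith) (by linarith)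
  have heq := ray_mul_sub_eq (P := P) A m (σ := σ) (ρ := ρ) hsβ.ne'
  set L := ρ * Real.sin σ / Real.sin β with hL
  set ρ' := ρ * Real.sin (β - σ) / Real.sin β
  have hL0 : 0 < L := by positivity
  have hρ'0 : 0 < ρ' := by positivity
  refine ⟨hL0, fun t h0 h1 => ?_, ?_⟩
  · have hs0 : 0 < t / L := by positivity
    have hs1 : t / L < 1 := by rwa [div_lt_one hL0]
    have hs2 : 0 < 1 - t / L := by linarith
    obtain ⟨ρ₁, c, e0, e1, e2, e3, e4⟩ := P.exists_mul_ray_eq_add A m (a := 0) (b := σ)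
      (x := t / L * ρ') (y := (1 - t / L) * ρ) hσ0 (by linarith) (by positivity) (by positivity)
    have hL' : (L : ℂ) ≠ 0 := by exact_mod_cast hL0.ne'
    have e5 : (ρ : ℂ) * P.ray A m σ + (t : ℂ) * -P.ray A m β =
        (ρ₁ : ℂ) * P.ray A m c := by
      rw [← e4, Complex.ofReal_mul, mul_assoc, ← heq]
      push_cast; field_simp; ring
    rw [add_assoc, e5]
    refine hr.mem_interior m ρ₁ c e0 (e1.trans_lt ?_) e2 (by linarith)
    nlinarith
  · rw [add_assoc, heq]
    exact add_ray_mem_openSide hAB m hρ'0 (hρ'.trans_le (hr.le_norm m))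

/-- The bounces of a trajectory that passes close to a vertex: at each of them, the angle grows by the
interior angle, as long as it is less than `π`. -/
theorem IsCornerRadius.exists_iterate_step {r : ℝ} (hAB : P.next B = A)
    (hr : P.IsCornerRadius A B r) (n : ℕ) {δ : ℝ} (hδ : 0 < δ) {m : ℕ}
    {σ β : ℝ} (hσ0 : 0 < σ) (hσ1 : σ ≤ P.interiorAngle A) (hσβ : σ < β) (hβσ : β < σ + Real.pi)
    (hn : ∀ j < n, β + j * P.interiorAngle A < Real.pi) :
    ∃ ρ₀ > 0, ∀ ρ : ℝ, 0 < ρ → ρ < ρ₀ → ∀ e, ∃ (ρ' σ' : ℝ) (e' : 𝒜), 0 < ρ' ∧ ρ' < δ ∧ 0 < σ' ∧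
      σ' ≤ P.interiorAngle A ∧ σ' < β + n * P.interiorAngle A ∧
      β + n * P.interiorAngle A < σ' + Real.pi ∧
      P.step^[n] ⟨P.start A + (ρ : ℂ) * P.ray A m σ, -P.ray A m β, e⟩ =
        ⟨P.start A + (ρ' : ℂ) * P.ray A (m + n) σ',
          -P.ray A (m + n) (β + n * P.interiorAngle A), e'⟩ ∧
      ∀ j < n, (P.step^[j + 1] ⟨P.start A + (ρ : ℂ) * P.ray A m σ, -P.ray A m β, e⟩).edge =
        alternatingLetter A B (m + j) := by
  induction n generalizing m σ β with
  | zero =>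
    refine ⟨δ, hδ, fun ρ h0 h1 e => ⟨ρ, σ, e, h0, h1, hσ0, hσ1, ?_, ?_, ?_, ?_⟩⟩
    · simpa using hσβ
    · simpa using hβσ
    · simp
    · intro j hj; exact absurd hj (Nat.not_lt_zero j)
  | succ n ih =>
    have hθ0 : 0 < P.interiorAngle A := interiorAngle_pos hAB
    -- After this bounce the point lies on the `m`-th letter, that is, at the angle `θ` from the
    -- next one. This is why the induction allows `σ = θ`.
    have hβ : β < Real.pi := by simpa using hn 0 (Nat.succ_pos n)
    obtain ⟨ρ₁, hρ₁, H⟩ := ih (m := m + 1) (σ := P.interiorAngle A) (β := β + P.interiorAngle A)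
      hθ0 le_rfl (by linarith) (by linarith) (fun j hj => by
        have := hn (j + 1) (by omega)
        push_cast at this; linarith)
    have hsβ : 0 < Real.sin β := Real.sin_pos_of_pos_of_lt_pi (by linarith) (by linarith)
    have hsβσ : 0 < Real.sin (β - σ) := Real.sin_pos_of_pos_of_lt_pi (by linarith) (by linarith)
    have hr0 := hr.pos
    -- This makes the distance `ρ sin (β - σ) / sin β` of the bounce from the vertex smaller than
    -- `r` and than the radius for the remaining bounces.
    refine ⟨min r (min r ρ₁ * Real.sin β / Real.sin (β - σ)), by positivity,
      fun ρ h0 h1 e => ?_⟩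
    have h2 := h1.trans_le (min_le_left _ _)
    have h3 := h1.trans_le (min_le_right _ _)
    rw [lt_div_iff₀ hsβσ, ← div_lt_iff₀ hsβ] at h3
    have h4 := h3.trans_le (min_le_left _ _)
    have h5 := h3.trans_le (min_le_right _ _)
    have hreach := hr.reaches (m := m) hAB hσ0 hσ1 hσβ hβ h0 h2 h4
    have hstep := hreach.step_eq e
    have heq := ray_mul_sub_eq (P := P) A m (σ := σ) (ρ := ρ) hsβ.ne'
    rw [add_assoc, heq, reflectAlong_neg, reflectAlong_ray hAB] at hstep
    have e1 : P.ray A m 0 = P.ray A (m + 1) (P.interiorAngle A) := by rw [ray_succ, sub_self]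
    have e2 : P.ray A m (-β) = P.ray A (m + 1) (β + P.interiorAngle A) := by
      rw [ray_succ]; congr 1; ring
    rw [e1, e2] at hstep
    obtain ⟨ρ', σ', e', q0, q1, q2, q3, q4, q5, q6, q7⟩ :=
      H _ (by positivity) h5 (alternatingLetter A B m)
    have e3 : β + ((n + 1 : ℕ) : ℝ) * P.interiorAngle A =
        β + P.interiorAngle A + n * P.interiorAngle A := by push_cast; ring
    refine ⟨ρ', σ', e', q0, q1, q2, q3, by rwa [e3], by rwa [e3], ?_, ?_⟩
    · rw [Function.iterate_succ_apply, hstep, q6, e3, add_right_comm m, add_assoc m]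
    · intro j hj
      rw [Function.iterate_succ_apply, hstep]
      rcases j with _ | j
      · rfl
      · rw [q7 j (by omega)]; congr 1; ring

/-- The edges hit by the ray from the vertex. -/
noncomputable def rayEdge (P : BilliardTable 𝒜) (A : 𝒜) (m : ℕ) (s : ℝ) (j : ℕ) : 𝒜 :=
  (P.step^[j + 1] ⟨P.start A, P.ray A m s, A⟩).edge

theorem IsCornerRadius.isGood {r : ℝ} (hr : P.IsCornerRadius A B r) {m : ℕ} {γ : ℝ} (hγ0 : 0 < γ)
    (hγ1 : γ < P.interiorAngle A)
    (h : ∀ t : ℝ, 0 < t → P.start A + (t : ℂ) * P.ray A m γ ∉ P.unfoldedVertices) :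
    P.IsGood ⟨P.start A, P.ray A m γ, A⟩ := by
  refine ⟨P.norm_ray A m γ, ?_, h⟩
  filter_upwards [Ioo_mem_nhdsGT hr.pos] with t ht
  exact hr.mem_interior m t γ ht.1 ht.2 hγ0 hγ1

/-- `A` and `B` lie at the angles `0` and `θ`, so a ray strictly between them meets these edges only
at the vertex. This supplies the neighbour condition of an empty insertion. -/
theorem rayEdge_zero_ne (hAB : P.next B = A) {m : ℕ} {γ : ℝ} (hγ0 : 0 < γ)
    (hγ1 : γ < P.interiorAngle A) (h : P.IsGood ⟨P.start A, P.ray A m γ, A⟩) :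
    P.rayEdge A m γ 0 ≠ A ∧ P.rayEdge A m γ 0 ≠ B := by
  obtain ⟨L, e, hr⟩ := h.exists_reaches
  have hE : P.rayEdge A m γ 0 = e := by
    show (P.step _).edge = e
    rw [hr.step_eq]
  have hθ := P.interiorAngle_lt A
  have key : ∀ k, e ≠ alternatingLetter A B k := by
    have h1 : ∀ s : ℝ, 0 ≤ s → s ≤ P.interiorAngle A → s ≠ γ → ∀ ρ : ℝ, 0 ≤ ρ →
        P.start A + (L : ℂ) * P.ray A m γ ≠ P.start A + (ρ : ℂ) * P.ray A m s := by
      intro s hs0 hs1 hsγ ρ hρ heq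
      have hL := hr.pos
      rcases hρ.eq_or_lt with rfl | hρ
      · have := hr.mem_openSide
        rw [show P.start A + (L : ℂ) * P.ray A m γ = P.start A by rw [heq]; simp] at this
        exact P.start_notMem_openSide _ _ this
      · exact hsγ (P.eq_of_mul_ray_eq hL hρ (by rw [abs_lt]; constructor <;> linarith)
          (add_left_cancel heq)).symm
    have h0 : ∀ k s, (P.ray A k 0 = P.ray A m s) → 0 ≤ s → s ≤ P.interiorAngle A → s ≠ γ →
        e ≠ alternatingLetter A B k := by
      rintro k s hks hs0 hs1 hsγ rfl
      obtain ⟨ρ, hρ, heq⟩ := exists_eq_add_ray_of_mem_side hAB k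
        (P.openSide_subset_side _ hr.mem_openSide)
      rw [hks] at heq
      exact h1 s hs0 hs1 hsγ ρ hρ heq
    intro k
    have e1 : (∀ s, P.ray A m s = P.ray A k s) ∨
        ∀ s, P.ray A m s = P.ray A k (P.interiorAngle A - s) := by
      by_cases hm : Even m <;> by_cases hk : Even k
      · left; simp [ray, hm, hk]
      · right; simp [ray, hm, hk]
      · right; simp [ray, hm, hk]
      · left; simp [ray, hm, hk]
    rcases e1 with h2 | h2
    · exact h0 k 0 (h2 0).symm le_rfl (by linarith) hγ0.ne
    · exact h0 k (P.interiorAngle A) (by rw [h2, sub_self]) (by linarith) le_rfl hγ1.ne'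
  rw [hE]
  exact ⟨by simpa [alternatingLetter] using key 0, by simpa [alternatingLetter] using key 1⟩

/-- Rays that start close to the vertex hit the same edges as the parallel ray from the vertex. -/
theorem IsCornerRadius.exists_edge_eq_rayEdge [Finite 𝒜] {r : ℝ} (hr : P.IsCornerRadius A B r)
    {m : ℕ} {γ : ℝ} (hγ0 : 0 < γ) (hγ1 : γ < P.interiorAngle A)
    (h : P.IsGood ⟨P.start A, P.ray A m γ, A⟩) (N : ℕ) : ∃ δ > 0, ∀ (ρ σ : ℝ) (e : 𝒜), 0 < ρ →
      ρ < δ → 0 ≤ σ → σ ≤ P.interiorAngle A → |σ - γ| < Real.pi →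
      P.IsGood ⟨P.start A + (ρ : ℂ) * P.ray A m σ, P.ray A m γ, e⟩ → ∀ j < N,
        (P.step^[j + 1] ⟨P.start A + (ρ : ℂ) * P.ray A m σ, P.ray A m γ, e⟩).edge =
          P.rayEdge A m γ j := by
  have hr0 := hr.pos
  set u := r / 2 with hu
  have hu0 : 0 < u := by positivity
  have hx : P.start A + (u : ℂ) * P.ray A m γ ∈ interior P.region :=
    hr.mem_interior m u γ hu0 (by linarith) hγ0 hγ1
  -- Both rays are slid by the same distance `u` into the interior, where continuity in the starting
  -- point is available.
  obtain ⟨hg, hs⟩ := h.slide (e' := A) hu0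
    fun t h0 h1 => hr.mem_interior m t γ h0 (by linarith) hγ0 hγ1
  obtain ⟨δ, hδ, hev⟩ := Metric.eventually_nhds_iff.1 (hg.eventually_edge_eq N hx)
  refine ⟨min δ u, by positivity, fun ρ σ e h0 h1 hσ0 hσ1 hσγ hgood j hj => ?_⟩
  have h2 := h1.trans_le (min_le_left _ _)
  have h3 := h1.trans_le (min_le_right _ _)
  obtain ⟨hg', hs'⟩ := hgood.slide (e' := A) hu0 fun t ht0 ht1 =>
    hr.add_mem_interior hσ0 hσ1 hγ0 hγ1 hσγ h0 ht0 (by linarith)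
  have hd : dist (P.start A + (ρ : ℂ) * P.ray A m σ + (u : ℂ) * P.ray A m γ)
      (P.start A + (u : ℂ) * P.ray A m γ) < δ := by
    have : P.start A + (ρ : ℂ) * P.ray A m σ + (u : ℂ) * P.ray A m γ -
      (P.start A + (u : ℂ) * P.ray A m γ) = (ρ : ℂ) * P.ray A m σ := by ring
    rw [dist_eq_norm, this, norm_mul, norm_ray, mul_one, Complex.norm_real,
      Real.norm_of_nonneg h0.le]
    exact h2
  have := hev hd hg' j hj
  rw [Function.iterate_succ_apply, Function.iterate_succ_apply, hs', hs] at this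
  rw [rayEdge, Function.iterate_succ_apply, Function.iterate_succ_apply, this]

/-- All but countably many parallel lines avoid the unfolded vertices. -/
theorem exists_isGood_isGood_neg [Finite 𝒜] {r : ℝ} (hr : P.IsCornerRadius A B r) {m : ℕ}
    {σ β ρ₀ : ℝ} (hσ0 : 0 < σ) (hσ1 : σ < P.interiorAngle A) (hσβ : σ < β) (hβσ : β < σ + Real.pi)
    (hρ₀ : 0 < ρ₀) : ∃ ρ : ℝ, 0 < ρ ∧ ρ < ρ₀ ∧
      P.start A + (ρ : ℂ) * P.ray A m σ ∈ interior P.region ∧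
      P.IsGood ⟨P.start A + (ρ : ℂ) * P.ray A m σ, P.ray A m β, A⟩ ∧
      P.IsGood ⟨P.start A + (ρ : ℂ) * P.ray A m σ, -P.ray A m β, A⟩ := by
  set c := crossIm (P.ray A m β) (P.ray A m σ) with hc
  have hc0 : c ≠ 0 := by
    have : 0 < Real.sin (β - σ) := Real.sin_pos_of_pos_of_lt_pi (by linarith) (by linarith)
    rw [← neg_sub, Real.sin_neg] at this
    rw [hc, crossIm_ray]
    split_ifs <;> intro h <;> linarith
  -- This function is constant on lines parallel to `ray β` and takes the value `ρ` on the line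
  -- considered, so only countably many `ρ` give a line through an unfolded vertex.
  have hbad : ((fun z => crossIm (P.ray A m β) (z - P.start A) / c) ''
      P.unfoldedVertices).Countable := P.countable_unfoldedVertices.image _
  obtain ⟨ρ, hρ, hρ0, hρ1⟩ := (hbad.dense_compl ℝ).exists_between (lt_min hρ₀ hr.pos)
  have hline : ∀ t : ℝ, P.start A + (ρ : ℂ) * P.ray A m σ + (t : ℂ) * P.ray A m β ∉
      P.unfoldedVertices := by
    intro t ht
    refine hρ ⟨_, ht, ?_⟩
    have : P.start A + (ρ : ℂ) * P.ray A m σ + (t : ℂ) * P.ray A m β - P.start A =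
      (ρ : ℂ) * P.ray A m σ + (t : ℂ) * P.ray A m β := by ring
    dsimp only
    rw [this, crossIm_add_right, crossIm_smul_right, crossIm_smul_right, crossIm_self, mul_zero,
      add_zero, mul_div_assoc, ← hc, div_self hc0, mul_one]
  have hint : P.start A + (ρ : ℂ) * P.ray A m σ ∈ interior P.region :=
    hr.mem_interior m ρ σ hρ0 (hρ1.trans_le (min_le_right _ _)) hσ0 hσ1
  have hinw : ∀ d : ℂ, ∀ᶠ t : ℝ in nhdsWithin 0 (Set.Ioi 0),
      P.start A + (ρ : ℂ) * P.ray A m σ + (t : ℂ) * d ∈ interior P.region := by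
    intro d
    refine Filter.Eventually.filter_mono nhdsWithin_le_nhds ?_
    have hcont : Continuous (fun t : ℝ => P.start A + (ρ : ℂ) * P.ray A m σ + (t : ℂ) * d) := by
      fun_prop
    have := hcont.tendsto 0
    simp only [Complex.ofReal_zero, zero_mul, add_zero] at this
    exact this.eventually (isOpen_interior.mem_nhds hint)
  refine ⟨ρ, hρ0, hρ1.trans_le (min_le_left _ _), hint,
    ⟨P.norm_ray A m β, hinw _, fun t _ => hline t⟩,
    ⟨(norm_neg _).trans (P.norm_ray A m β), hinw _, fun t _ => ?_⟩⟩
  have := hline (-t)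
  rw [Complex.ofReal_neg, neg_mul, ← mul_neg] at this
  exact this

/-- A trajectory that comes in along one ray from the vertex, turns about the vertex by the angle `π`,
and leaves along another ray. -/
theorem IsCornerRadius.exists_trajectory_turning [Finite 𝒜] {r : ℝ} (hAB : P.next B = A)
    (hr : P.IsCornerRadius A B r) {m n : ℕ} {β γ : ℝ} (hβ0 : 0 < β) (hβ1 : β < P.interiorAngle A)
    (hγ0 : 0 < γ) (hγ1 : γ < P.interiorAngle A) (hβγ : γ = β + n * P.interiorAngle A - Real.pi)
    (hgβ : P.IsGood ⟨P.start A, P.ray A m β, A⟩)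
    (hgγ : P.IsGood ⟨P.start A, P.ray A (m + n) γ, A⟩) (N : ℕ) {ε : ℝ} (hε : 0 < ε) :
    ∃ τ : P.Trajectory,
      (∀ j < N, τ.edge (-1 - j) = P.rayEdge A m β j) ∧
      (∀ j < n, τ.edge j = alternatingLetter A B (m + j)) ∧
      (∀ j < N, τ.edge (n + j) = P.rayEdge A (m + n) γ j) ∧
      (n = 0 → ∃ q ∈ openSegment ℝ (τ.point (-1)) (τ.point 0), dist q (P.start A) < ε ∧
        (alternatingLetter A B m = B →
          0 < ((starRingEnd ℂ) (τ.dir (-1)) * (P.start A - q)).im) ∧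
        (alternatingLetter A B m = A →
          ((starRingEnd ℂ) (τ.dir (-1)) * (P.start A - q)).im < 0)) := by
  have hθ := P.interiorAngle_lt A
  have hπ := Real.pi_pos
  -- Any `σ` in the range gives a transversal through the parallel lines. If `n = 0`, then `β > π`,
  -- and `σ = β - π / 2` makes the point the foot of the perpendicular from the vertex, so the side
  -- of `p` can be read off.
  obtain ⟨σ, hσ0, hσ1, hσβ, hβσ, hσn⟩ : ∃ σ, 0 < σ ∧ σ < P.interiorAngle A ∧ σ < β ∧
      β < σ + Real.pi ∧ (n = 0 → σ = β - Real.pi / 2) := by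
    rcases lt_or_ge β Real.pi with h | h
    · refine ⟨β / 2, by linarith, by linarith, by linarith, by linarith, ?_⟩
      rintro rfl
      simp at hβγ; linarith
    · exact ⟨β - Real.pi / 2, by linarith, by linarith, by linarith, by linarith, fun _ => rfl⟩
  obtain ⟨δ₁, hδ₁, H₁⟩ := hr.exists_edge_eq_rayEdge hβ0 hβ1 hgβ N
  obtain ⟨δ₂, hδ₂, H₂⟩ := hr.exists_edge_eq_rayEdge hγ0 hγ1 hgγ N
  have hn : ∀ j < n, β + j * P.interiorAngle A < Real.pi := by
    intro j hj
    have : ((j + 1 : ℕ) : ℝ) ≤ n := by exact_mod_cast hj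
    push_cast at this
    nlinarith
  obtain ⟨δ₃, hδ₃, H₃⟩ := hr.exists_iterate_step hAB n hδ₂ (m := m) hσ0 hσ1.le hσβ hβσ hn
  obtain ⟨ρ, hρ0, hρ1, hint, hg, hg'⟩ := exists_isGood_isGood_neg hr (m := m) hσ0 hσ1 hσβ hβσ
    (lt_min hδ₁ (lt_min hδ₃ hε))
  have h1 := hρ1.trans_le (min_le_left _ _)
  have h2 := hρ1.trans_le ((min_le_right _ _).trans (min_le_left _ _))
  have h3 := hρ1.trans_le ((min_le_right _ _).trans (min_le_right _ _))
  obtain ⟨ρ', σ', e', q0, q1, q2, q3, q4, q5, q6, q7⟩ := H₃ ρ hρ0 h2 A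
  have hγ' : -P.ray A (m + n) (β + n * P.interiorAngle A) = P.ray A (m + n) γ := by
    rw [hβγ, ray_sub_pi]
  rw [hγ'] at q6
  have hgn := hg'.iterate n
  rw [q6] at hgn
  obtain ⟨τ, hτ, hτ', hdir, hq⟩ := exists_trajectory hint hg' (by rwa [neg_neg])
  rw [neg_neg] at hτ'
  refine ⟨τ, fun j hj => ?_, fun j hj => ?_, fun j hj => ?_, fun h0 => ?_⟩
  · rw [hτ' j, H₁ ρ σ A hρ0 h1 hσ0.le hσ1.le (by rw [abs_lt]; constructor <;> linarith) hg j hj]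
  · rw [hτ j, q7 j hj]
  · have e1 := hτ (n + j)
    push_cast at e1
    rw [e1, show n + j + 1 = (j + 1) + n by ring, Function.iterate_add_apply, q6]
    exact H₂ ρ' σ' e' q0 q1 q2.le q3 (by rw [abs_lt]; constructor <;> linarith) hgn j hj
  · have hs : Real.sin (σ - β) = -1 := by
      rw [hσn h0, show β - Real.pi / 2 - β = -(Real.pi / 2) by ring, Real.sin_neg,
        Real.sin_pi_div_two]
    have hc : ((starRingEnd ℂ) (τ.dir (-1)) * (P.start A -
        (P.start A + (ρ : ℂ) * P.ray A m σ))).im = ρ * crossIm (P.ray A m β) (P.ray A m σ) := by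
      rw [← crossIm_eq, hdir]; simp [crossIm]; ring
    have hne := ne_of_next_eq hAB
    refine ⟨_, hq, ?_, fun hB => ?_, fun hA => ?_⟩
    · rw [dist_eq_norm, add_sub_cancel_left, norm_mul, norm_ray, mul_one, Complex.norm_real,
        Real.norm_of_nonneg hρ0.le]
      exact h3
    · have hm : ¬Even m := fun hm => hne (by simpa [alternatingLetter, hm] using hB)
      rw [hc, crossIm_ray, if_neg hm, hs]; linarith
    · have hm : Even m := by
        by_contra hm
        exact hne (by simpa [alternatingLetter, hm] using hA.symm)
      rw [hc, crossIm_ray, if_pos hm, hs]; linarith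

/-- For fixed `M` and `i`, different `b` in `(0, θ)` give rays that meet only at the vertex, so each
unfolded vertex excludes at most one `b`. The nonvanishing condition excludes one more. -/
theorem exists_generic_angle [Finite 𝒜] (hAB : P.next B = A) : ∃ b, 0 < b ∧ b < P.interiorAngle A ∧
    ∀ M i : ℕ, b + M * P.interiorAngle A - i * Real.pi ≠ 0 ∧ ∀ t : ℝ, 0 < t →
      P.start A + (t : ℂ) * P.ray A M (b + M * P.interiorAngle A - i * Real.pi) ∉
        P.unfoldedVertices := by
  have hθ := P.interiorAngle_lt A
  let bad : ℕ → ℕ → Set ℝ := fun M i => {i * Real.pi - M * P.interiorAngle A} ∪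
    ⋃ z ∈ P.unfoldedVertices, {b | b ∈ Set.Ioo 0 (P.interiorAngle A) ∧ ∃ t : ℝ, 0 < t ∧
      P.start A + (t : ℂ) * P.ray A M (b + M * P.interiorAngle A - i * Real.pi) = z}
  have hbad : (⋃ M, ⋃ i, bad M i).Countable := by
    refine Set.countable_iUnion fun M => Set.countable_iUnion fun i =>
      (Set.countable_singleton _).union (P.countable_unfoldedVertices.biUnion fun z _ =>
        Set.Subsingleton.countable ?_)
    rintro b ⟨⟨hb0, hb1⟩, t, ht, hbt⟩ b' ⟨⟨hb0', hb1'⟩, t', ht', hbt'⟩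
    have := P.eq_of_mul_ray_eq ht ht' (by rw [abs_lt]; constructor <;> linarith)
      (add_left_cancel (hbt.trans hbt'.symm))
    linarith
  obtain ⟨b, hb, hb0, hb1⟩ := (hbad.dense_compl ℝ).exists_between (interiorAngle_pos hAB)
  refine ⟨b, hb0, hb1, fun M i => ⟨fun h => hb ?_, fun t ht hmem => hb ?_⟩⟩
  · refine Set.mem_iUnion.2 ⟨M, Set.mem_iUnion.2 ⟨i, Or.inl ?_⟩⟩
    rw [Set.mem_singleton_iff]; linarith
  · exact Set.mem_iUnion.2 ⟨M, Set.mem_iUnion.2 ⟨i, Or.inr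
      (Set.mem_biUnion hmem ⟨⟨hb0, hb1⟩, t, ht, rfl⟩)⟩⟩

end BilliardTable

/-! ### The infinite list of matching sequences -/

namespace BilliardTable

variable {𝒜 : Type*} {P : BilliardTable 𝒜} {A B : 𝒜}

/-- The bi-infinite word that consists of `a` read backwards, the first `n` letters of `w`, and `b`. -/
def spliceWord (a w b : ℕ → 𝒜) (n : ℕ) (j : ℤ) : 𝒜 :=
  if j < 0 then a (-1 - j).toNat else if j < n then w j.toNat else b (j - n).toNat

theorem spliceWord_neg (a w b : ℕ → 𝒜) (n j : ℕ) : spliceWord a w b n (-1 - j) = a j := by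
  rw [spliceWord, if_pos (by omega)]; congr 1; omega

theorem spliceWord_of_lt (a w b : ℕ → 𝒜) {n j : ℕ} (h : j < n) :
    spliceWord a w b n j = w j := by
  rw [spliceWord, if_neg (by omega), if_pos (by omega)]; congr 1

theorem spliceWord_add (a w b : ℕ → 𝒜) (n j : ℕ) : spliceWord a w b n (n + j) = b j := by
  rw [spliceWord, if_neg (by omega), if_neg (by omega)]; congr 1; omega

theorem eq_spliceWord {a w b : ℕ → 𝒜} {n N : ℕ} {f : ℤ → 𝒜} (ha : ∀ j < N, f (-1 - j) = a j)
    (hw : ∀ j < n, f j = w j) (hb : ∀ j < N, f (n + j) = b j) (j : ℤ) (h0 : -(N : ℤ) ≤ j)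
    (h1 : j < n + N) : f j = spliceWord a w b n j := by
  rcases lt_or_ge j 0 with h | h
  · obtain ⟨i, rfl⟩ : ∃ i : ℕ, j = -1 - i := ⟨(-1 - j).toNat, by omega⟩
    rw [spliceWord_neg, ha i (by omega)]
  · rcases lt_or_ge j n with h' | h'
    · obtain ⟨i, rfl⟩ : ∃ i : ℕ, j = i := ⟨j.toNat, by omega⟩
      rw [spliceWord_of_lt _ _ _ (by omega), hw i (by omega)]
    · obtain ⟨i, rfl⟩ : ∃ i : ℕ, j = n + i := ⟨(j - n).toNat, by omega⟩
      rw [spliceWord_add, hb i (by omega)]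

theorem mem_closure_bounceSpectrum [TopologicalSpace 𝒜] {s : ℤ → 𝒜}
    (h : ∀ N : ℕ, ∃ τ : P.Trajectory, ∀ j : ℤ, -(N : ℤ) ≤ j → j < N → τ.edge j = s j) :
    s ∈ closure P.bounceSpectrum := by
  rw [mem_closure_iff]
  intro o ho hs
  obtain ⟨I, u, hu, hI⟩ := isOpen_pi_iff.1 ho s hs
  obtain ⟨τ, hτ⟩ := h (I.sup Int.natAbs + 1)
  refine ⟨τ.edge, hI fun j hj => ?_, τ, rfl⟩
  have : j.natAbs ≤ I.sup Int.natAbs := Finset.le_sup (f := Int.natAbs) hj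
  rw [hτ j (by omega) (by omega)]
  exact (hu j hj).2

/-- How many letters of the corner are crossed when one turns by `π`, starting at the angle `β`. -/
noncomputable def turningLength (P : BilliardTable 𝒜) (A : 𝒜) (β : ℝ) : ℕ :=
  ⌈(Real.pi - β) / P.interiorAngle A⌉₊

/-- The number of letters crossed and the angle before the `i`-th turn by `π`. -/
noncomputable def turningState (P : BilliardTable 𝒜) (A : 𝒜) (b : ℝ) : ℕ → ℕ × ℝ
  | 0 => (0, b)
  | i + 1 => ((turningState P A b i).1 + P.turningLength A (turningState P A b i).2,
      (turningState P A b i).2 +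
        P.turningLength A (turningState P A b i).2 * P.interiorAngle A - Real.pi)

theorem turningState_snd (P : BilliardTable 𝒜) (A : 𝒜) (b : ℝ) (i : ℕ) :
    (P.turningState A b i).2 =
      b + (P.turningState A b i).1 * P.interiorAngle A - i * Real.pi := by
  induction i with
  | zero => simp [turningState]
  | succ i ih => rw [turningState]; dsimp only; rw [ih]; push_cast; ring

/-- The ceiling is the least number of steps `θ` that carries `β` to `π` or beyond, so the overshoot
is less than `θ`. For `β > π` it is `0`, and the overshoot `β - π` is already less than `θ`. -/
theorem turning_bounds (hAB : P.next B = A) {β : ℝ} (hβ1 : β < P.interiorAngle A) :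
    0 ≤ β + P.turningLength A β * P.interiorAngle A - Real.pi ∧
      β + P.turningLength A β * P.interiorAngle A - Real.pi < P.interiorAngle A := by
  have hθ0 : 0 < P.interiorAngle A := interiorAngle_pos hAB
  have h1 := Nat.le_ceil ((Real.pi - β) / P.interiorAngle A)
  rw [div_le_iff₀ hθ0] at h1
  refine ⟨by rw [turningLength]; linarith, ?_⟩
  rcases le_or_gt β Real.pi with h | h
  · have h2 := Nat.ceil_lt_add_one (div_nonneg (sub_nonneg.2 h) hθ0.le)
    have h3 := mul_lt_mul_of_pos_right h2 hθ0
    rw [add_mul, one_mul, div_mul_cancel₀ _ hθ0.ne'] at h3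
    rw [turningLength]; linarith
  · have : P.turningLength A β = 0 :=
      Nat.ceil_eq_zero.2 (div_nonpos_of_nonpos_of_nonneg (by linarith) hθ0.le)
    rw [this, Nat.cast_zero, zero_mul]
    linarith [Real.pi_pos]

/-- Since `β` lies strictly between `0` and `θ`, the quotients `(π - β) / θ` and `π / θ` differ by
less than `1`, so the ceilings differ by at most `1`. This gives the two admissible lengths, `k`
being the ceiling of `π / θ`. -/
theorem turningLength_eq (hAB : P.next B = A) {β : ℝ} (hβ0 : 0 < β)
    (hβ1 : β < P.interiorAngle A) :
    P.turningLength A β = ⌈Real.pi / P.interiorAngle A⌉₊ - 1 ∨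
      P.turningLength A β = ⌈Real.pi / P.interiorAngle A⌉₊ := by
  have hθ0 : 0 < P.interiorAngle A := interiorAngle_pos hAB
  have h1 : P.turningLength A β ≤ ⌈Real.pi / P.interiorAngle A⌉₊ :=
    Nat.ceil_mono (by gcongr; linarith)
  have h2 : ⌈Real.pi / P.interiorAngle A⌉₊ ≤ P.turningLength A β + 1 := by
    rw [Nat.ceil_le]
    have := (turning_bounds hAB hβ1).1
    rw [div_le_iff₀ hθ0]; push_cast
    linarith
  omega

theorem turningState_mem (hAB : P.next B = A) {b : ℝ} (hb0 : 0 < b) (hb1 : b < P.interiorAngle A)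
    (hb : ∀ M i : ℕ, b + M * P.interiorAngle A - i * Real.pi ≠ 0) (i : ℕ) :
    0 < (P.turningState A b i).2 ∧ (P.turningState A b i).2 < P.interiorAngle A := by
  induction i with
  | zero => exact ⟨hb0, hb1⟩
  | succ i ih =>
    obtain ⟨h1, h2⟩ := turning_bounds hAB ih.2
    refine ⟨lt_of_le_of_ne h1 fun h => ?_, h2⟩
    refine hb _ (i + 1) ((P.turningState_snd A b (i + 1)).symm.trans h.symm)

/-- The sequence that follows one ray from the vertex inwards, turns about the vertex by the angle
`π`, and follows another ray outwards. -/
noncomputable def turningSequence (P : BilliardTable 𝒜) (A B : 𝒜) (b : ℝ) (i : ℕ) :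
    InsertedSequence 𝒜 where
  seq := spliceWord (P.rayEdge A (P.turningState A b i).1 (P.turningState A b i).2)
    (fun j => alternatingLetter A B ((P.turningState A b i).1 + j))
    (P.rayEdge A (P.turningState A b (i + 1)).1 (P.turningState A b (i + 1)).2)
    (P.turningLength A (P.turningState A b i).2)
  pos := 0
  len := P.turningLength A (P.turningState A b i).2

theorem turningSequence_neg (P : BilliardTable 𝒜) (A B : 𝒜) (b : ℝ) (i n : ℕ) :
    (P.turningSequence A B b i).seq (-1 - n) =
      P.rayEdge A (P.turningState A b i).1 (P.turningState A b i).2 n := by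
  simp only [turningSequence, spliceWord_neg]

theorem turningSequence_add (P : BilliardTable 𝒜) (A B : 𝒜) (b : ℝ) (i n : ℕ) :
    (P.turningSequence A B b i).seq ((P.turningSequence A B b i).len + n) =
      P.rayEdge A (P.turningState A b (i + 1)).1 (P.turningState A b (i + 1)).2 n := by
  simp only [turningSequence, spliceWord_add]

theorem turningSequence_of_lt (P : BilliardTable 𝒜) (A B : 𝒜) (b : ℝ) {i j : ℕ}
    (h : j < (P.turningSequence A B b i).len) : (P.turningSequence A B b i).seq j =
      alternatingLetter A B ((P.turningState A b i).1 + j) := by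
  simp only [turningSequence] at h ⊢
  exact spliceWord_of_lt _ _ _ h

theorem turningSequence_pos (P : BilliardTable 𝒜) (A B : 𝒜) (b : ℝ) (i : ℕ) :
    (P.turningSequence A B b i).pos = 0 := rfl

theorem totalInsertion_turningSequence (P : BilliardTable 𝒜) (A B : 𝒜) (b : ℝ) (i : ℕ) :
    totalInsertion (P.turningSequence A B b) i = (P.turningState A b i).1 := by
  induction i with
  | zero => simp [totalInsertion, turningState]
  | succ i ih => rw [totalInsertion_succ, ih]; rfl

/-- The turning states chain up: the outgoing ray of one sequence is the incoming ray of the next,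
with the same letter count and angle. The alternation starts with `A`, so `o = 0`. -/
theorem exists_isMatching [Finite 𝒜] [TopologicalSpace 𝒜] (hAB : P.next B = A) :
    ∃ S : ℕ → InsertedSequence 𝒜, ∀ ℓ : ℕ, P.IsMatching A B ℓ S := by
  obtain ⟨b, hb0, hb1, hb⟩ := P.exists_generic_angle hAB
  obtain ⟨r, hr⟩ := exists_isCornerRadius hAB
  have hmem := P.turningState_mem hAB hb0 hb1 fun M i => (hb M i).1
  have hgood : ∀ i, P.IsGood
      ⟨P.start A, P.ray A (P.turningState A b i).1 (P.turningState A b i).2, A⟩ := by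
    intro i
    refine hr.isGood (hmem i).1 (hmem i).2 fun t ht => ?_
    rw [turningState_snd]
    exact (hb _ i).2 t ht
  have htraj := fun i N {ε : ℝ} (hε : 0 < ε) => hr.exists_trajectory_turning hAB
    (n := P.turningLength A (P.turningState A b i).2) (hmem i).1 (hmem i).2 (hmem (i + 1)).1
    (hmem (i + 1)).2 rfl (hgood i) (hgood (i + 1)) N hε
  refine ⟨P.turningSequence A B b, fun ℓ => ⟨fun i _ => ?_, ⟨⌈Real.pi / P.interiorAngle A⌉₊,
    Nat.ceil_pos.2 (div_pos Real.pi_pos (interiorAngle_pos hAB)),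
    fun i _ => turningLength_eq hAB (hmem i).1 (hmem i).2⟩, ⟨0, fun i _ => ⟨fun j hj => ?_, fun h0 => ?_⟩⟩,
    fun i _ n => ?_⟩⟩
  · refine mem_closure_bounceSpectrum fun N => ?_
    obtain ⟨τ, h1, h2, h3, -⟩ := htraj i N one_pos
    exact ⟨τ, fun j hj0 hj1 => eq_spliceWord h1 h2 h3 j hj0 (by omega)⟩
  · rw [totalInsertion_turningSequence, zero_add]
    rw [turningSequence_pos, zero_add, turningSequence_of_lt _ _ _ _ hj]
  · rw [totalInsertion_turningSequence, zero_add]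
    have hn : P.turningLength A (P.turningState A b i).2 = 0 := h0
    have e0 : (P.turningSequence A B b i).seq ((P.turningSequence A B b i).pos - 1) =
        P.rayEdge A (P.turningState A b i).1 (P.turningState A b i).2 0 :=
      P.turningSequence_neg A B b i 0
    have e1 : (P.turningSequence A B b i).seq (P.turningSequence A B b i).pos =
        P.rayEdge A (P.turningState A b (i + 1)).1 (P.turningState A b (i + 1)).2 0 := by
      rw [← P.turningSequence_add A B b i 0, h0, turningSequence_pos]; rfl
    have h1 := rayEdge_zero_ne hAB (hmem i).1 (hmem i).2 (hgood i)
    have h2 := rayEdge_zero_ne hAB (hmem (i + 1)).1 (hmem (i + 1)).2 (hgood (i + 1))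
    refine ⟨e0 ▸ h1.1, e0 ▸ h1.2, e1 ▸ h2.1, e1 ▸ h2.2, fun n ε hε => ?_⟩
    obtain ⟨τ, h1, h2, h3, h4⟩ := htraj i n hε
    refine ⟨τ, fun j hj0 hj1 => ?_, h4 hn⟩
    rw [turningSequence_pos, zero_add]
    exact eq_spliceWord h1 h2 h3 j hj0 (by omega)
  · rw [turningSequence_pos, turningSequence_pos, zero_add, zero_sub, turningSequence_add,
      turningSequence_neg]

end BilliardTable

theorem mainTheorem6 {𝒜 : Type*} [Finite 𝒜] [TopologicalSpace 𝒜] [DiscreteTopology 𝒜]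
    (P : BilliardTable 𝒜) (A B : 𝒜) (hAB : P.next B = A) :
    (∃ S : ℕ → InsertedSequence 𝒜, ∀ ℓ : ℕ, P.IsMatching A B ℓ S) ∧
    ∀ ε > (0 : ℝ), ∃ L : ℕ, ∀ ℓ ≥ L, ∀ S : ℕ → InsertedSequence 𝒜, P.IsMatching A B ℓ S →
      0 < totalInsertion S ℓ ∧
      |Real.pi * ((ℓ : ℝ) / (totalInsertion S ℓ : ℝ)) - P.interiorAngle A| < ε ∧
      Real.pi * ((ℓ : ℝ) / (totalInsertion S ℓ : ℝ)) =
        Real.pi / ((totalInsertion S ℓ : ℝ) / (ℓ : ℝ)) := by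
  refine ⟨BilliardTable.exists_isMatching hAB, fun ε hε => ?_⟩
  obtain ⟨L, hL⟩ := BilliardTable.exists_abs_sub_interiorAngle_lt hAB hε
  refine ⟨L, fun ℓ hℓ S hS => ⟨(hL ℓ hℓ S hS).1, (hL ℓ hℓ S hS).2, ?_⟩⟩
  -- The identity holds under the conventions for division by zero, so no case distinction is
  -- needed.
  rw [div_div_eq_mul_div, mul_div_assoc]
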